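/- **Setting.** Let $(M,I,\omega,\Omega)$ be a connected Calabi–Yau manifold of complex dimension $n$: a complex manifold with a Kähler form $\omega$ (Kähler metric $g(u,v)=\omega(u,Iv)$) and a nowhere vanishing holomorphic $n$-form $\Omega$ such that $\frac{\omega^n}{n!}=(-1)^{n(n-1)/2}\left(\frac{\sqrt{-1}}2\right)^n\Omega\wedge\overline\Omega$. Let $H$ be a connected Lie group with Lie algebra $\mathfrak h$, acting smoothly on $M$ and preserving $I$. For $\xi\in\mathfrak h$ let $\xi^\#_p=\frac{d}{dt}\big|_{t=0}\exp(t\xi)p$. Let $\mu:M\to\mathfrak h^*$ be a moment map, that is, $\langle\mu(hp),\xi\rangle=\langle\mu(p),\mathrm{Ad}_{h^{-1}}\xi\rangle$ and $-\mathfrak i(\xi^\#)\omega=d\langle\mu,\xi\rangle$ for all $h\in H$, $p\in M$, $\xi\in\mathfrak h$. For an immersion $f:N\to M$ of a manifold of dimension $n$, $f$ is Lagrangian if $f^*\omega=0$, and a *Lagrangian angle* of $f$ on an open set $W\subset N$ is a function $\theta:W\to\mathbb R/2\pi\mathbb Z$ such that, for some orientation of $W$, $f^*\Omega=e^{\sqrt{-1}\theta}\mathrm{vol}_{f^*g}$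 on $W$. Let $L\subset M$ be an (embedded) Lagrangian submanifold and let $\theta$ be a Lagrangian angle of $L$ on an open set $U\subset L$. Let $c\in\mathfrak h^*$ and let $V_c\subset M$ be a submanifold with $V_c\subset\mu^{-1}(c)\cap L$. Assume: * the isotropy group of every $p\in V_c$ is one and the same subgroup $K$ of $H$, and $H/K$ carries its standard smooth structure, the one for which $H\to H/K$ is a submersion; * $c$ is central: $\langle c,\mathrm{Ad}_h\xi\rangle=\langle c,\xi\rangle$ for all $h\in H$, $\xi\in\mathfrak h$; * $\dim H/K+\dim V_c=n$; * for all $p\in V_c$ and $\xi\in\mathfrak h$: (i) $\xi^\#_p\in \mathrm T_p^\perp L\oplus \mathrm T_pV_c$, where $\mathrm T_p^\perp L$ is the $g$-orthogonal complement of $\mathrm T_pL$ in $\mathrm T_pM$; (ii) $\xi^\#_p\notin \mathrm T_pV_c\setminus\{0\}$. **Theorem.** The map $\phi_c:(H/K)\times V_c\to M$, $(hK,p)\mapsto hp$, is a Lagrangian immersion. Every $h\in H$ can be written as $h=\exp\eta_1\cdots\exp\eta_l$ with $\eta_1,\dots,\eta_l\in\mathfrak h$, and there is a unique $a_H\in\mathfrak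 h^*$ such that for every $h=\exp\eta_1\cdots\exp\eta_l$ the translation $L_h:p\mapsto hp$ satisfies $L_h^*\Omega=e^{\sqrt{-1}\langle a_H,\eta_1+\cdots+\eta_l\rangle}\Omega$. For every $h\in H$, every $p\in V_c\cap U$ and every expression $h=\exp\eta_1\cdots\exp\eta_l$, $$(\phi_c^*\Omega)_{(hK,p)}=\pm e^{\sqrt{-1}\theta_c(hK,p)}\,\mathrm{vol}_{\phi_c^*g},\qquad \theta_c(hK,p)=\langle a_H,\eta_1+\cdots+\eta_l\rangle+\theta(p)-\frac\pi2\dim(H/K).$$ Moreover, locally $\theta_c$ is a Lagrangian angle of $\phi_c$: every point $(h_0K,p_0)$ with $p_0\in V_c\cap U$ has an open neighbourhood $W\subset(H/K)\times(V_c\cap U)$ and a Lagrangian angle of $\phi_c$ on $W$ which at each point $(hK,p)\in W$ is given by the formula for $\theta_c(hK,p)$, for a suitable representative $h$ of $hK$ and suitable $\eta_1,\dots,\eta_l$ with $h=\exp\eta_1\cdots\exp\eta_l$. -/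

import Mathlib

open scoped Manifold ContDiff ComplexConjugate

noncomputable section

namespace LagAngle

/-! ### Differential forms in coordinates and exterior products -/

section Forms

variable {𝕜 : Type*} [NontriviallyNormedField 𝕜]
  {F : Type*} [NormedAddCommGroup F] [NormedSpace 𝕜 F]
  {B : Type*} [TopologicalSpace B] (J : ModelWithCorners 𝕜 F B)
  {N : Type*} [TopologicalSpace N] [ChartedSpace B N]
  {G : Type*} [NormedAddCommGroup G] [NormedSpace 𝕜 G] {k : ℕ}

/-- The coordinate expression of a `k`-form `α` in the chart around `x₀`: the pullback of `α` under
the inverse of the chart, a `k`-form on the target of the chart in the model space. -/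
def chartForm (α : ∀ x : N, TangentSpace J x [⋀^Fin k]→L[𝕜] G) (x₀ : N) :
    F → F [⋀^Fin k]→L[𝕜] G := fun y =>
  (α ((extChartAt J x₀).symm y)).compContinuousLinearMap
    (mfderiv 𝓘(𝕜, F) J (extChartAt J x₀).symm y)

end Forms

section Wedge

variable {T R : Type*} [Field R]

/-- Exterior product of a `k`-form and an `l`-form on `T`, given as functions of `k` and of `l`
vectors, normalised so that `(a ∧ b) (u, v) = a u * b v - a v * b u` for `1`-forms `a`, `b`. -/
def wedge {k l : ℕ} (α : (Fin k → T) → R) (β : (Fin l → T) → R) : (Fin (k + l) → T) → R :=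
  fun v => ((k.factorial : R) * (l.factorial : R))⁻¹ *
    ∑ σ : Equiv.Perm (Fin (k + l)), ((Equiv.Perm.sign σ : ℤ) : R) *
      (α (fun i => v (σ (Fin.castAdd l i))) * β (fun j => v (σ (Fin.natAdd k j))))

/-- The `j`-th exterior power of a `2`-form. -/
def wedgePow (α : (Fin 2 → T) → R) : (j : ℕ) → (Fin (2 * j) → T) → R
  | 0 => fun _ => 1
  | j + 1 => wedge (wedgePow α j) α

end Wedge

/-! ### Calabi–Yau manifolds -/

section CalabiYau

variable {E : Type*} [NormedAddCommGroup E] [NormedSpace ℂ E]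
  {M : Type*} [TopologicalSpace M] [ChartedSpace E M]

/-- The complex structure `I_x` of the real tangent space `T_x M` of a complex manifold:
multiplication by `√-1` (which does not depend on the chart, as coordinate changes are
holomorphic). -/
def cplx (x : M) : TangentSpace 𝓘(ℝ, E) x →L[ℝ] TangentSpace 𝓘(ℝ, E) x :=
  (Complex.I • ContinuousLinearMap.id ℝ E : E →L[ℝ] E)

/-- A Calabi–Yau structure on the complex manifold `M`, of complex dimension `n`: a Kähler form
and a holomorphic volume form with `ω ^ n / n! = (-1) ^ (n (n - 1) / 2) (√-1 / 2) ^ n Ω ∧ conj Ω`. -/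
structure CalabiYau (n : ℕ) (E : Type*) [NormedAddCommGroup E] [NormedSpace ℂ E]
    (M : Type*) [TopologicalSpace M] [ChartedSpace E M] where
  /-- the Kähler form `ω` -/
  kform : ∀ x : M, TangentSpace 𝓘(ℝ, E) x [⋀^Fin 2]→L[ℝ] ℝ
  /-- the holomorphic volume form `Ω`: as it is complex multilinear, it has type `(n, 0)` -/
  vform : ∀ x : M, TangentSpace 𝓘(ℂ, E) x [⋀^Fin n]→L[ℂ] ℂ
  finrank_eq : Module.finrank ℂ E = n
  kform_smooth : ∀ x₀ : M, ContDiffOn ℝ ∞ (chartForm 𝓘(ℝ, E) kform x₀)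
    (extChartAt 𝓘(ℝ, E) x₀).target
  kform_closed : ∀ x₀ : M, ∀ y ∈ (extChartAt 𝓘(ℝ, E) x₀).target,
    extDeriv (chartForm 𝓘(ℝ, E) kform x₀) y = 0
  kform_cplx : ∀ (x : M) (u v : TangentSpace 𝓘(ℝ, E) x),
    kform x ![cplx x u, cplx x v] = kform x ![u, v]
  kform_pos : ∀ (x : M) (u : TangentSpace 𝓘(ℝ, E) x), u ≠ 0 → 0 < kform x ![u, cplx x u]
  vform_holomorphic : ∀ x₀ : M, DifferentiableOn ℂ (chartForm 𝓘(ℂ, E) vform x₀)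
    (extChartAt 𝓘(ℂ, E) x₀).target
  vform_ne_zero : ∀ x : M, vform x ≠ 0
  normalization : ∀ (x : M) (v : Fin (2 * n) → E),
    wedgePow (fun w => (kform x w : ℂ)) n v / (n.factorial : ℂ) =
      (-1) ^ (n * (n - 1) / 2) * (Complex.I / 2) ^ n *
        wedge (fun w => vform x w) (fun w => conj (vform x w))
          (fun i => v (Fin.cast (two_mul n).symm i))

namespace CalabiYau

variable {n : ℕ} (C : CalabiYau n E M)

/-- The Kähler metric, `g (u, v) = ω (u, I v)`, that is, `ω (u, v) = g (I u, v)`. -/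
def metric (x : M) (u v : TangentSpace 𝓘(ℝ, E) x) : ℝ := C.kform x ![u, cplx x v]

/-- The orthogonal complement, for the Kähler metric, of a subspace of `T_x M`. -/
def perp (x : M) (S : Submodule ℝ (TangentSpace 𝓘(ℝ, E) x)) :
    Submodule ℝ (TangentSpace 𝓘(ℝ, E) x) where
  carrier := {u | ∀ w ∈ S, C.metric x u w = 0}
  zero_mem' := fun w _ => (C.kform x).map_coord_zero (m := ![0, cplx x w]) 0 rfl
  add_mem' := by
    intro a b ha hb w hw
    have h := (C.kform x).toMultilinearMap.cons_add ![cplx x w] a b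
    change C.kform x ![a + b, cplx x w] = 0
    have h' : C.kform x ![a + b, cplx x w]
        = C.kform x ![a, cplx x w] + C.kform x ![b, cplx x w] := h
    have h1 : C.kform x ![a, cplx x w] = 0 := ha w hw
    have h2 : C.kform x ![b, cplx x w] = 0 := hb w hw
    rw [h', h1, h2, add_zero]
  smul_mem' := by
    intro c a ha w hw
    have h := (C.kform x).toMultilinearMap.cons_smul ![cplx x w] c a
    change C.kform x ![c • a, cplx x w] = 0
    have h' : C.kform x ![c • a, cplx x w] = c • C.kform x ![a, cplx x w] := h
    have h1 : C.kform x ![a, cplx x w] = 0 := ha w hw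
    rw [h', h1, smul_zero]

end CalabiYau

end CalabiYau

/-! ### Immersions, submanifolds, Lagrangian angles -/

section Immersions

variable {F : Type*} [NormedAddCommGroup F] [NormedSpace ℝ F]
  {B : Type*} [TopologicalSpace B] (J : ModelWithCorners ℝ F B)
  {N : Type*} [TopologicalSpace N] [ChartedSpace B N]
  {F' : Type*} [NormedAddCommGroup F'] [NormedSpace ℝ F']
  {B' : Type*} [TopologicalSpace B'] (J' : ModelWithCorners ℝ F' B')
  {N' : Type*} [TopologicalSpace N'] [ChartedSpace B' N']

/-- A smooth immersion: a smooth map with injective differentials. -/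
def IsImmersion (f : N → N') : Prop :=
  ContMDiff J J' ∞ f ∧ ∀ x, Function.Injective (mfderiv J J' f x)

/-- A smooth submersion: a smooth map with surjective differentials. -/
def IsSubmersion (f : N → N') : Prop :=
  ContMDiff J J' ∞ f ∧ ∀ x, Function.Surjective (mfderiv J J' f x)

end Immersions

section Submanifolds

variable {E : Type*} [NormedAddCommGroup E] [NormedSpace ℝ E]
  {M : Type*} [TopologicalSpace M] [ChartedSpace E M]

/-- The subset `S` of `M`, with the subspace topology and the given charts, is an (embedded)
submanifold of `M`. -/
def IsSubmanifold (F : Type*) [NormedAddCommGroup F] [NormedSpace ℝ F]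
    (S : Set M) [ChartedSpace F S] : Prop :=
  IsManifold 𝓘(ℝ, F) ∞ S ∧ IsImmersion 𝓘(ℝ, F) 𝓘(ℝ, E) (Subtype.val : S → M)

/-- The tangent space `T_p S` of a submanifold `S`, as a subspace of `T_p M`. -/
def tangent (F : Type*) [NormedAddCommGroup F] [NormedSpace ℝ F]
    (S : Set M) [ChartedSpace F S] (p : S) :
    Submodule ℝ (TangentSpace 𝓘(ℝ, E) (p : M)) :=
  LinearMap.range (mfderiv 𝓘(ℝ, F) 𝓘(ℝ, E) (Subtype.val : S → M) p).toLinearMap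

end Submanifolds

namespace CalabiYau

variable {n : ℕ} {E : Type*} [NormedAddCommGroup E] [NormedSpace ℂ E]
  {M : Type*} [TopologicalSpace M] [ChartedSpace E M] (C : CalabiYau n E M)
  {F : Type*} [NormedAddCommGroup F] [NormedSpace ℝ F]
  {B : Type*} [TopologicalSpace B] (J : ModelWithCorners ℝ F B)
  {N : Type*} [TopologicalSpace N] [ChartedSpace B N]

/-- A Lagrangian immersion: an immersion of a manifold of half the dimension that pulls the
symplectic form back to zero. -/
def IsLagrangian (f : N → M) : Prop :=
  IsImmersion J 𝓘(ℝ, E) f ∧ Module.finrank ℝ F = n ∧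
    ∀ (x : N) (u v : TangentSpace J x),
      C.kform (f x) ![mfderiv J 𝓘(ℝ, E) f x u, mfderiv J 𝓘(ℝ, E) f x v] = 0

/-- The `n`-form `ν` on `T_x N`, where `n = dim N`, is one of the two volume forms `± vol` of the
induced metric `f^* g`: its square on a family of vectors is the Gram determinant. -/
def IsVolumeAt (f : N → M) (x : N) (ν : TangentSpace J x [⋀^Fin n]→L[ℝ] ℝ) : Prop :=
  ∀ v : Fin n → TangentSpace J x, ν v ^ 2 = Matrix.det (Matrix.of fun i j =>
    C.metric (f x) (mfderiv J 𝓘(ℝ, E) f x (v i)) (mfderiv J 𝓘(ℝ, E) f x (v j)))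

/-- `(f^* Ω)_x = e ^ (√-1 t) ν`. -/
def PullbackEq (f : N → M) (x : N) (t : Real.Angle)
    (ν : TangentSpace J x [⋀^Fin n]→L[ℝ] ℝ) : Prop :=
  ∀ v : Fin n → TangentSpace J x,
    C.vform (f x) (fun i => mfderiv J 𝓘(ℝ, E) f x (v i)) = (t.toCircle : ℂ) * (ν v : ℂ)

/-- `(f^* Ω)_x = ± e ^ (√-1 t) vol`, where `vol` is the volume form of `f^* g` on `T_x N` (its sign
depends on an orientation of `T_x N`). -/
def HasAngleAt (f : N → M) (x : N) (t : Real.Angle) : Prop :=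
  ∃ ν : TangentSpace J x [⋀^Fin n]→L[ℝ] ℝ, C.IsVolumeAt J f x ν ∧ C.PullbackEq J f x t ν

/-- `θ` is a Lagrangian angle of `f` on the open set `W`: for some orientation of `W`, that is, for
some continuous choice `ν` of the volume form of `f^* g`, `f^* Ω = e ^ (√-1 θ) ν` on `W`. -/
def IsAngleOn (f : N → M) (θ : N → Real.Angle) (W : Set N) : Prop :=
  IsOpen W ∧ ∃ ν : ∀ x : N, TangentSpace J x [⋀^Fin n]→L[ℝ] ℝ,
    (∀ x₀ : N, ContinuousOn (chartForm J ν x₀)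
      ((extChartAt J x₀).target ∩ (extChartAt J x₀).symm ⁻¹' W)) ∧
    ∀ x ∈ W, C.IsVolumeAt J f x (ν x) ∧ C.PullbackEq J f x (θ x) (ν x)

end CalabiYau

/-! ### Lie groups and their actions -/

section LieGroups

variable {EH : Type*} [NormedAddCommGroup EH] [NormedSpace ℝ EH]
  {H : Type*} [TopologicalSpace H] [ChartedSpace EH H] [Group H]

/-- `γ` is the one-parameter subgroup of `H` with `γ'(0) = ξ`. (A homomorphism `ℝ → H` that is
differentiable at `0` is smooth.) -/
def IsOneParam (γ : ℝ → H) (ξ : GroupLieAlgebra 𝓘(ℝ, EH) H) : Prop :=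
  (∀ s t, γ (s + t) = γ s * γ t) ∧ MDifferentiableAt 𝓘(ℝ, ℝ) 𝓘(ℝ, EH) γ 0 ∧
    mfderiv 𝓘(ℝ, ℝ) 𝓘(ℝ, EH) γ 0 (1 : ℝ) = ξ

open Classical in
/-- The exponential map `exp : 𝔥 → H`. (A one-parameter subgroup with the given velocity exists and
is unique, so that the second case does not occur.) -/
def lieExp (ξ : GroupLieAlgebra 𝓘(ℝ, EH) H) : H :=
  if hγ : ∃ γ : ℝ → H, IsOneParam γ ξ then hγ.choose 1 else 1

/-- The adjoint action `Ad_h` on the Lie algebra. -/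
def adj (h : H) : GroupLieAlgebra 𝓘(ℝ, EH) H →L[ℝ] GroupLieAlgebra 𝓘(ℝ, EH) H :=
  (mfderiv 𝓘(ℝ, EH) 𝓘(ℝ, EH) (fun x : H => h * x * h⁻¹) 1 : EH →L[ℝ] EH)

variable {E : Type*} [NormedAddCommGroup E]
  {M : Type*} [TopologicalSpace M] [ChartedSpace E M] [MulAction H M]

/-- The fundamental vector field `ξ^#`: at `p`, the velocity at `t = 0` of `exp (t ξ) p`, that is,
the image of `ξ` under the differential at `1` of the orbit map `h ↦ h p`. -/
def fund [NormedSpace ℝ E] (ξ : GroupLieAlgebra 𝓘(ℝ, EH) H) (p : M) : TangentSpace 𝓘(ℝ, E) p :=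
  (mfderiv 𝓘(ℝ, EH) 𝓘(ℝ, E) (fun h : H => h • p) 1 : EH →L[ℝ] E) ξ

namespace CalabiYau

variable [NormedSpace ℂ E] {n : ℕ} (C : CalabiYau n E M)

/-- `μ` is a moment map: equivariant for the coadjoint action, with `d⟨μ, ξ⟩ = - i(ξ^#) ω`. -/
def IsMomentMap (μ : M → (GroupLieAlgebra 𝓘(ℝ, EH) H →L[ℝ] ℝ)) : Prop :=
  (∀ (h : H) (p : M) (ξ : GroupLieAlgebra 𝓘(ℝ, EH) H), μ (h • p) ξ = μ p (adj h⁻¹ ξ)) ∧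
  ∀ ξ : GroupLieAlgebra 𝓘(ℝ, EH) H, MDifferentiable 𝓘(ℝ, E) 𝓘(ℝ, ℝ) (fun p => μ p ξ) ∧
    ∀ (p : M) (v : TangentSpace 𝓘(ℝ, E) p),
      mfderiv 𝓘(ℝ, E) 𝓘(ℝ, ℝ) (fun q => μ q ξ) p v = - C.kform p ![fund ξ p, v]

/-- The property that determines `a_H ∈ 𝔥^*`: for `h = exp η₁ ⋯ exp η_l`, the translation `L_h`
satisfies `L_h^* Ω = e ^ (√-1 ⟨a_H, η₁ + ⋯ + η_l⟩) Ω`. -/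
def IsPhase (a : GroupLieAlgebra 𝓘(ℝ, EH) H →L[ℝ] ℝ) : Prop :=
  ∀ (η : List (GroupLieAlgebra 𝓘(ℝ, EH) H)) (h : H), h = (η.map lieExp).prod →
    ∀ (p : M) (v : Fin n → TangentSpace 𝓘(ℝ, E) p),
      C.vform (h • p) (fun i => mfderiv 𝓘(ℝ, E) 𝓘(ℝ, E) (fun q : M => h • q) p (v i)) =
        Complex.exp (Complex.I * (a η.sum : ℂ)) * C.vform p v

end CalabiYau

end LieGroups

/-- The map `φ : (H / K) × V → M`, `(h K, p) ↦ h p`. -/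
def orbitMap {H M : Type*} [Group H] [MulAction H M] (K : Subgroup H) (V : Set M)
    (hK : ∀ p ∈ V, MulAction.stabilizer H p = K) : (H ⧸ K) × V → M := fun x =>
  Quotient.liftOn' x.1 (fun h => h • (x.2 : M)) (by
    intro a b hab
    have h1 : a⁻¹ * b ∈ K := QuotientGroup.leftRel_apply.mp hab
    rw [← hK x.2 x.2.2, MulAction.mem_stabilizer_iff, mul_smul, inv_smul_eq_iff] at h1
    exact h1.symm)

end LagAngle

end

noncomputable section

/-! By equivariance the problem reduces to linear algebra at one point $p$ of $V_c$, once it is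
known how a translation $L_h$ acts on $\omega$ and on $\Omega$.

The moment map makes $H$ preserve $\omega$: since $d\omega=0$, Cartan's formula gives $\mathcal
L_{\xi^\#}\omega=d\,\mathfrak i(\xi^\#)\omega=-dd\langle\mu,\xi\rangle=0$, and $H$ is connected
(`hasFDerivAt_pullback_two_form`, `CalabiYau.kform_smul`). As $L_h$ preserves $I$,
$L_h^*\Omega=f_h\Omega$ with $f_h$ holomorphic. The normalization of $\Omega\wedge\overline\Omega$
by $\omega^n$ forces $|f_h|=1$, because $\Omega\wedge\overline\Omega\ne0$
(`exists_wedge_conj_ne_zero`), and the maximum principle makes $f_h$ constant on $M$. Hence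
$h\mapsto f_h$ is a unitary character of $H$. Its differential is $\sqrt{-1}\,a_H$, and its value at
$\exp\eta_1\cdots\exp\eta_l$ depends only on $\sum\eta_i$ (`CalabiYau.exists_character`).

Up to $dL_h$, the differential of $\phi_c$ at $(hK,p)$ sends $(w,v)$ to $\xi^\#_p+v$, where $\xi$
induces $w$ (`exists_mfderiv_orbitMap`). It is injective by condition (ii) and because the isotropy
group is $K$. Its image $Z$ is isotropic: $\mu$ is constant on $V_c$ and, as $c$ is central, on the
orbit of $p$, and $V_c$ lies in $L$. By condition (i), $Z$ is the orthogonal sum of $D=Z\cap\mathrm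
T_p^\perp L$ and $\mathrm T_pV_c$, with $\dim D=\dim H/K=d$. Since $\mathrm T_p^\perp L=I\,\mathrm
T_pL$, rotating $D$ by $-\sqrt{-1}$ carries $Z$ isometrically onto $\mathrm T_pL$, where $\Omega=\pm
e^{\sqrt{-1}\theta}\mathrm{vol}$, and changes the value of $\Omega$ by $(-\sqrt{-1})^d$. This yields
the shift $-\frac\pi2d$ up to sign (`exists_eq_toCircle_mul_of_perp`).

For the local angle, a smooth local section of $H\to H/K$ makes $e^{\sqrt{-1}\theta_c}$ continuous.
The real part of $e^{-\sqrt{-1}\theta_c}\phi_c^*\Omega$ is then a continuous choice of volume form,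
that is, the orientation (`CalabiYau.isAngleOn_of_continuousOn`). -/

namespace LagAngle

/-! ### Nonvanishing of the product of a complex volume form with its conjugate. -/

section WedgeConj

variable {E : Type*} [NormedAddCommGroup E] [NormedSpace ℂ E]

/-- The wedge product of a nonzero complex `n`-form with its conjugate does not vanish. -/
theorem exists_wedge_conj_ne_zero {n : ℕ} (Ω : E [⋀^Fin n]→L[ℂ] ℂ) (hΩ : Ω ≠ 0) :
    ∃ v : Fin (n + n) → E, wedge (fun w => Ω w) (fun w => conj (Ω w)) v ≠ 0 := by
  classical
  obtain ⟨e, he⟩ : ∃ e, Ω e ≠ 0 := by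
    by_contra! h
    exact hΩ (ContinuousAlternatingMap.ext h)
  by_contra! hz
  -- Both blocks of arguments carry the same vectors `e`. Multiplying some of them by `√-1` and
  -- averaging isolates the permutations that preserve the two blocks.
  let x : Fin (n + n) → E := Fin.append e e
  -- `c k * d l` is `1` if `k` and `l` lie in the same block and `-1` otherwise, so `∏ (1 + c k * d
  -- (σ.symm k))` vanishes unless `σ` preserves the blocks. The signs in `d` differ because the
  -- second factor is conjugated.
  let c : Fin (n + n) → ℂ := Fin.append (fun _ => -Complex.I) (fun _ => Complex.I)
  let d : Fin (n + n) → ℂ := Fin.append (fun _ => Complex.I) (fun _ => -Complex.I)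
  let A : Equiv.Perm (Fin (n + n)) → ℂ := fun σ =>
    Ω (fun i => x (σ (Fin.castAdd n i))) * conj (Ω (fun j => x (σ (Fin.natAdd n j))))
  let y : Finset (Fin (n + n)) → Fin (n + n) → E := fun S k =>
    (if k ∈ S then Complex.I else 1) • x k
  have hterm : ∀ (S : Finset (Fin (n + n))) (σ : Equiv.Perm (Fin (n + n))),
      Ω (fun i => y S (σ (Fin.castAdd n i))) * conj (Ω (fun j => y S (σ (Fin.natAdd n j)))) =
        (∏ k ∈ S, d (σ.symm k)) * A σ := by
    intro S σ
    have h1 : Ω (fun i => y S (σ (Fin.castAdd n i))) =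
        (∏ i, (if σ (Fin.castAdd n i) ∈ S then Complex.I else 1)) *
          Ω (fun i => x (σ (Fin.castAdd n i))) :=
      Ω.map_smul_univ _ _
    have h2 : Ω (fun i => y S (σ (Fin.natAdd n i))) =
        (∏ i, (if σ (Fin.natAdd n i) ∈ S then Complex.I else 1)) *
          Ω (fun i => x (σ (Fin.natAdd n i))) :=
      Ω.map_smul_univ _ _
    have h3 : ∏ k ∈ S, d (σ.symm k) = ∏ k, (if σ k ∈ S then d k else 1) := by
      rw [← Finset.univ_inter S, ← Finset.prod_ite_mem, ← Equiv.prod_comp σ]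
      simp
    rw [h1, h2, h3, Fin.prod_univ_add, map_mul, map_prod]
    have h4 : ∀ i : Fin n, conj (if σ (Fin.natAdd n i) ∈ S then Complex.I else (1 : ℂ)) =
        if σ (Fin.natAdd n i) ∈ S then d (Fin.natAdd n i) else 1 := by
      intro i
      split_ifs <;> simp [d, -Fin.natAdd_eq_addNat]
    have h5 : ∀ i : Fin n, (if σ (Fin.castAdd n i) ∈ S then Complex.I else (1 : ℂ)) =
        if σ (Fin.castAdd n i) ∈ S then d (Fin.castAdd n i) else 1 := by
      intro i
      split_ifs <;> simp [d, -Fin.natAdd_eq_addNat]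
    simp only [h4, h5, A]
    ring
  -- The vanishing values of the wedge product at the families `y S` are added with weights `∏ k ∈
  -- S, c k`; the sum over `S` is the expansion of the product.
  have hsum : ∑ σ : Equiv.Perm (Fin (n + n)), ((Equiv.Perm.sign σ : ℤ) : ℂ) *
      ((∏ k, (1 + c k * d (σ.symm k))) * A σ) = 0 := by
    have hfac : ((n.factorial : ℂ) * (n.factorial : ℂ))⁻¹ ≠ 0 := by
      simp [Nat.factorial_ne_zero]
    have h1 : ∀ S : Finset (Fin (n + n)), ∑ σ : Equiv.Perm (Fin (n + n)),
        ((Equiv.Perm.sign σ : ℤ) : ℂ) * ((∏ k ∈ S, d (σ.symm k)) * A σ) = 0 := by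
      intro S
      have h2 := hz (y S)
      simp only [wedge, hterm] at h2
      exact (mul_eq_zero.1 h2).resolve_left hfac
    have h3 : ∑ S : Finset (Fin (n + n)), (∏ k ∈ S, c k) * ∑ σ : Equiv.Perm (Fin (n + n)),
        ((Equiv.Perm.sign σ : ℤ) : ℂ) * ((∏ k ∈ S, d (σ.symm k)) * A σ) = 0 :=
      Finset.sum_eq_zero fun S _ => by rw [h1, mul_zero]
    rw [← h3]
    simp only [Finset.mul_sum]
    rw [Finset.sum_comm]
    refine Finset.sum_congr rfl fun σ _ => ?_
    rw [Finset.prod_one_add, Finset.powerset_univ, Finset.sum_mul, Finset.mul_sum]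
    refine Finset.sum_congr rfl fun S _ => ?_
    rw [Finset.prod_mul_distrib]
    ring
  have hnonneg : ∀ σ : Equiv.Perm (Fin (n + n)), 0 ≤ (((Equiv.Perm.sign σ : ℤ) : ℂ) *
      ((∏ k, (1 + c k * d (σ.symm k))) * A σ)).re := by
    intro σ
    by_cases hp : ∏ k, (1 + c k * d (σ.symm k)) = 0
    · rw [hp]; simp
    have hk : ∀ i : Fin n, ∃ j : Fin n, σ (Fin.castAdd n i) = Fin.castAdd n j := by
      intro i
      have h1 := (Finset.prod_ne_zero_iff.1 hp) (σ (Fin.castAdd n i)) (Finset.mem_univ _)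
      induction hj : σ (Fin.castAdd n i) using Fin.addCases with
      | left j => exact ⟨j, rfl⟩
      | right j =>
        rw [Equiv.symm_apply_apply, hj] at h1
        simp [c, d, -Fin.natAdd_eq_addNat] at h1
    have hmem : (finSumFinEquiv.permCongr.symm σ : Equiv.Perm (Fin n ⊕ Fin n)) ∈
        (Equiv.Perm.sumCongrHom (Fin n) (Fin n)).range := by
      apply Equiv.Perm.mem_sumCongrHom_range_of_perm_mapsTo_inl
      rintro _ ⟨i, rfl⟩
      obtain ⟨j, hj⟩ := hk i
      refine ⟨j, ?_⟩
      simp [Equiv.permCongr_def, hj]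
    obtain ⟨⟨τ, ρ⟩, hτ⟩ := hmem
    have hσ : σ = finSumFinEquiv.permCongr (Equiv.Perm.sumCongr τ ρ) := by
      rw [← Equiv.symm_apply_eq, ← hτ]; rfl
    have hσ1 : ∀ i, σ (Fin.castAdd n i) = Fin.castAdd n (τ i) := by
      intro i; rw [hσ]; simp [-Fin.natAdd_eq_addNat]
    have hσ2 : ∀ i, σ (Fin.natAdd n i) = Fin.natAdd n (ρ i) := by
      intro i; rw [hσ]; simp [-Fin.natAdd_eq_addNat]
    have hsign : Equiv.Perm.sign σ = Equiv.Perm.sign τ * Equiv.Perm.sign ρ := by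
      rw [hσ, Equiv.Perm.sign_permCongr, Equiv.Perm.sign_sumCongr]
    have hA : A σ = ((Equiv.Perm.sign τ : ℤ) : ℂ) * ((Equiv.Perm.sign ρ : ℤ) : ℂ) *
        (Ω e * conj (Ω e)) := by
      have h1 : Ω (fun i => e (τ i)) = ((Equiv.Perm.sign τ : ℤ) : ℂ) * Ω e := by
        have := Ω.toAlternatingMap.map_perm e τ
        rw [Units.smul_def, zsmul_eq_mul] at this
        exact this
      have h2 : Ω (fun i => e (ρ i)) = ((Equiv.Perm.sign ρ : ℤ) : ℂ) * Ω e := by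
        have := Ω.toAlternatingMap.map_perm e ρ
        rw [Units.smul_def, zsmul_eq_mul] at this
        exact this
      simp only [A, hσ1, hσ2, x, Fin.append_left, Fin.append_right, h1, h2, map_mul, map_intCast]
      ring
    have hP : ∏ k, (1 + c k * d (σ.symm k)) = 2 ^ (n + n) := by
      rw [← Equiv.prod_comp σ]
      simp only [Equiv.symm_apply_apply, Fin.prod_univ_add, hσ1, hσ2, c, d, Fin.append_left,
        Fin.append_right]
      norm_num [pow_add]
    have hu : ∀ u : ℤˣ, ((u : ℤ) : ℂ) * ((u : ℤ) : ℂ) = 1 := fun u => by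
      rw [← Int.cast_mul, ← Units.val_mul, Int.units_mul_self]; simp
    -- The sign of `σ` cancels the signs from permuting `e` within the two blocks, so all surviving
    -- terms are equal and positive.
    have : ((Equiv.Perm.sign σ : ℤ) : ℂ) * ((∏ k, (1 + c k * d (σ.symm k))) * A σ) =
        ((2 ^ (n + n) * Complex.normSq (Ω e) : ℝ) : ℂ) := by
      rw [hP, hA, hsign, Complex.mul_conj]
      push_cast
      linear_combination (2 ^ (n + n) * (Complex.normSq (Ω e) : ℂ)) *
        (((Equiv.Perm.sign ρ : ℤ) : ℂ) * ((Equiv.Perm.sign ρ : ℤ) : ℂ) * hu (Equiv.Perm.sign τ)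
          + hu (Equiv.Perm.sign ρ))
    rw [this, Complex.ofReal_re]
    exact mul_nonneg (by positivity) (Complex.normSq_nonneg _)
  have hpos : 0 < (((Equiv.Perm.sign (1 : Equiv.Perm (Fin (n + n))) : ℤ) : ℂ) *
      ((∏ k, (1 + c k * d ((1 : Equiv.Perm (Fin (n + n))).symm k))) * A 1)).re := by
    have hP : ∏ k, (1 + c k * d ((1 : Equiv.Perm (Fin (n + n))).symm k)) = 2 ^ (n + n) := by
      have hone : ∀ k, (1 : Equiv.Perm (Fin (n + n))).symm k = k := fun _ => rfl
      simp only [hone, Fin.prod_univ_add, c, d, Fin.append_left,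
        Fin.append_right]
      norm_num [pow_add]
    have hA : A 1 = Ω e * conj (Ω e) := by
      simp [A, x, -Fin.natAdd_eq_addNat]
    have : (((Equiv.Perm.sign (1 : Equiv.Perm (Fin (n + n))) : ℤ) : ℂ) *
      ((∏ k, (1 + c k * d ((1 : Equiv.Perm (Fin (n + n))).symm k))) * A 1)) =
        ((2 ^ (n + n) * Complex.normSq (Ω e) : ℝ) : ℂ) := by
      rw [hP, hA, Complex.mul_conj]
      simp
    rw [this, Complex.ofReal_re]
    exact mul_pos (by positivity) (Complex.normSq_pos.2 he)
  have h0 := congrArg Complex.re hsum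
  rw [Complex.re_sum, Complex.zero_re] at h0
  exact absurd h0 (Finset.sum_pos' (fun σ _ => hnonneg σ) ⟨1, Finset.mem_univ _, hpos⟩).ne'

end WedgeConj

/-! ### Linear algebra: rotating part of a Lagrangian subspace. -/

section Rotation

/-- The bilinear form underlying an alternating `2`-form. -/
def toBilin {E : Type*} [NormedAddCommGroup E] [NormedSpace ℝ E] (w : E [⋀^Fin 2]→L[ℝ] ℝ) :
    E →ₗ[ℝ] E →ₗ[ℝ] ℝ :=
  LinearMap.mk₂ ℝ (fun u v => w ![u, v])
    (fun a b v => w.toMultilinearMap.cons_add ![v] a b)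
    (fun c a v => w.toMultilinearMap.cons_smul ![v] c a)
    (fun u a b => by
      have h := w.toMultilinearMap.map_update_add ![u, 0] 1 a b
      have e : ∀ x, Function.update ![u, 0] 1 x = ![u, x] := fun x => by
        ext i; fin_cases i <;> simp
      rw [e, e, e] at h; exact h)
    (fun c u a => by
      have h := w.toMultilinearMap.map_update_smul ![u, 0] 1 c a
      have e : ∀ x, Function.update ![u, 0] 1 x = ![u, x] := fun x => by
        ext i; fin_cases i <;> simp
      rw [e, e] at h; exact h)

theorem toBilin_apply {E : Type*} [NormedAddCommGroup E] [NormedSpace ℝ E]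
    (w : E [⋀^Fin 2]→L[ℝ] ℝ) (u v : E) : toBilin w u v = w ![u, v] := rfl

theorem toBilin_swap {E : Type*} [NormedAddCommGroup E] [NormedSpace ℝ E]
    (w : E [⋀^Fin 2]→L[ℝ] ℝ) (u v : E) : toBilin w u v = - toBilin w v u := by
  have h : ∀ x, toBilin w x x = 0 := fun x =>
    w.map_eq_zero_of_eq ![x, x] (i := 0) (j := 1) rfl (by simp)
  have h1 := h (u + v)
  simp only [map_add, LinearMap.add_apply, h] at h1
  linarith

variable {E : Type*} [NormedAddCommGroup E] [NormedSpace ℂ E] [FiniteDimensional ℂ E]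

/-- If a complex alternating `n`-form is evaluated on `κ (k) + β` and on `-√-1 κ (k) + β`, where `k`
varies in a space of real dimension `d` and the total dimension is `n`, then the values differ by
the factor `(-√-1) ^ d`. -/
theorem map_rotate_eq {n d : ℕ} (Ω : E [⋀^Fin n]→L[ℂ] ℂ) (D Q : Submodule ℝ E)
    (hd : Module.finrank ℝ D = d) (hn : d + Module.finrank ℝ Q = n)
    (k b : Fin n → E) (hk : ∀ i, k i ∈ D) (hb : ∀ i, b i ∈ Q) :
    Ω (fun i => -(Complex.I • k i) + b i) = (-Complex.I) ^ d * Ω (fun i => k i + b i) := by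
  classical
  have : FiniteDimensional ℝ E := FiniteDimensional.complexToReal E
  let Ω' : E [⋀^Fin n]→ₗ[ℝ] ℂ := (Ω.restrictScalars ℝ).toAlternatingMap
  let J : E →ₗ[ℝ] E := ((-Complex.I) • (LinearMap.id : E →ₗ[ℂ] E)).restrictScalars ℝ
  let f₁ : D × Q →ₗ[ℝ] E := LinearMap.coprod (J ∘ₗ D.subtype) Q.subtype
  let f₂ : D × Q →ₗ[ℝ] E := LinearMap.coprod D.subtype Q.subtype
  let bD := Module.finBasisOfFinrankEq ℝ D hd
  let bQ := Module.finBasis ℝ Q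
  let bb := bD.prod bQ
  -- Both sides are real alternating `n`-forms on the `n`-dimensional external sum `D × Q`. An
  -- injective choice of `n` basis vectors uses each of them once and so collects one factor `-√-1`
  -- for each of the `d` vectors from `D`.
  have key : Ω'.compLinearMap f₁ = ((-Complex.I) ^ d) • Ω'.compLinearMap f₂ := by
    apply Module.Basis.ext_alternating bb
    intro σ hσ
    have hbij : Function.Bijective σ := by
      refine (Fintype.bijective_iff_injective_and_card σ).2 ⟨hσ, ?_⟩
      simp [hn]
    let s : Fin d ⊕ Fin (Module.finrank ℝ Q) → ℂ := Sum.elim (fun _ => -Complex.I) (fun _ => 1)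
    have h1 : ∀ i, f₁ (bb (σ i)) = s (σ i) • f₂ (bb (σ i)) := by
      intro i
      rcases σ i with j | j <;> simp [f₁, f₂, bb, s, J]
    have h2 : Ω (fun i => s (σ i) • f₂ (bb (σ i))) = (∏ i, s (σ i)) * Ω fun i => f₂ (bb (σ i)) :=
      Ω.map_smul_univ _ _
    have h3 : ∏ i, s (σ i) = (-Complex.I) ^ d := by
      rw [hbij.prod_comp s]
      simp [s]
    have h4 : (fun i => f₁ (bb (σ i))) = fun i => s (σ i) • f₂ (bb (σ i)) := funext h1
    change Ω (fun i => f₁ (bb (σ i))) = (-Complex.I) ^ d * Ω fun i => f₂ (bb (σ i))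
    rw [h4, h2, h3]
  have := congrArg (fun F => F fun i => ((⟨k i, hk i⟩ : D), (⟨b i, hb i⟩ : Q))) key
  change Ω (fun i => f₁ ((⟨k i, hk i⟩ : D), (⟨b i, hb i⟩ : Q))) =
    (-Complex.I) ^ d * Ω (fun i => f₂ ((⟨k i, hk i⟩ : D), (⟨b i, hb i⟩ : Q))) at this
  simpa [f₁, f₂, J] using this

/-- A complex `n`-form on a Lagrangian subspace `Z` that is obtained from the Lagrangian subspace
`Λ` by rotating by `√-1` the orthogonal complement in `Λ` of `Q`. -/
theorem exists_eq_toCircle_mul_of_perp {n d : ℕ} (hn : Module.finrank ℂ E = n)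
    (w : E [⋀^Fin 2]→L[ℝ] ℝ)
    (hI : ∀ u v, w ![Complex.I • u, Complex.I • v] = w ![u, v])
    (hpos : ∀ u, u ≠ 0 → 0 < w ![u, Complex.I • u]) (Ω : E [⋀^Fin n]→L[ℂ] ℂ)
    (Λ Q Z : Submodule ℝ E) (hΛ : Module.finrank ℝ Λ = n) (hΛ₀ : ∀ u ∈ Λ, ∀ v ∈ Λ, w ![u, v] = 0)
    (hZ : Module.finrank ℝ Z = n) (hZ₀ : ∀ u ∈ Z, ∀ v ∈ Z, w ![u, v] = 0)
    (hQΛ : Q ≤ Λ) (hQZ : Q ≤ Z)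
    (hZQ : ∀ z ∈ Z, ∃ k b, (∀ l ∈ Λ, w ![k, Complex.I • l] = 0) ∧ b ∈ Q ∧ k + b = z)
    (hd : d + Module.finrank ℝ Q = n) (t : Real.Angle)
    (ht : ∀ l : Fin n → E, (∀ i, l i ∈ Λ) → ∃ r : ℝ,
      r ^ 2 = Matrix.det (Matrix.of fun i j => w ![l i, Complex.I • l j]) ∧
        Ω l = (t.toCircle : ℂ) * r)
    (z : Fin n → E) (hz : ∀ i, z i ∈ Z) :
    ∃ r : ℝ, r ^ 2 = Matrix.det (Matrix.of fun i j => w ![z i, Complex.I • z j]) ∧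
      Ω z = ((((-(Real.pi / 2 * d) : ℝ) : Real.Angle) + t).toCircle : ℂ) * r := by
  classical
  have : FiniteDimensional ℝ E := FiniteDimensional.complexToReal E
  simp only [← toBilin_apply] at *
  set B := toBilin w with hB
  have hsw := toBilin_swap w
  rw [← hB] at hsw
  have hII : ∀ u : E, Complex.I • Complex.I • u = -u := fun u => by
    rw [smul_smul, Complex.I_mul_I, neg_one_smul]
  have hI' : ∀ u v, B (Complex.I • u) v = - B u (Complex.I • v) := fun u v => by
    rw [← hI, hII, map_neg, LinearMap.neg_apply]
  have hsym : ∀ u v, B u (Complex.I • v) = B v (Complex.I • u) := fun u v => by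
    rw [hsw, hI', neg_neg]
  have hzero : ∀ u, B u (Complex.I • u) = 0 → u = 0 := fun u hu => by
    by_contra h
    exact (hpos u h).ne' hu
  let J : E →ₗ[ℝ] E := (Complex.I • (LinearMap.id : E →ₗ[ℂ] E)).restrictScalars ℝ
  have hJ : ∀ u, J u = Complex.I • u := fun u => rfl
  have hJinj : Function.Injective J := fun u v huv => by
    have : Complex.I • u = Complex.I • v := huv
    exact smul_right_injective E Complex.I_ne_zero this
  -- If `y` and `√-1 y` both lie in `Λ`, then `w (y, √-1 y) = 0`, so `y = 0` by positivity; the rest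
  -- is a count of real dimensions.
  have htop : Λ ⊔ Λ.map J = ⊤ := by
    apply Submodule.eq_top_of_finrank_eq
    have h1 := Submodule.finrank_sup_add_finrank_inf_eq Λ (Λ.map J)
    have h2 : Λ ⊓ Λ.map J = ⊥ := by
      rw [Submodule.eq_bot_iff]
      rintro _ ⟨hx, y, hy, rfl⟩
      have : y = 0 := hzero y (hΛ₀ y hy _ hx)
      rw [this, map_zero]
    have h3 : Module.finrank ℝ (Λ.map J) = n := by
      rw [← hΛ]; exact (LinearEquiv.finrank_eq (Λ.equivMapOfInjective J hJinj)).symm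
    have h4 : Module.finrank ℝ E = 2 * n := by
      rw [finrank_real_of_complex, hn]
    rw [h2, finrank_bot] at h1
    omega
  let P : Submodule ℝ E :=
    { carrier := {k | ∀ l ∈ Λ, B k (Complex.I • l) = 0}
      zero_mem' := fun l _ => by simp
      add_mem' := fun {a b} ha hb l hl => by simp [ha l hl, hb l hl]
      smul_mem' := fun c a ha l hl => by simp [ha l hl] }
  -- The orthogonal complement of a Lagrangian subspace is its rotation by `√-1`.
  have hP : ∀ k ∈ P, ∃ a ∈ Λ, k = Complex.I • a := by
    intro k hk
    obtain ⟨a, ha, _, ⟨b, hb, rfl⟩, rfl⟩ := Submodule.mem_sup.1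
      (htop ▸ Submodule.mem_top : k ∈ Λ ⊔ Λ.map J)
    have h1 := hk a ha
    rw [hJ, map_add, LinearMap.add_apply, hI', hII, map_neg, neg_neg, hΛ₀ b hb a ha, add_zero] at h1
    exact ⟨b, hb, by rw [hzero a h1, zero_add, hJ]⟩
  -- `Z` is the direct sum of `Z ⊓ P` and `Q`.
  have hdim : Module.finrank ℝ (Z ⊓ P : Submodule ℝ E) = d := by
    have h1 := Submodule.finrank_sup_add_finrank_inf_eq (Z ⊓ P) Q
    have h2 : (Z ⊓ P) ⊓ Q = ⊥ := by
      rw [Submodule.eq_bot_iff]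
      rintro x ⟨⟨_, hx⟩, hxQ⟩
      exact hzero x (hx x (hQΛ hxQ))
    have h3 : (Z ⊓ P) ⊔ Q = Z := by
      apply le_antisymm (sup_le inf_le_left hQZ)
      intro x hx
      obtain ⟨k, b, hk, hb, rfl⟩ := hZQ x hx
      refine Submodule.add_mem_sup ⟨?_, hk⟩ hb
      have := Z.sub_mem hx (hQZ hb)
      rwa [add_sub_cancel_right] at this
    rw [h2, h3, finrank_bot, hZ] at h1
    omega
  choose k b hk hb hkb using fun i => hZQ (z i) (hz i)
  have hkZ : ∀ i, k i ∈ Z ⊓ P := fun i => by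
    refine ⟨?_, hk i⟩
    have := Z.sub_mem (hz i) (hQZ (hb i))
    rwa [← hkb, add_sub_cancel_right] at this
  choose a ha hka using fun i => hP (k i) (hk i)
  -- The rotated vectors lie in `Λ`, where the phase of `Ω` is known.
  have hl : ∀ i, -(Complex.I • k i) + b i = a i + b i := fun i => by rw [hka, hII, neg_neg]
  obtain ⟨r, hr, hΩ⟩ := ht (fun i => a i + b i) (fun i => Λ.add_mem (ha i) (hQΛ (hb i)))
  have hrot := map_rotate_eq Ω (Z ⊓ P) Q hdim hd k b hkZ hb
  simp only [hl, hkb, hΩ] at hrot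
  -- Undoing the rotation gives `√-1 ^ d = (-1) ^ d * (-√-1) ^ d`. The sign goes into the volume,
  -- which is only determined up to sign, and the other factor is the shift by `-π/2 * d`.
  refine ⟨(-1) ^ d * r, ?_, ?_⟩
  · rw [mul_pow, hr, ← pow_mul, mul_comm d 2, pow_mul, neg_one_sq, one_pow, one_mul]
    congr 1
    ext i j
    simp only [Matrix.of_apply]
    -- All mixed terms of both Gram matrices vanish: `e1` and `e2` because `Z` is isotropic, `e3`
    -- and `e4` because `Λ` is.
    have e1 : B (a i) (Complex.I • b j) = 0 := by
      have := hZ₀ _ (hkZ i).1 _ (hQZ (hb j))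
      rwa [hka, hI', neg_eq_zero] at this
    have e2 : B (b i) (Complex.I • a j) = 0 := by
      have := hZ₀ _ (hQZ (hb i)) _ (hkZ j).1
      rwa [hka] at this
    have e3 : B (a i) (b j) = 0 := hΛ₀ _ (ha i) _ (hQΛ (hb j))
    have e4 : B (b i) (a j) = 0 := hΛ₀ _ (hQΛ (hb i)) _ (ha j)
    rw [← hkb i, ← hkb j, hka, hka]
    simp only [smul_add, map_add, LinearMap.add_apply, hII, map_neg, e1, e2, hI', e3, e4, neg_neg]
    ring
  · rw [Real.Angle.toCircle_add, Circle.coe_mul, Real.Angle.toCircle_coe, Circle.coe_exp]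
    have h1 : Complex.exp (((-(Real.pi / 2 * d) : ℝ) : ℂ) * Complex.I) = (-Complex.I) ^ d := by
      rw [← Complex.exp_neg_pi_div_two_mul_I, ← Complex.exp_nat_mul]
      congr 1
      push_cast
      ring
    rw [h1]
    push_cast
    have h2 : (-Complex.I) ^ d * (-Complex.I) ^ d = (-1) ^ d := by
      rw [← mul_pow]; simp
    have h3 : ((-1 : ℂ) ^ d) * (-1) ^ d = 1 := by rw [← mul_pow]; simp
    have h4 : Ω z = (-1) ^ d * ((-1) ^ d * Ω z) := by rw [← mul_assoc, h3, one_mul]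
    rw [h4]
    linear_combination (-(-Complex.I) ^ d * (-1) ^ d) * hrot - (-1) ^ d * Ω z * h2

end Rotation

/-! ### Maps with zero differential on connected manifolds. -/

section Manifolds

open Set Filter Topology

variable {F : Type*} [NormedAddCommGroup F] [NormedSpace ℝ F]
  {N : Type*} [TopologicalSpace N] [ChartedSpace F N] [IsManifold 𝓘(ℝ, F) 1 N]
  {E : Type*} [NormedAddCommGroup E] [NormedSpace ℝ E]
  {M : Type*} [TopologicalSpace M] [ChartedSpace E M] [IsManifold 𝓘(ℝ, E) 1 M]

theorem mdifferentiableAt_extChartAt_symm {𝕜 : Type*} [NontriviallyNormedField 𝕜]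
    {F : Type*} [NormedAddCommGroup F] [NormedSpace 𝕜 F]
    {B : Type*} [TopologicalSpace B] {J : ModelWithCorners 𝕜 F B} [J.Boundaryless]
    {N : Type*} [TopologicalSpace N] [ChartedSpace B N] [IsManifold J 1 N]
    {x : N} {y : F} (hy : y ∈ (extChartAt J x).target) :
    MDifferentiableAt 𝓘(𝕜, F) J (extChartAt J x).symm y := by
  have h := mdifferentiableWithinAt_extChartAt_symm (I := J) hy
  rwa [J.range_eq_univ, mdifferentiableWithinAt_univ] at h

/-- A differentiable map with zero differential on a connected manifold is constant. -/
theorem eq_of_hasMFDerivAt_zero [PreconnectedSpace N] {f : N → M}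
    (hf : ∀ x, HasMFDerivAt 𝓘(ℝ, F) 𝓘(ℝ, E) f x 0) (x y : N) : f x = f y := by
  refine IsLocallyConstant.apply_eq_of_preconnectedSpace
    ((IsLocallyConstant.iff_eventually_eq f).2 fun x => ?_) x y
  let φ := extChartAt 𝓘(ℝ, F) x
  let ψ := extChartAt 𝓘(ℝ, E) (f x)
  have hφ : ContinuousAt φ.symm (φ x) := continuousAt_extChartAt_symm x
  have hxx : φ.symm (φ x) = x := extChartAt_to_inv x
  have hS : ∀ᶠ z in 𝓝 (φ x), z ∈ φ.target ∧ f (φ.symm z) ∈ ψ.source := by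
    refine Filter.Eventually.and (extChartAt_target_mem_nhds x) ?_
    have h1 : ContinuousAt f (φ.symm (φ x)) := (hf _).continuousAt
    have h2 := h1.comp hφ
    refine h2.eventually_mem ?_
    rw [Function.comp_apply, hxx]
    exact extChartAt_source_mem_nhds (f x)
  obtain ⟨ε, hε, hball⟩ := Metric.eventually_nhds_iff_ball.1 hS
  have hder : ∀ z ∈ Metric.ball (φ x) ε, HasFDerivAt (ψ ∘ f ∘ φ.symm) (0 : F →L[ℝ] E) z := by
    intro z hz
    obtain ⟨h1, h2⟩ := hball z hz
    have d1 := (mdifferentiableAt_extChartAt_symm (J := 𝓘(ℝ, F)) h1).hasMFDerivAt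
    have d2 := (mdifferentiableAt_extChartAt (I := 𝓘(ℝ, E)) (y := f (φ.symm z)) (x := f x)
      (by rwa [← extChartAt_source 𝓘(ℝ, E)])).hasMFDerivAt
    have d3 := d2.comp z ((hf _).comp z d1)
    rw [ContinuousLinearMap.zero_comp, ContinuousLinearMap.comp_zero] at d3
    exact d3.hasFDerivAt
  have hconst : ∀ z ∈ Metric.ball (φ x) ε, (ψ ∘ f ∘ φ.symm) z = (ψ ∘ f ∘ φ.symm) (φ x) :=
    fun z hz => Metric.isOpen_ball.is_const_of_fderiv_eq_zero (𝕜 := ℝ)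
      (convex_ball _ _).isPreconnected
      (fun z hz => (hder z hz).differentiableAt.differentiableWithinAt)
      (fun z hz => (hder z hz).fderiv) hz (Metric.mem_ball_self hε)
  have h3 : ∀ᶠ y in 𝓝 x, φ y ∈ Metric.ball (φ x) ε :=
    (continuousAt_extChartAt x).eventually_mem (Metric.ball_mem_nhds _ hε)
  filter_upwards [h3, extChartAt_source_mem_nhds (I := 𝓘(ℝ, F)) x] with y hy hys
  have h4 := hconst _ hy
  simp only [Function.comp_apply, hxx] at h4
  have h5 := (hball _ hy).2
  have h6 : φ.symm (φ y) = y := φ.left_inv hys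
  rw [h6] at h4 h5
  exact ψ.injOn h5 (mem_extChartAt_source _) h4

end Manifolds

/-! ### Factors through immersions and local sections of submersions. -/

section Factor

open Set Filter Topology

variable {F : Type*} [NormedAddCommGroup F] [NormedSpace ℝ F]
  {G : Type*} [NormedAddCommGroup G] [NormedSpace ℝ G]
  {E : Type*} [NormedAddCommGroup E] [NormedSpace ℝ E] [FiniteDimensional ℝ E]

/-- A continuous factor through an immersion of a differentiable map is differentiable. -/
theorem differentiableAt_factor {f : F → E} {j : G → E} {i : F → G} {x : F} {f' : F →L[ℝ] E}
    {j' : G →L[ℝ] E} (hf : HasFDerivAt f f' x) (hj : HasFDerivAt j j' (i x))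
    (hinj : Function.Injective j') (hi : ContinuousAt i x) (hfac : ∀ᶠ y in 𝓝 x, f y = j (i y)) :
    DifferentiableAt ℝ i x := by
  obtain ⟨B₀, hB₀⟩ := LinearMap.exists_leftInverse_of_injective (j' : G →ₗ[ℝ] E)
    (LinearMap.ker_eq_bot.2 hinj)
  let A : E →L[ℝ] G := LinearMap.toContinuousLinearMap B₀
  have hA : ∀ u, A (j' u) = u := fun u => LinearMap.congr_fun hB₀ u
  have hjo : (fun z => j z - j (i x) - j' (z - i x)) =o[𝓝 (i x)] fun z => z - i x := hj.isLittleO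
  have h0 : (fun z => (z - i x) - A (j z - j (i x))) =o[𝓝 (i x)] fun z => z - i x := by
    have := ((A.isBigO_comp (fun z => j z - j (i x) - j' (z - i x)) (𝓝 (i x))).trans_isLittleO
      hjo).neg_left
    refine this.congr_left fun z => ?_
    rw [map_sub, hA]
    abel
  -- The left inverse `A` of `j'` bounds `i y - i x` by `j (i y) - j (i x)`. Continuity of `i` is
  -- what allows this local estimate to be pulled back along `i`.
  have h1 : (fun y => i y - i x) =O[𝓝 x] fun y => j (i y) - j (i x) := by
    have h : (fun z => z - i x) =O[𝓝 (i x)] fun z => j z - j (i x) :=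
      (h0.right_isBigO_sub.congr_right fun z => by abel).trans
        (A.isBigO_comp (fun z => j z - j (i x)) (𝓝 (i x)))
    exact h.comp_tendsto hi
  have h2 : (fun y => j (i y) - j (i x)) =O[𝓝 x] fun y => y - x := by
    refine hf.isBigO_sub.congr' ?_ EventuallyEq.rfl
    filter_upwards [hfac] with y hy
    rw [hy, hfac.self_of_nhds]
  have h3 : (fun y => j (i y) - j (i x) - j' (i y - i x)) =o[𝓝 x] fun y => y - x :=
    (hj.isLittleO.comp_tendsto hi).trans_isBigO (h1.trans h2)
  have h4 : (fun y => f y - f x - f' (y - x)) =o[𝓝 x] fun y => y - x := hf.isLittleO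
  have h5 : (fun y => j' (i y - i x) - f' (y - x)) =o[𝓝 x] fun y => y - x := by
    refine (h4.sub h3).congr' ?_ EventuallyEq.rfl
    filter_upwards [hfac] with y hy
    rw [hy, hfac.self_of_nhds]
    abel
  have h6 := (A.isBigO_comp (fun y => j' (i y - i x) - f' (y - x)) (𝓝 x)).trans_isLittleO h5
  refine (HasFDerivAt.of_isLittleO (f' := A.comp f') ?_).differentiableAt
  simpa [hA] using h6

end Factor

section Manifolds

open Set Filter Topology

variable {F : Type*} [NormedAddCommGroup F] [NormedSpace ℝ F]
  {N : Type*} [TopologicalSpace N] [ChartedSpace F N]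
  {G : Type*} [NormedAddCommGroup G] [NormedSpace ℝ G]
  {P : Type*} [TopologicalSpace P] [ChartedSpace G P]
  {E : Type*} [NormedAddCommGroup E] [NormedSpace ℝ E]
  {M : Type*} [TopologicalSpace M] [ChartedSpace E M]

/-- The differential in the preferred charts, as a map between the model spaces. -/
theorem hasFDerivAt_of_mdifferentiableAt {f : N → M} {x : N}
    (hf : MDifferentiableAt 𝓘(ℝ, F) 𝓘(ℝ, E) f x) :
    ∃ D : F →L[ℝ] E, (∀ v, D v = mfderiv 𝓘(ℝ, F) 𝓘(ℝ, E) f x v) ∧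
      HasFDerivAt (writtenInExtChartAt 𝓘(ℝ, F) 𝓘(ℝ, E) x f) D (extChartAt 𝓘(ℝ, F) x x) := by
  refine ⟨mfderiv 𝓘(ℝ, F) 𝓘(ℝ, E) f x, fun _ => rfl, ?_⟩
  have h : HasFDerivWithinAt (E := F) (F := E) (writtenInExtChartAt 𝓘(ℝ, F) 𝓘(ℝ, E) x f)
      (mfderiv 𝓘(ℝ, F) 𝓘(ℝ, E) f x) (range 𝓘(ℝ, F)) (extChartAt 𝓘(ℝ, F) x x) :=
    hf.hasMFDerivAt.2
  exact h.hasFDerivAt (by rw [ModelWithCorners.range_eq_univ]; exact univ_mem)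

/-- A continuous factor through an immersion of a differentiable map is differentiable. -/
theorem mdifferentiableAt_factor [FiniteDimensional ℝ E] {f : N → M} {j : P → M} {i : N → P} {x : N}
    (hf : MDifferentiableAt 𝓘(ℝ, F) 𝓘(ℝ, E) f x) (hj : MDifferentiableAt 𝓘(ℝ, G) 𝓘(ℝ, E) j (i x))
    (hinj : Function.Injective (mfderiv 𝓘(ℝ, G) 𝓘(ℝ, E) j (i x)))
    (hi : ContinuousAt i x) (hfac : ∀ y, f y = j (i y)) :
    MDifferentiableAt 𝓘(ℝ, F) 𝓘(ℝ, G) i x := by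
  obtain rfl : f = j ∘ i := funext hfac
  obtain ⟨D₁, -, h1⟩ := hasFDerivAt_of_mdifferentiableAt hf
  obtain ⟨D₂, hD₂, h2⟩ := hasFDerivAt_of_mdifferentiableAt hj
  have hx0 : (extChartAt 𝓘(ℝ, F) x).symm (extChartAt 𝓘(ℝ, F) x x) = x := extChartAt_to_inv x
  have hw : writtenInExtChartAt 𝓘(ℝ, F) 𝓘(ℝ, G) x i (extChartAt 𝓘(ℝ, F) x x) =
      extChartAt 𝓘(ℝ, G) (i x) (i x) := by
    simp only [writtenInExtChartAt, Function.comp_apply, hx0]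
  have hci : ContinuousAt (i ∘ (extChartAt 𝓘(ℝ, F) x).symm) (extChartAt 𝓘(ℝ, F) x x) := by
    refine ContinuousAt.comp ?_ (continuousAt_extChartAt_symm x)
    rwa [hx0]
  refine (mdifferentiableAt_iff _ _).2 ⟨hi, ?_⟩
  rw [ModelWithCorners.range_eq_univ, differentiableWithinAt_univ]
  refine differentiableAt_factor h1 (j := writtenInExtChartAt 𝓘(ℝ, G) 𝓘(ℝ, E) (i x) j) (j' := D₂) ?_
    (fun u v huv => hinj (by rwa [← hD₂, ← hD₂])) ?_ ?_
  · rw [hw]; exact h2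
  · refine ContinuousAt.comp ?_ hci
    rw [Function.comp_apply, hx0]
    exact continuousAt_extChartAt _
  · have h3 : ∀ᶠ y in 𝓝 (extChartAt 𝓘(ℝ, F) x x), i ((extChartAt 𝓘(ℝ, F) x).symm y) ∈
        (extChartAt 𝓘(ℝ, G) (i x)).source := by
      refine hci.eventually_mem ?_
      rw [Function.comp_apply, hx0]
      exact extChartAt_source_mem_nhds _
    filter_upwards [h3] with y hy
    simp only [writtenInExtChartAt, Function.comp_apply, PartialEquiv.left_inv _ hy]

/-- A map with surjective differential at a point has a local section. -/
theorem exists_local_section [IsManifold 𝓘(ℝ, F) ∞ N] [IsManifold 𝓘(ℝ, E) ∞ M]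
    [CompleteSpace F] [FiniteDimensional ℝ E] {π : N → M} (x : N)
    (hπ : ContMDiffAt 𝓘(ℝ, F) 𝓘(ℝ, E) ∞ π x)
    (hs : Function.Surjective (mfderiv 𝓘(ℝ, F) 𝓘(ℝ, E) π x)) :
    ∃ s : M → N, s (π x) = x ∧ ContMDiffAt 𝓘(ℝ, E) 𝓘(ℝ, F) ∞ s (π x) ∧
      ∀ᶠ y in 𝓝 (π x), π (s y) = y := by
  let φ := extChartAt 𝓘(ℝ, F) x
  let ψ := extChartAt 𝓘(ℝ, E) (π x)
  have hx0 : φ.symm (φ x) = x := extChartAt_to_inv x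
  have hg : ContDiffAt ℝ ∞ (ψ ∘ π ∘ φ.symm) (φ x) := by
    have := (contMDiffAt_iff.1 hπ).2
    rwa [ModelWithCorners.range_eq_univ, contDiffWithinAt_univ] at this
  obtain ⟨D, hD, hgd⟩ := hasFDerivAt_of_mdifferentiableAt (hπ.mdifferentiableAt (by simp))
  obtain ⟨R, hR⟩ := ContinuousLinearMap.exists_rightInverse_of_surjective D
    (LinearMap.range_eq_top.2 fun e => (hs e).imp fun v hv => (hD v).trans hv)
  -- On the affine slice through `φ x` in the direction of a right inverse `R` of the differential,
  -- `π` has derivative the identity, so the inverse function theorem applies there and its inverse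
  -- is the section.
  let a : E → F := fun e => φ x + R e
  have ha : ContDiff ℝ ∞ a := contDiff_const.add R.contDiff
  have ha0 : a 0 = φ x := by simp [a]
  have hq : ContDiffAt ℝ ∞ ((ψ ∘ π ∘ φ.symm) ∘ a) 0 :=
    ContDiffAt.comp 0 (by rwa [ha0]) ha.contDiffAt
  have hqd : HasFDerivAt ((ψ ∘ π ∘ φ.symm) ∘ a)
      ((ContinuousLinearEquiv.refl ℝ E : E ≃L[ℝ] E) : E →L[ℝ] E) 0 := by
    have h1 : HasFDerivAt a R 0 := R.hasFDerivAt.const_add _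
    have h2 := HasFDerivAt.comp (g := ψ ∘ π ∘ φ.symm) (g' := D) 0 (by rwa [ha0]) h1
    rw [hR] at h2
    exact h2
  have hq0 : ((ψ ∘ π ∘ φ.symm) ∘ a) 0 = ψ (π x) := by simp [ha0, hx0]
  let b := hq.localInverse hqd (by simp)
  have hb : ContDiffAt ℝ ∞ b (ψ (π x)) := by
    rw [← hq0]; exact hq.to_localInverse hqd (by simp)
  have hb0 : b (ψ (π x)) = 0 := by
    rw [← hq0]; exact hq.localInverse_apply_image hqd (by simp)
  have hbr : ∀ᶠ e in 𝓝 (ψ (π x)), ((ψ ∘ π ∘ φ.symm) ∘ a) (b e) = e := by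
    rw [← hq0]
    exact (hq.hasStrictFDerivAt' hqd (by simp)).eventually_right_inverse
  let s : M → N := φ.symm ∘ a ∘ b ∘ ψ
  have hs0 : s (π x) = x := by simp [s, hb0, ha0, hx0]
  have hsc : ContMDiffAt 𝓘(ℝ, E) 𝓘(ℝ, F) ∞ s (π x) := by
    have h1 : ContMDiffAt 𝓘(ℝ, E) 𝓘(ℝ, E) ∞ ψ (π x) := contMDiffAt_extChartAt
    have h2 : ContMDiffAt 𝓘(ℝ, E) 𝓘(ℝ, F) ∞ (a ∘ b) (ψ (π x)) :=
      (ha.contDiffAt.comp _ hb).contMDiffAt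
    have h3 : ContMDiffAt 𝓘(ℝ, F) 𝓘(ℝ, F) ∞ φ.symm ((a ∘ b) (ψ (π x))) := by
      rw [Function.comp_apply, hb0, ha0]
      exact (contMDiffOn_extChartAt_symm x).contMDiffAt (extChartAt_target_mem_nhds x)
    exact h3.comp (π x) (h2.comp (π x) h1)
  refine ⟨s, hs0, hsc, ?_⟩
  have h1 : ∀ᶠ y in 𝓝 (π x), y ∈ ψ.source := extChartAt_source_mem_nhds _
  have h2 : ∀ᶠ y in 𝓝 (π x), π (s y) ∈ ψ.source := by
    have : ContinuousAt (π ∘ s) (π x) := by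
      refine ContinuousAt.comp ?_ hsc.continuousAt
      rw [hs0]; exact hπ.continuousAt
    refine this.eventually_mem ?_
    rw [Function.comp_apply, hs0]
    exact extChartAt_source_mem_nhds _
  filter_upwards [h1, h2, (continuousAt_extChartAt (I := 𝓘(ℝ, E)) (π x)).eventually hbr]
    with y hy1 hy2 hy3
  exact ψ.injOn hy2 hy1 hy3

end Manifolds

/-! ### Differential forms read in charts. -/

section ChartForms

open Set Filter Topology

variable {𝕜 : Type*} [NontriviallyNormedField 𝕜]
  {F : Type*} [NormedAddCommGroup F] [NormedSpace 𝕜 F]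
  {B : Type*} [TopologicalSpace B] {J : ModelWithCorners 𝕜 F B}
  {N : Type*} [TopologicalSpace N] [ChartedSpace B N]
  {F' : Type*} [NormedAddCommGroup F'] [NormedSpace 𝕜 F']
  {B' : Type*} [TopologicalSpace B'] {J' : ModelWithCorners 𝕜 F' B'}
  {N' : Type*} [TopologicalSpace N'] [ChartedSpace B' N']
  {G : Type*} [NormedAddCommGroup G] [NormedSpace 𝕜 G] {k : ℕ}

/-- The types of the vectors depend on the base point, which blocks rewriting. All tangent spaces
being the model space, point and vectors can be exchanged together. -/
theorem form_congr (α : ∀ x : N, TangentSpace J x [⋀^Fin k]→L[𝕜] G) {x x' : N} (hx : x = x')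
    {v v' : Fin k → F} (hv : v = v') :
    α x (v : Fin k → TangentSpace J x) = α x' (v' : Fin k → TangentSpace J x') := by
  subst hx hv; rfl

/-- The differential of a map, computed through a chart of the target. -/
theorem mfderiv_extChartAt_symm_comp [J.Boundaryless] [IsManifold J 1 N] (x₀ : N) {f : N' → N} {x : N'}
    (hf : MDifferentiableAt J' J f x) (hx : f x ∈ (extChartAt J x₀).source)
    {y : F} (hy : extChartAt J x₀ (f x) = y) (v : F') :
    (mfderiv 𝓘(𝕜, F) J (extChartAt J x₀).symm y : F →L[𝕜] F)
      ((mfderiv J' 𝓘(𝕜, F) (extChartAt J x₀ ∘ f) x : F' →L[𝕜] F) v) =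
      (mfderiv J' J f x : F' →L[𝕜] F) v := by
  subst hy
  have h1 : MDifferentiableAt J 𝓘(𝕜, F) (extChartAt J x₀) (f x) :=
    mdifferentiableAt_extChartAt (by rwa [← extChartAt_source J])
  have h2 := h1.comp x hf
  have h3 : MDifferentiableAt 𝓘(𝕜, F) J (extChartAt J x₀).symm ((extChartAt J x₀ ∘ f) x) :=
    mdifferentiableAt_extChartAt_symm ((extChartAt J x₀).map_source hx)
  have h4 : (extChartAt J x₀).symm ∘ (extChartAt J x₀ ∘ f) =ᶠ[𝓝 x] f := by
    have : ∀ᶠ y in 𝓝 x, f y ∈ (extChartAt J x₀).source :=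
      hf.continuousAt.eventually_mem (extChartAt_source_mem_nhds' hx)
    filter_upwards [this] with y hy
    exact (extChartAt J x₀).left_inv hy
  have h5 : HasMFDerivAt J' J f x
      ((mfderiv 𝓘(𝕜, F) J (extChartAt J x₀).symm ((extChartAt J x₀ ∘ f) x) : F →L[𝕜] F).comp
        (mfderiv J' 𝓘(𝕜, F) (extChartAt J x₀ ∘ f) x : F' →L[𝕜] F)) :=
    (h3.hasMFDerivAt.comp x h2.hasMFDerivAt).congr_of_eventuallyEq h4.symm
  exact congrArg (fun D : F' →L[𝕜] F => D v) h5.mfderiv.symm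

/-- Evaluation of a form on image vectors, in a chart of the target. -/
theorem chartForm_mfderiv [J.Boundaryless] [IsManifold J 1 N]
    (α : ∀ x : N, TangentSpace J x [⋀^Fin k]→L[𝕜] G) (x₀ : N)
    {f : N' → N} {x : N'} (hf : MDifferentiableAt J' J f x)
    (hx : f x ∈ (extChartAt J x₀).source) (v : Fin k → TangentSpace J' x) :
    chartForm J α x₀ (extChartAt J x₀ (f x))
        (fun i => mfderiv J' 𝓘(𝕜, F) (extChartAt J x₀ ∘ f) x (v i)) =
      α (f x) (fun i => mfderiv J' J f x (v i)) := by
  exact form_congr α ((extChartAt J x₀).left_inv hx)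
    (funext fun i => mfderiv_extChartAt_symm_comp x₀ hf hx rfl (v i))

end ChartForms

/-! ### A complex manifold as a real manifold. -/

section RestrictScalars

open Set Filter Topology

variable {E : Type*} [NormedAddCommGroup E] [NormedSpace ℂ E]
  {M : Type*} [TopologicalSpace M] [ChartedSpace E M]
  {E' : Type*} [NormedAddCommGroup E'] [NormedSpace ℂ E']
  {M' : Type*} [TopologicalSpace M'] [ChartedSpace E' M']

/-- The real manifold underlying a complex manifold. -/
theorem isManifold_real [IsManifold 𝓘(ℂ, E) ω M] : IsManifold 𝓘(ℝ, E) ∞ M := by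
  refine isManifold_of_contDiffOn _ _ _ fun e e' he he' => ?_
  have h := ((contDiffGroupoid ω 𝓘(ℂ, E)).compatible he he' :
    e.symm ≫ₕ e' ∈ contDiffGroupoid ω 𝓘(ℂ, E))
  rw [contDiffGroupoid, mem_groupoid_of_pregroupoid] at h
  have h1 : ContDiffOn ℂ ω (𝓘(ℂ, E) ∘ (e.symm ≫ₕ e') ∘ 𝓘(ℂ, E).symm)
    (𝓘(ℂ, E).symm ⁻¹' (e.symm ≫ₕ e').source ∩ range 𝓘(ℂ, E)) := h.1
  exact (h1.restrict_scalars ℝ).of_le le_top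

/-- The real and the complex charts are the same functions; only the scalars of the derivative
change. -/
theorem hasMFDerivAt_restrictScalars {f : M → M'} {x : M}
    {f' : TangentSpace 𝓘(ℂ, E) x →L[ℂ] TangentSpace 𝓘(ℂ, E') (f x)}
    (h : HasMFDerivAt 𝓘(ℂ, E) 𝓘(ℂ, E') f x f') :
    HasMFDerivAt 𝓘(ℝ, E) 𝓘(ℝ, E') f x ((f' : E →L[ℂ] E').restrictScalars ℝ) := by
  refine ⟨h.1, ?_⟩
  have h2 : HasFDerivWithinAt (E := E) (F := E') (writtenInExtChartAt 𝓘(ℂ, E) 𝓘(ℂ, E') x f) f'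
    (range 𝓘(ℂ, E)) (extChartAt 𝓘(ℂ, E) x x) := h.2
  exact h2.restrictScalars ℝ

variable {n : ℕ} (C : CalabiYau n E M)

/-- The holomorphic volume form, as a complex valued form on the real tangent spaces. -/
def CalabiYau.rform (x : M) : TangentSpace 𝓘(ℝ, E) x [⋀^Fin n]→L[ℝ] ℂ :=
  (C.vform x : E [⋀^Fin n]→L[ℂ] ℂ).restrictScalars ℝ

/-- Makes the holomorphy of `Ω`, a condition in complex charts, available for differentiation along
maps that are only real differentiable. -/
theorem CalabiYau.chartForm_rform [IsManifold 𝓘(ℂ, E) ω M] (x₀ : M) {y : E}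
    (hy : y ∈ (extChartAt 𝓘(ℝ, E) x₀).target) :
    chartForm 𝓘(ℝ, E) C.rform x₀ y = (chartForm 𝓘(ℂ, E) C.vform x₀ y).restrictScalars ℝ := by
  have : IsManifold 𝓘(ℂ, E) 1 M := IsManifold.of_le (n := ω) le_top
  have h1 : MDifferentiableAt 𝓘(ℂ, E) 𝓘(ℂ, E) (extChartAt 𝓘(ℂ, E) x₀).symm y :=
    mdifferentiableAt_extChartAt_symm hy
  have h2 := (hasMFDerivAt_restrictScalars h1.hasMFDerivAt).mfderiv
  ext v
  refine congrArg (fun D : E →L[ℝ] E => (C.vform ((extChartAt 𝓘(ℝ, E) x₀).symm y)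
    (fun i => D (v i)) : ℂ)) h2

theorem CalabiYau.differentiableOn_chartForm_rform [IsManifold 𝓘(ℂ, E) ω M] (x₀ : M) :
    DifferentiableOn ℝ (chartForm 𝓘(ℝ, E) C.rform x₀) (extChartAt 𝓘(ℝ, E) x₀).target := by
  have h1 : DifferentiableOn ℝ (chartForm 𝓘(ℂ, E) C.vform x₀) (extChartAt 𝓘(ℝ, E) x₀).target :=
    (C.vform_holomorphic x₀).restrictScalars ℝ
  have h2 : DifferentiableOn ℝ
      (fun y => (chartForm 𝓘(ℂ, E) C.vform x₀ y).restrictScalars ℝ)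
      (extChartAt 𝓘(ℝ, E) x₀).target :=
    fun y hy => ((ContinuousAlternatingMap.restrictScalarsLI (𝕜 := ℂ) (E := E) (F := ℂ)
      (ι := Fin n) ℝ).toContinuousLinearMap.differentiableAt).comp_differentiableWithinAt y (h1 y hy)
  exact h2.congr fun y hy => C.chartForm_rform x₀ hy

end RestrictScalars

/-! ### One-parameter subgroups and the exponential map. -/

section OneParameter

set_option linter.unusedSectionVars false

open Set Filter Topology

variable {EH : Type*} [NormedAddCommGroup EH] [NormedSpace ℝ EH]
  {H : Type*} [TopologicalSpace H] [ChartedSpace EH H] [Group H] [LieGroup 𝓘(ℝ, EH) ∞ H]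

/-- Charts make points closed, and a `T₁` topological group is Hausdorff. This is needed for the
uniqueness of integral curves. -/
theorem t2Space_of_lieGroup (EH : Type*) [NormedAddCommGroup EH] [NormedSpace ℝ EH]
    (H : Type*) [TopologicalSpace H] [ChartedSpace EH H] [Group H] [LieGroup 𝓘(ℝ, EH) ∞ H] :
    T2Space H := by
  have := topologicalGroup_of_lieGroup 𝓘(ℝ, EH) ∞ (G := H)
  have : T1Space H := ChartedSpace.t1Space EH H
  infer_instance

theorem mdifferentiableAt_mul_left' (g h : H) :
    MDifferentiableAt 𝓘(ℝ, EH) 𝓘(ℝ, EH) (fun x : H => g * x) h :=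
  (contMDiffAt_mul_left (n := ∞)).mdifferentiableAt (by simp)

theorem mfderiv_mul_left_mulInvariantVectorField (ξ : GroupLieAlgebra 𝓘(ℝ, EH) H) (g h : H) :
    mfderiv 𝓘(ℝ, EH) 𝓘(ℝ, EH) (fun x : H => g * x) h (mulInvariantVectorField ξ h) =
      mulInvariantVectorField ξ (g * h) := by
  have h1 : HasMFDerivAt 𝓘(ℝ, EH) 𝓘(ℝ, EH) (fun x : H => h * x) 1 _ :=
    (mdifferentiableAt_mul_left' h 1).hasMFDerivAt
  have h2 : HasMFDerivAt 𝓘(ℝ, EH) 𝓘(ℝ, EH) (fun x : H => g * x) (h * 1) _ :=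
    (mdifferentiableAt_mul_left' g (h * 1)).hasMFDerivAt
  have h3 := h2.comp 1 h1
  have h4 : (fun x : H => g * x) ∘ (fun x : H => h * x) = fun x => g * h * x := by
    ext x; simp [mul_assoc]
  rw [h4] at h3
  have h5 := congrArg (fun D : EH →L[ℝ] EH => D ξ) h3.mfderiv
  have h6 : (mfderiv 𝓘(ℝ, EH) 𝓘(ℝ, EH) (fun x : H => g * x) (h * 1) : EH →L[ℝ] EH) =
    mfderiv 𝓘(ℝ, EH) 𝓘(ℝ, EH) (fun x : H => g * x) h := by rw [mul_one]
  refine Eq.trans ?_ h5.symm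
  exact congrArg (fun D : EH →L[ℝ] EH => D (mulInvariantVectorField ξ h : EH)) h6.symm

theorem contMDiff_mulInvariantVectorField_one (ξ : GroupLieAlgebra 𝓘(ℝ, EH) H) :
    ContMDiff 𝓘(ℝ, EH) 𝓘(ℝ, EH).tangent 1
      (fun g : H => (⟨g, mulInvariantVectorField ξ g⟩ : TangentBundle 𝓘(ℝ, EH) H)) := by
  have : LieGroup 𝓘(ℝ, EH) (minSmoothness ℝ 3) H := by
    refine LieGroup.of_le (n := ∞) ?_
    rw [minSmoothness_of_isRCLikeNormedField]
    exact WithTop.coe_le_coe.2 le_top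
  refine (contMDiff_mulInvariantVectorField ξ).of_le ?_
  rw [minSmoothness_of_isRCLikeNormedField]
  norm_num

theorem smulRight_map_eq_comp {F G : Type*} [NormedAddCommGroup F] [NormedSpace ℝ F]
    [NormedAddCommGroup G] [NormedSpace ℝ G] (D : F →L[ℝ] G) {u : F} {v : G} (h : D u = v) :
    ((1 : ℝ →L[ℝ] ℝ).smulRight v : ℝ →L[ℝ] G) = D.comp ((1 : ℝ →L[ℝ] ℝ).smulRight u) := by
  subst h; ext; simp

theorem IsMIntegralCurve.mul_left {ξ : GroupLieAlgebra 𝓘(ℝ, EH) H} {γ : ℝ → H}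
    (hγ : IsMIntegralCurve (I := 𝓘(ℝ, EH)) γ (mulInvariantVectorField ξ)) (g : H) :
    IsMIntegralCurve (I := 𝓘(ℝ, EH)) (fun t => g * γ t) (mulInvariantVectorField ξ) := by
  intro t
  have h1 := (mdifferentiableAt_mul_left' (EH := EH) g (γ t)).hasMFDerivAt.comp t (hγ t)
  have h2 : ((1 : ℝ →L[ℝ] ℝ).smulRight (mulInvariantVectorField ξ (g * γ t)) : ℝ →L[ℝ] EH) =
      (mfderiv 𝓘(ℝ, EH) 𝓘(ℝ, EH) (fun x : H => g * x) (γ t) : EH →L[ℝ] EH).comp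
        ((1 : ℝ →L[ℝ] ℝ).smulRight (mulInvariantVectorField ξ (γ t)) : ℝ →L[ℝ] EH) := by
    exact smulRight_map_eq_comp (F := EH) (G := EH) _ (mfderiv_mul_left_mulInvariantVectorField ξ g (γ t))
  exact h2 ▸ h1

theorem IsOneParam.zero {γ : ℝ → H} {ξ : GroupLieAlgebra 𝓘(ℝ, EH) H} (h : IsOneParam γ ξ) :
    γ 0 = 1 := by
  have := h.1 0 0
  rw [add_zero] at this
  exact left_eq_mul.1 this

theorem IsOneParam.hasMFDerivAt_zero {γ : ℝ → H} {ξ : GroupLieAlgebra 𝓘(ℝ, EH) H}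
    (h : IsOneParam γ ξ) :
    HasMFDerivAt 𝓘(ℝ, ℝ) 𝓘(ℝ, EH) γ 0 ((1 : ℝ →L[ℝ] ℝ).smulRight (ξ : EH) : ℝ →L[ℝ] EH) := by
  have h1 := h.2.1.hasMFDerivAt
  have h2 : (mfderiv 𝓘(ℝ, ℝ) 𝓘(ℝ, EH) γ 0 : ℝ →L[ℝ] EH) =
      (1 : ℝ →L[ℝ] ℝ).smulRight (ξ : EH) := by
    refine ContinuousLinearMap.ext_ring (h.2.2.trans ?_)
    exact (one_smul ℝ (ξ : EH)).symm
  exact h2 ▸ h1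

/-- A one-parameter subgroup is an integral curve of the invariant vector field. -/
theorem IsOneParam.isMIntegralCurve {γ : ℝ → H} {ξ : GroupLieAlgebra 𝓘(ℝ, EH) H}
    (h : IsOneParam γ ξ) :
    IsMIntegralCurve (I := 𝓘(ℝ, EH)) γ (mulInvariantVectorField ξ) := by
  intro t
  have h0 := h.hasMFDerivAt_zero
  have h1 : HasMFDerivAt 𝓘(ℝ, ℝ) 𝓘(ℝ, ℝ) (fun s : ℝ => s - t) t (ContinuousLinearMap.id ℝ ℝ) :=
    ((hasFDerivAt_id t).sub_const t).hasMFDerivAt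
  have h2 : HasMFDerivAt 𝓘(ℝ, ℝ) 𝓘(ℝ, EH) γ (t - t)
      ((1 : ℝ →L[ℝ] ℝ).smulRight (ξ : EH) : ℝ →L[ℝ] EH) := by rw [sub_self]; exact h0
  have h3 : HasMFDerivAt 𝓘(ℝ, EH) 𝓘(ℝ, EH) (fun x : H => γ t * x) (γ (t - t))
      (mfderiv 𝓘(ℝ, EH) 𝓘(ℝ, EH) (fun x : H => γ t * x) 1 : EH →L[ℝ] EH) := by
    rw [sub_self, h.zero]
    exact (mdifferentiableAt_mul_left' (γ t) 1).hasMFDerivAt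
  have h4 := h3.comp t (HasMFDerivAt.comp (f := fun s : ℝ => s - t) t h2 h1)
  have h5 : (fun x : H => γ t * x) ∘ γ ∘ (fun s : ℝ => s - t) = γ := by
    ext s
    simp [← h.1]
  rw [h5] at h4
  have h6 : ((1 : ℝ →L[ℝ] ℝ).smulRight (mulInvariantVectorField ξ (γ t)) : ℝ →L[ℝ] EH) =
      (mfderiv 𝓘(ℝ, EH) 𝓘(ℝ, EH) (fun x : H => γ t * x) 1 : EH →L[ℝ] EH).comp
        (((1 : ℝ →L[ℝ] ℝ).smulRight (ξ : EH) : ℝ →L[ℝ] EH).comp (ContinuousLinearMap.id ℝ ℝ)) := by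
    exact smulRight_map_eq_comp (F := EH) (G := EH) _ rfl
  exact h6 ▸ h4

/-- Both are integral curves of the same invariant field with the same initial point. -/
theorem IsOneParam.unique {γ γ' : ℝ → H} {ξ : GroupLieAlgebra 𝓘(ℝ, EH) H} [CompleteSpace EH]
    (h : IsOneParam γ ξ) (h' : IsOneParam γ' ξ) : γ = γ' := by
  have := t2Space_of_lieGroup EH H
  have : IsManifold 𝓘(ℝ, EH) 1 H := IsManifold.of_le (n := ∞) (by simp)
  exact isMIntegralCurve_Ioo_eq_of_contMDiff_boundaryless (t₀ := 0)
    (contMDiff_mulInvariantVectorField_one ξ) h.isMIntegralCurve h'.isMIntegralCurve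
    (h.zero.trans h'.zero.symm)

/-- Left translations carry an integral curve through `1` to one through any other point, on the
same time interval; a uniform existence time makes the field complete. The homomorphism law is
uniqueness for `t ↦ γ (s + t)` and `t ↦ γ s * γ t`. -/
theorem exists_isOneParam [CompleteSpace EH] (ξ : GroupLieAlgebra 𝓘(ℝ, EH) H) :
    ∃ γ : ℝ → H, IsOneParam γ ξ := by
  have := t2Space_of_lieGroup EH H
  have : IsManifold 𝓘(ℝ, EH) 1 H := IsManifold.of_le (n := ∞) (by simp)
  have hv := contMDiff_mulInvariantVectorField_one ξ
  obtain ⟨γ₀, h0, hγ₀⟩ := exists_isMIntegralCurveAt_of_contMDiffAt_boundaryless 0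
    (hv.contMDiffAt (x := 1))
  obtain ⟨ε, hε, hγε⟩ := isMIntegralCurveAt_iff'.1 hγ₀
  rw [Real.ball_eq_Ioo, zero_sub, zero_add] at hγε
  obtain ⟨γ, hγ0, hγ⟩ := exists_isMIntegralCurve_of_isMIntegralCurveOn hv hε (fun x => by
    refine ⟨fun t => x * γ₀ t, by simp [h0], fun t ht => ?_⟩
    have h1 := (mdifferentiableAt_mul_left' (EH := EH) x
      (γ₀ t)).hasMFDerivAt.comp_hasMFDerivWithinAt t (hγε t ht)
    have h2 : ((1 : ℝ →L[ℝ] ℝ).smulRight (mulInvariantVectorField ξ (x * γ₀ t)) : ℝ →L[ℝ] EH) =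
        (mfderiv 𝓘(ℝ, EH) 𝓘(ℝ, EH) (fun y : H => x * y) (γ₀ t) : EH →L[ℝ] EH).comp
          ((1 : ℝ →L[ℝ] ℝ).smulRight (mulInvariantVectorField ξ (γ₀ t)) : ℝ →L[ℝ] EH) := by
      exact smulRight_map_eq_comp (F := EH) (G := EH) _ (mfderiv_mul_left_mulInvariantVectorField ξ x (γ₀ t))
    exact h2 ▸ h1) 1
  refine ⟨γ, fun s t => ?_, (hγ 0).mdifferentiableAt, ?_⟩
  · have h1 := hγ.comp_add s
    have h2 := IsMIntegralCurve.mul_left hγ (γ s)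
    have h3 := isMIntegralCurve_Ioo_eq_of_contMDiff_boundaryless (t₀ := 0) hv h1 h2
      (by simp [hγ0])
    simpa [add_comm] using congrFun h3 t
  · rw [(hγ 0).mfderiv]
    change (1 : ℝ) • (mulInvariantVectorField ξ (γ 0) : EH) = ξ
    rw [one_smul, hγ0]
    have h1 : (fun x : H => 1 * x) = id := by ext; simp
    have h2 : HasMFDerivAt 𝓘(ℝ, EH) 𝓘(ℝ, EH) (fun x : H => 1 * x) 1
        (ContinuousLinearMap.id ℝ EH) := by
      rw [h1]; exact hasMFDerivAt_id 1
    exact congrArg (fun D : EH →L[ℝ] EH => D ξ) h2.mfderiv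

theorem lieExp_eq [CompleteSpace EH] {γ : ℝ → H} {ξ : GroupLieAlgebra 𝓘(ℝ, EH) H}
    (h : IsOneParam γ ξ) : lieExp ξ = γ 1 := by
  have h1 : ∃ γ : ℝ → H, IsOneParam γ ξ := ⟨γ, h⟩
  rw [lieExp, dif_pos h1, h1.choose_spec.unique h]

theorem IsOneParam.lieExp_smul [CompleteSpace EH] {γ : ℝ → H} {ξ : GroupLieAlgebra 𝓘(ℝ, EH) H}
    (h : IsOneParam γ ξ) (t : ℝ) : lieExp (t • ξ) = γ t := by
  have h1 : IsOneParam (fun s => γ (t * s)) (t • ξ) := by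
    have h3 : HasMFDerivAt 𝓘(ℝ, ℝ) 𝓘(ℝ, ℝ) (fun s : ℝ => t * s) 0
        (t • ContinuousLinearMap.id ℝ ℝ) :=
      ((hasFDerivAt_id (0 : ℝ)).const_mul t).hasMFDerivAt
    have h4 : HasMFDerivAt 𝓘(ℝ, ℝ) 𝓘(ℝ, EH) γ (t * 0)
        ((1 : ℝ →L[ℝ] ℝ).smulRight (ξ : EH) : ℝ →L[ℝ] EH) := by
      rw [mul_zero]; exact h.hasMFDerivAt_zero
    have h5 := HasMFDerivAt.comp (f := fun s : ℝ => t * s) 0 h4 h3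
    refine ⟨fun s u => by simp only [mul_add, h.1], h5.mdifferentiableAt, ?_⟩
    refine (congrArg (fun D : ℝ →L[ℝ] EH => D 1) h5.mfderiv).trans ?_
    change (t * 1) • (ξ : EH) = t • (ξ : EH)
    rw [mul_one]
  rw [lieExp_eq h1, mul_one]

end OneParameter

/-! ### Exponentials generate a connected Lie group. -/

section Exponentials

open Set Filter Topology

/-- Integral curves of a `C¹` vector field are `C¹`. -/
theorem contMDiffAt_of_isMIntegralCurve {E : Type*} [NormedAddCommGroup E] [NormedSpace ℝ E]
    {M : Type*} [TopologicalSpace M] [ChartedSpace E M] [IsManifold 𝓘(ℝ, E) 2 M]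
    [IsManifold 𝓘(ℝ, E) 1 M]
    {v : ∀ x : M, TangentSpace 𝓘(ℝ, E) x} {γ : ℝ → M}
    (hv : ContMDiff 𝓘(ℝ, E) 𝓘(ℝ, E).tangent 1
      (fun x => (⟨x, v x⟩ : TangentBundle 𝓘(ℝ, E) M)))
    (hγ : IsMIntegralCurve (I := 𝓘(ℝ, E)) γ v) (t₀ : ℝ) :
    ContMDiffAt 𝓘(ℝ, ℝ) 𝓘(ℝ, E) 1 γ t₀ := by
  refine contMDiffAt_iff_target.2 ⟨hγ.continuous.continuousAt, ?_⟩
  rw [contMDiffAt_iff_contDiffAt, contDiffAt_one_iff]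
  have h1 := (Bundle.contMDiffAt_totalSpace.1 (hv.contMDiffAt (x := γ t₀))).2
  have h2 := ((contMDiffAt_iff_contMDiffAt_nhds (by simp)).1 h1).mono fun x hx => hx.continuousAt
  have h3 := (hγ.continuous.tendsto t₀).eventually h2
  have h4 := (hγ.isMIntegralCurveAt t₀).eventually_hasDerivAt
  refine ⟨fun t => (1 : ℝ →L[ℝ] ℝ).smulRight
    (tangentCoordChange 𝓘(ℝ, E) (γ t) (γ t₀) (γ t) (v (γ t))), _, h3.and h4, ?_, ?_⟩
  · intro t ht
    refine ContinuousAt.continuousWithinAt ?_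
    have h5 : ContinuousAt (fun t => tangentCoordChange 𝓘(ℝ, E) (γ t) (γ t₀) (γ t) (v (γ t))) t :=
      ContinuousAt.comp (f := γ) ht.1 hγ.continuous.continuousAt
    exact ((ContinuousLinearMap.smulRightL ℝ ℝ E (1 : ℝ →L[ℝ] ℝ)).continuous.continuousAt).comp h5
  · intro t ht
    exact ht.2.hasFDerivAt

theorem _root_.List.prod_map_eq_of_forall_ne {ι G : Type*} [Monoid G] {l : List ι} (hl : l.Nodup)
    {i : ι} (hi : i ∈ l) {g : ι → G} (hg : ∀ j, j ≠ i → g j = 1) : (l.map g).prod = g i := by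
  induction l with
  | nil => simp at hi
  | cons a l ih =>
    rw [List.nodup_cons] at hl
    rw [List.map_cons, List.prod_cons]
    rcases List.mem_cons.1 hi with rfl | h
    · rw [List.prod_eq_one, mul_one]
      intro x hx
      obtain ⟨j, hj, rfl⟩ := List.mem_map.1 hx
      exact hg j fun h => hl.1 (h ▸ hj)
    · rw [ih hl.2 h, hg a fun h' => hl.1 (h' ▸ h), one_mul]

variable {EH : Type*} [NormedAddCommGroup EH] [NormedSpace ℝ EH] [FiniteDimensional ℝ EH]
  {H : Type*} [TopologicalSpace H] [ChartedSpace EH H] [Group H] [LieGroup 𝓘(ℝ, EH) ∞ H]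

theorem lieExp_neg (ξ : GroupLieAlgebra 𝓘(ℝ, EH) H) : lieExp (-ξ) = (lieExp ξ)⁻¹ := by
  have : CompleteSpace EH := FiniteDimensional.complete ℝ EH
  obtain ⟨γ, hγ⟩ := exists_isOneParam ξ
  have h1 := hγ.lieExp_smul (-1)
  rw [neg_one_smul] at h1
  rw [h1, lieExp_eq hγ, eq_inv_iff_mul_eq_one, ← hγ.1, neg_add_cancel, hγ.zero]

/-- The exponentials generate a neighbourhood of the identity. -/
theorem closure_range_lieExp_mem_nhds :
    (Subgroup.closure (range (lieExp : GroupLieAlgebra 𝓘(ℝ, EH) H → H)) : Set H) ∈ 𝓝 (1 : H) := by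
  have : CompleteSpace EH := FiniteDimensional.complete ℝ EH
  have : IsManifold 𝓘(ℝ, EH) 1 H := IsManifold.of_le (n := ∞) (by simp)
  have : IsManifold 𝓘(ℝ, EH) 2 H := IsManifold.of_le (n := ∞) (WithTop.coe_le_coe.2 le_top)
  have : LieGroup 𝓘(ℝ, EH) 1 H := LieGroup.of_le (n := ∞) (by simp)
  set S := Subgroup.closure (range (lieExp : GroupLieAlgebra 𝓘(ℝ, EH) H → H))
  let m := Module.finrank ℝ EH
  let b : Module.Basis (Fin m) ℝ EH := Module.finBasis ℝ EH
  choose γ hγ using fun i : Fin m => exists_isOneParam (H := H) (EH := EH) (b i)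
  let χ := extChartAt 𝓘(ℝ, EH) (1 : H)
  -- Coordinates of the second kind: an ordered product of the one-parameter subgroups of a basis.
  -- The derivative at `0` sends the standard basis to `b`, so it is onto and `ψ` maps
  -- neighbourhoods of `0` to neighbourhoods of `1`.
  let ψ : (Fin m → ℝ) → H := fun t => ((List.finRange m).map fun i => γ i (t i)).prod
  have hψS : ∀ t, ψ t ∈ S := by
    intro t
    refine Subgroup.list_prod_mem _ fun x hx => ?_
    obtain ⟨i, -, rfl⟩ := List.mem_map.1 hx
    rw [← (hγ i).lieExp_smul]
    exact Subgroup.subset_closure (mem_range_self _)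
  have hψ0 : ψ 0 = 1 := by
    refine List.prod_eq_one fun x hx => ?_
    obtain ⟨i, -, rfl⟩ := List.mem_map.1 hx
    exact (hγ i).zero
  have hψi : ∀ i s, ψ (Pi.single i s) = γ i s := by
    intro i s
    have := List.prod_map_eq_of_forall_ne (List.nodup_finRange m) (List.mem_finRange i)
      (g := fun j => γ j ((Pi.single i s : Fin m → ℝ) j)) (fun j hj => by
        simp only [Pi.single_eq_of_ne hj]
        exact (hγ j).zero)
    simpa using this
  have hψc : ContMDiffAt 𝓘(ℝ, Fin m → ℝ) 𝓘(ℝ, EH) 1 ψ 0 := by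
    have hγc : ∀ i, ContMDiffAt 𝓘(ℝ, Fin m → ℝ) 𝓘(ℝ, EH) 1 (fun t : Fin m → ℝ => γ i (t i)) 0 := by
      intro i
      have h1 : ContMDiffAt 𝓘(ℝ, ℝ) 𝓘(ℝ, EH) 1 (γ i) ((0 : Fin m → ℝ) i) :=
        contMDiffAt_of_isMIntegralCurve (contMDiff_mulInvariantVectorField_one _)
          (hγ i).isMIntegralCurve _
      have h2 : ContMDiffAt 𝓘(ℝ, Fin m → ℝ) 𝓘(ℝ, ℝ) 1 (fun t : Fin m → ℝ => t i) 0 :=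
        (contDiff_apply ℝ ℝ i).contDiffAt.contMDiffAt
      exact ContMDiffAt.comp (0 : Fin m → ℝ) h1 h2
    have h : ∀ l : List (Fin m), ContMDiffAt 𝓘(ℝ, Fin m → ℝ) 𝓘(ℝ, EH) 1
        (fun t : Fin m → ℝ => (l.map fun i => γ i (t i)).prod) 0 := by
      intro l
      induction l with
      | nil => simpa using contMDiffAt_const
      | cons a l ih =>
        simp only [List.map_cons, List.prod_cons]
        exact (hγc a).mul ih
    exact h _
  have hχψ : ContDiffAt ℝ 1 (χ ∘ ψ) 0 := by
    have h1 : ContMDiffAt 𝓘(ℝ, EH) 𝓘(ℝ, EH) 1 χ (ψ 0) := by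
      rw [hψ0]; exact contMDiffAt_extChartAt
    exact (h1.comp 0 hψc).contDiffAt
  have hstrict := hχψ.hasStrictFDerivAt (by simp)
  set D := fderiv ℝ (χ ∘ ψ) 0
  have hD : ∀ i, D (Pi.single i 1) = b i := by
    intro i
    have h1 : HasFDerivAt (χ ∘ ψ) D ((ContinuousLinearMap.single ℝ (fun _ : Fin m => ℝ) i) 0) := by
      rw [map_zero]; exact hstrict.hasFDerivAt
    have h2 := h1.comp 0 (ContinuousLinearMap.single ℝ (fun _ : Fin m => ℝ) i).hasFDerivAt
    have h3 : (χ ∘ ψ) ∘ (ContinuousLinearMap.single ℝ (fun _ : Fin m => ℝ) i) = χ ∘ γ i := by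
      ext s
      simp [hψi]
    rw [h3] at h2
    obtain ⟨D', hD', h4⟩ := hasFDerivAt_of_mdifferentiableAt (hγ i).2.1
    have h5 : writtenInExtChartAt 𝓘(ℝ, ℝ) 𝓘(ℝ, EH) 0 (γ i) = χ ∘ γ i := by
      simp only [writtenInExtChartAt, (hγ i).zero]
      rfl
    rw [h5] at h4
    have h6 := congrArg (fun D : ℝ →L[ℝ] EH => D 1) (h2.unique h4)
    refine Eq.trans ?_ (h6.trans ((hD' 1).trans (hγ i).2.2))
    simp
  have hsurj : D.range = ⊤ := by
    refine eq_top_iff.2 fun x _ => ?_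
    rw [← b.sum_repr x]
    refine Submodule.sum_mem _ fun i _ => Submodule.smul_mem _ _ ?_
    exact ⟨_, hD i⟩
  have hmap := hstrict.map_nhds_eq_of_surj hsurj
  have hsrc : ∀ᶠ t in 𝓝 (0 : Fin m → ℝ), ψ t ∈ χ.source := by
    refine hψc.continuousAt.eventually_mem ?_
    rw [hψ0]
    exact extChartAt_source_mem_nhds _
  have himg : (χ ∘ ψ) '' {t | ψ t ∈ χ.source} ∈ 𝓝 (χ 1) := by
    have h1 := image_mem_map (m := χ ∘ ψ) hsrc
    rwa [hmap, Function.comp_apply, hψ0] at h1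
  filter_upwards [extChartAt_source_mem_nhds (I := 𝓘(ℝ, EH)) (1 : H),
    (continuousAt_extChartAt (I := 𝓘(ℝ, EH)) (1 : H)).preimage_mem_nhds himg] with h hh1 hh2
  obtain ⟨t, ht, hth⟩ := hh2
  rw [← χ.injOn ht hh1 hth]
  exact hψS t

/-- In a connected Lie group every element is a product of exponentials. -/
theorem exists_eq_prod_lieExp [ConnectedSpace H] (h : H) :
    ∃ η : List (GroupLieAlgebra 𝓘(ℝ, EH) H), h = (η.map lieExp).prod := by
  have := topologicalGroup_of_lieGroup 𝓘(ℝ, EH) ∞ (G := H)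
  -- An open subgroup is closed, hence all of the connected group. Inverses of exponentials are
  -- exponentials, so the generated subgroup consists of finite products.
  have hopen := Subgroup.isOpen_of_mem_nhds _ (closure_range_lieExp_mem_nhds (EH := EH) (H := H))
  have hclopen : IsClopen (Subgroup.closure
      (range (lieExp : GroupLieAlgebra 𝓘(ℝ, EH) H → H)) : Set H) :=
    ⟨Subgroup.isClosed_of_isOpen _ hopen, hopen⟩
  have huniv := hclopen.eq_univ ⟨1, one_mem _⟩
  have hmem : h ∈ (Subgroup.closure (range (lieExp : GroupLieAlgebra 𝓘(ℝ, EH) H → H))).toSubmonoid := by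
    have : h ∈ (univ : Set H) := mem_univ h
    rwa [← huniv] at this
  rw [Subgroup.closure_toSubmonoid] at hmem
  obtain ⟨l, hl, rfl⟩ := Submonoid.exists_list_of_mem_closure hmem
  have : ∀ x ∈ l, ∃ ξ : GroupLieAlgebra 𝓘(ℝ, EH) H, lieExp ξ = x := by
    intro x hx
    rcases hl x hx with ⟨ξ, rfl⟩ | ⟨ξ, hξ⟩
    · exact ⟨ξ, rfl⟩
    · exact ⟨-ξ, by rw [lieExp_neg, hξ, inv_inv]⟩
  clear hmem hl
  induction l with
  | nil => exact ⟨[], by simp⟩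
  | cons a l ih =>
    obtain ⟨η, hη⟩ := ih fun x hx => this x (List.mem_cons_of_mem _ hx)
    obtain ⟨ξ, hξ⟩ := this a List.mem_cons_self
    exact ⟨ξ :: η, by simp [hη, hξ]⟩

end Exponentials

/-! ### Cartan's formula for closed two-forms, in coordinates. -/

section TwoForms

open Set Filter Topology

variable {P : Type*} [NormedAddCommGroup P] [NormedSpace ℝ P]
  {E : Type*} [NormedAddCommGroup E] [NormedSpace ℝ E]

theorem differentiableAt_clm_of_apply {𝕜 D E F : Type*} [NontriviallyNormedField 𝕜]
    [CompleteSpace 𝕜] [NormedAddCommGroup D] [NormedSpace 𝕜 D] [NormedAddCommGroup E]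
    [NormedSpace 𝕜 E] [FiniteDimensional 𝕜 E] [NormedAddCommGroup F] [NormedSpace 𝕜 F]
    {f : D → E →L[𝕜] F} {x : D} (h : ∀ v, DifferentiableAt 𝕜 (fun y => f y v) x) :
    DifferentiableAt 𝕜 f x := by
  let d := Module.finrank 𝕜 E
  have hd : d = Module.finrank 𝕜 (Fin d → 𝕜) := (Module.finrank_fin_fun 𝕜).symm
  let e₁ := ContinuousLinearEquiv.ofFinrankEq hd
  let e₂ := (e₁.arrowCongr (1 : F ≃L[𝕜] F)).trans (ContinuousLinearEquiv.piRing (Fin d))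
  rw [← Function.id_comp f, ← e₂.symm_comp_self]
  exact e₂.symm.differentiableAt.comp x (differentiableAt_pi.2 fun i => h _)

theorem hasFDerivAt_two_form_apply {w : P → E [⋀^Fin 2]→L[ℝ] ℝ}
    {w' : P →L[ℝ] (E [⋀^Fin 2]→L[ℝ] ℝ)} {u v : P → E} {u' v' : P →L[ℝ] E} {x : P}
    (hw : HasFDerivAt w w' x) (hu : HasFDerivAt u u' x) (hv : HasFDerivAt v v' x) :
    ∃ D : P →L[ℝ] ℝ, HasFDerivAt (fun y => w y ![u y, v y]) D x ∧
      ∀ d, D d = w' d ![u x, v x] + (w x ![u' d, v x] + w x ![u x, v' d]) := by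
  have h := HasFDerivAt.continuousAlternatingMap_apply (g := ![u, v]) (g' := ![u', v']) hw
    (fun i => by fin_cases i <;> simpa)
  have e : ∀ y, (fun i => (![u, v] : Fin 2 → P → E) i y) = ![u y, v y] := fun y => by
    ext i; fin_cases i <;> rfl
  simp only [e] at h
  refine ⟨_, h, fun d => ?_⟩
  simp only [add_apply, ContinuousLinearMap.comp_apply,
    Fin.sum_univ_two]
  congr 1
  congr 1
  · change w x (Function.update ![u x, v x] 0 (u' d)) = _
    congr 1
    ext i; fin_cases i <;> simp
  · change w x (Function.update ![u x, v x] 1 (v' d)) = _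
    congr 1
    ext i; fin_cases i <;> simp

/-- If the contraction of a closed two-form with the velocity field of a family of maps, starting
at the identity, is the differential of a function, then the pullback of the form is stationary. -/
theorem hasFDerivAt_pullback_two_form [FiniteDimensional ℝ E] {Φ : P × E → E} {a₀ : P} {y₀ : E}
    (hΦ : ContDiffAt ℝ ∞ Φ (a₀, y₀)) (hid : ∀ᶠ y in 𝓝 y₀, Φ (a₀, y) = y)
    {w : E → E [⋀^Fin 2]→L[ℝ] ℝ} (hw : ContDiffAt ℝ ∞ w y₀) (hclosed : extDeriv w y₀ = 0) (ξ : P)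
    {m : E → ℝ} (hm : ∀ᶠ y in 𝓝 y₀, DifferentiableAt ℝ m y ∧
      ∀ u, fderiv ℝ m y u = - w y ![fderiv ℝ Φ (a₀, y) (ξ, 0), u]) (u v : E) :
    ∃ D : P →L[ℝ] ℝ, HasFDerivAt (fun a => w (Φ (a, y₀))
      ![fderiv ℝ Φ (a, y₀) (0, u), fderiv ℝ Φ (a, y₀) (0, v)]) D a₀ ∧ D ξ = 0 := by
  have hΦ0 : Φ (a₀, y₀) = y₀ := hid.self_of_nhds
  have hΦd := (hΦ.differentiableAt (by simp)).hasFDerivAt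
  have hΦ1 : ContDiffAt ℝ ∞ (fderiv ℝ Φ) (a₀, y₀) := hΦ.fderiv_right (by simp)
  have hΦ2 := (hΦ1.differentiableAt (by simp)).hasFDerivAt
  set L := fderiv ℝ Φ (a₀, y₀) with hL
  set Q := fderiv ℝ (fderiv ℝ Φ) (a₀, y₀) with hQ
  -- The derivative in the parameter direction `ξ` of the differential of `Φ` in `y` is the
  -- differential of the velocity field.
  have hsymm : ∀ z z', Q z z' = Q z' z := fun z z' =>
    (hΦ.isSymmSndFDerivAt (by
      rw [minSmoothness_of_isRCLikeNormedField]; exact WithTop.coe_le_coe.2 le_top)).eq z z'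
  have hinl : HasFDerivAt (fun a : P => (a, y₀)) (ContinuousLinearMap.inl ℝ P E) a₀ :=
    hasFDerivAt_prodMk_left a₀ y₀
  have hinr : HasFDerivAt (fun y : E => (a₀, y)) (ContinuousLinearMap.inr ℝ P E) y₀ :=
    hasFDerivAt_prodMk_right a₀ y₀
  have hLr : ∀ u, L (0, u) = u := by
    have h1 : HasFDerivAt (fun y => Φ (a₀, y)) (L.comp (ContinuousLinearMap.inr ℝ P E)) y₀ :=
      hΦd.comp y₀ hinr
    have h2 := h1.unique ((hasFDerivAt_id y₀).congr_of_eventuallyEq hid)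
    exact fun u => congrArg (fun D : E →L[ℝ] E => D u) h2
  have hwd := (hw.differentiableAt (by simp)).hasFDerivAt
  set W := fderiv ℝ w y₀ with hW
  have hskew : ∀ a b, w y₀ ![a, b] = - w y₀ ![b, a] := toBilin_swap (w y₀)
  -- the velocity field
  set X : E → E := fun y => fderiv ℝ Φ (a₀, y) (ξ, 0) with hX
  have hXc : ContDiffAt ℝ ∞ X y₀ := by
    have h1 : ContDiffAt ℝ ∞ (fun y => fderiv ℝ Φ (a₀, y)) y₀ :=
      hΦ1.comp y₀ (contDiffAt_const.prodMk contDiffAt_id)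
    exact h1.clm_apply contDiffAt_const
  have hXd : HasFDerivAt X ((ContinuousLinearMap.apply ℝ E ((ξ, 0) : P × E)).comp
      (Q.comp (ContinuousLinearMap.inr ℝ P E))) y₀ :=
    (ContinuousLinearMap.apply ℝ E ((ξ, 0) : P × E)).hasFDerivAt.comp y₀ (hΦ2.comp y₀ hinr)
  -- second derivatives of `m`
  have hm2 : DifferentiableAt ℝ (fderiv ℝ m) y₀ := by
    -- Only one derivative of `m` is assumed; the second one exists because `dm` is the contraction
    -- of `w` with the velocity field, up to sign.
    refine differentiableAt_clm_of_apply fun u => ?_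
    obtain ⟨D, hD, -⟩ := hasFDerivAt_two_form_apply hwd hXd (hasFDerivAt_const u y₀)
    exact (hD.neg.congr_of_eventuallyEq (hm.mono fun y hy => hy.2 u)).differentiableAt
  have hm2s := second_derivative_symmetric_of_eventually
    (hm.mono fun y hy => hy.1.hasFDerivAt) hm2.hasFDerivAt
  have hm2v : ∀ a b, fderiv ℝ (fderiv ℝ m) y₀ a b = -(W a ![X y₀, b] + w y₀ ![Q (0, a) (ξ, 0), b]) := by
    intro a b
    obtain ⟨D, hD, hDv⟩ := hasFDerivAt_two_form_apply hwd hXd (hasFDerivAt_const b y₀)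
    have h1 : HasFDerivAt (fun y => fderiv ℝ m y b)
        ((ContinuousLinearMap.apply ℝ ℝ b).comp (fderiv ℝ (fderiv ℝ m) y₀)) y₀ :=
      (ContinuousLinearMap.apply ℝ ℝ b).hasFDerivAt.comp y₀ hm2.hasFDerivAt
    have h2 : HasFDerivAt (fun y => fderiv ℝ m y b) (-D) y₀ :=
      hD.neg.congr_of_eventuallyEq (hm.mono fun y hy => hy.2 b)
    have h3 := congrArg (fun D : E →L[ℝ] ℝ => D a) (h1.unique h2)
    have h4 : w y₀ ![X y₀, 0] = 0 := (w y₀).map_coord_zero 1 rfl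
    simp only [ContinuousLinearMap.comp_apply, ContinuousLinearMap.apply_apply,
      neg_apply, hDv, zero_apply, h4, add_zero,
      ContinuousLinearMap.inr_apply] at h3
    exact h3
  -- Closedness of `w`, evaluated on `(X, u, v)`.
  have hext : W (X y₀) ![u, v] - W u ![X y₀, v] + W v ![X y₀, u] = 0 := by
    have h1 := congrArg (fun F : E [⋀^Fin 3]→L[ℝ] ℝ => F ![X y₀, u, v]) hclosed
    have h2 := extDeriv_apply (hw.differentiableAt (by simp)) ![X y₀, u, v]
    have e0 : (0 : Fin 3).removeNth ![X y₀, u, v] = ![u, v] := by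
      ext i; fin_cases i <;> rfl
    have e1 : (1 : Fin 3).removeNth ![X y₀, u, v] = ![X y₀, v] := by
      ext i; fin_cases i <;> rfl
    have e2 : (2 : Fin 3).removeNth ![X y₀, u, v] = ![X y₀, u] := by
      ext i; fin_cases i <;> rfl
    have e3 : ∀ (c : Fin 2 → E) a, fderiv ℝ (fun y => w y c) y₀ a = W a c := by
      intro c a
      have := ((ContinuousAlternatingMap.apply ℝ E ℝ c).hasFDerivAt.comp y₀ hwd).fderiv
      exact congrArg (fun D : E →L[ℝ] ℝ => D a) this
    rw [Fin.sum_univ_three, e0, e1, e2, e3, e3, e3] at h2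
    have h3 := h2.symm.trans h1
    simp at h3
    linarith
  -- the derivative of the pullback
  have hA : HasFDerivAt (fun a => w (Φ (a, y₀)))
      (W.comp (L.comp (ContinuousLinearMap.inl ℝ P E))) a₀ := by
    have h1 : HasFDerivAt w W (Φ (a₀, y₀)) := by rw [hΦ0]; exact hwd
    exact HasFDerivAt.comp (f := fun a => Φ (a, y₀)) a₀ h1 (hΦd.comp a₀ hinl)
  have hB : ∀ c : E, HasFDerivAt (fun a => fderiv ℝ Φ (a, y₀) (0, c))
      ((ContinuousLinearMap.apply ℝ E ((0, c) : P × E)).comp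
        (Q.comp (ContinuousLinearMap.inl ℝ P E))) a₀ := fun c =>
    (ContinuousLinearMap.apply ℝ E ((0, c) : P × E)).hasFDerivAt.comp a₀ (hΦ2.comp a₀ hinl)
  obtain ⟨D, hD, hDv⟩ := hasFDerivAt_two_form_apply hA (hB u) (hB v)
  refine ⟨D, hD, ?_⟩
  rw [hDv]
  simp only [ContinuousLinearMap.comp_apply, ContinuousLinearMap.apply_apply,
    ContinuousLinearMap.inl_apply, hΦ0]
  have e1 : L (ξ, 0) = X y₀ := rfl
  rw [← hL, hLr, hLr, e1, hsymm (ξ, 0) (0, u), hsymm (ξ, 0) (0, v)]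
  -- The symmetry of the second derivative of `m` says that the contraction of `w` with `X` is
  -- closed. Together with `hext` this cancels every term of the derivative of the pullback.
  have h1 := hm2s u v
  rw [hm2v, hm2v] at h1
  have h2 := hskew u (Q (0, v) (ξ, 0))
  linarith

end TwoForms

/-! ### The action near the identity, in charts. -/

section ActionChart

set_option linter.unusedSectionVars false

open Set Filter Topology

theorem mdifferentiableAt_smul_left {E : Type*} [NormedAddCommGroup E] [NormedSpace ℝ E]
    {M : Type*} [TopologicalSpace M] [ChartedSpace E M]
    (EH : Type*) [NormedAddCommGroup EH] [NormedSpace ℝ EH]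
    {H : Type*} [TopologicalSpace H] [ChartedSpace EH H] [Group H]
    [MulAction H M] [ContMDiffSMul 𝓘(ℝ, EH) 𝓘(ℝ, E) ∞ H M] (h : H) (p : M) :
    MDifferentiableAt 𝓘(ℝ, E) 𝓘(ℝ, E) (fun q : M => h • q) p :=
  ((ContMDiffSMul.contMDiff_const_smul (I := 𝓘(ℝ, EH)) (n := ∞) h) p).mdifferentiableAt (by simp)

variable {E : Type*} [NormedAddCommGroup E] [NormedSpace ℝ E]
  {M : Type*} [TopologicalSpace M] [ChartedSpace E M] [IsManifold 𝓘(ℝ, E) ∞ M]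
  {EH : Type*} [NormedAddCommGroup EH] [NormedSpace ℝ EH]
  {H : Type*} [TopologicalSpace H] [ChartedSpace EH H] [Group H]
  [LieGroup 𝓘(ℝ, EH) ∞ H] [MulAction H M] [ContMDiffSMul 𝓘(ℝ, EH) 𝓘(ℝ, E) ∞ H M]

variable (EH H) in
/-- The action near `(1, p)`, in charts. -/
def actionChart (p : M) (z : EH × E) : E :=
  extChartAt 𝓘(ℝ, E) p ((extChartAt 𝓘(ℝ, EH) (1 : H)).symm z.1 • (extChartAt 𝓘(ℝ, E) p).symm z.2)

theorem contDiffAt_actionChart (p : M) :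
    ContDiffAt ℝ ∞ (actionChart EH H p)
      (extChartAt 𝓘(ℝ, EH) (1 : H) 1, extChartAt 𝓘(ℝ, E) p p) := by
  have : IsManifold 𝓘(ℝ, EH) ∞ H := LieGroup.toContMDiffMul.toIsManifold
  rw [← contMDiffAt_iff_contDiffAt]
  have h1 : ContMDiffAt 𝓘(ℝ, EH × E) 𝓘(ℝ, EH) ∞
      (fun z : EH × E => (extChartAt 𝓘(ℝ, EH) (1 : H)).symm z.1)
      (extChartAt 𝓘(ℝ, EH) (1 : H) 1, extChartAt 𝓘(ℝ, E) p p) :=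
    ContMDiffAt.comp (g := (extChartAt 𝓘(ℝ, EH) (1 : H)).symm) (f := Prod.fst)
      (I' := 𝓘(ℝ, EH)) _
      ((contMDiffOn_extChartAt_symm (1 : H)).contMDiffAt (show _ ∈ 𝓝 (extChartAt 𝓘(ℝ, EH) (1 : H) 1) from extChartAt_target_mem_nhds (1 : H)))
      contDiffAt_fst.contMDiffAt
  have h2 : ContMDiffAt 𝓘(ℝ, EH × E) 𝓘(ℝ, E) ∞
      (fun z : EH × E => (extChartAt 𝓘(ℝ, E) p).symm z.2)
      (extChartAt 𝓘(ℝ, EH) (1 : H) 1, extChartAt 𝓘(ℝ, E) p p) :=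
    ContMDiffAt.comp (g := (extChartAt 𝓘(ℝ, E) p).symm) (f := Prod.snd)
      (I' := 𝓘(ℝ, E)) _
      ((contMDiffOn_extChartAt_symm p).contMDiffAt (show _ ∈ 𝓝 (extChartAt 𝓘(ℝ, E) p p) from extChartAt_target_mem_nhds p))
      contDiffAt_snd.contMDiffAt
  have h3 := h1.smul h2
  have h4 : ContMDiffAt 𝓘(ℝ, E) 𝓘(ℝ, E) ∞ (extChartAt 𝓘(ℝ, E) p)
      ((extChartAt 𝓘(ℝ, EH) (1 : H)).symm (extChartAt 𝓘(ℝ, EH) (1 : H) 1) •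
        (extChartAt 𝓘(ℝ, E) p).symm (extChartAt 𝓘(ℝ, E) p p)) := by
    rw [extChartAt_to_inv, extChartAt_to_inv, one_smul]
    exact contMDiffAt_extChartAt
  exact ContMDiffAt.comp (g := extChartAt 𝓘(ℝ, E) p) (f := fun z : EH × E =>
    (extChartAt 𝓘(ℝ, EH) (1 : H)).symm z.1 • (extChartAt 𝓘(ℝ, E) p).symm z.2) _ h4 h3

theorem actionChart_one (p : M) {y : E} (hy : y ∈ (extChartAt 𝓘(ℝ, E) p).target) :
    actionChart EH H p (extChartAt 𝓘(ℝ, EH) (1 : H) 1, y) = y := by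
  rw [actionChart, extChartAt_to_inv, one_smul, (extChartAt 𝓘(ℝ, E) p).right_inv hy]

theorem mdifferentiableAt_smul_right (h : H) (p : M) :
    MDifferentiableAt 𝓘(ℝ, EH) 𝓘(ℝ, E) (fun k : H => k • p) h :=
  ContMDiffAt.mdifferentiableAt (n := ∞)
    ((contMDiff_id (I := 𝓘(ℝ, EH)) (n := ∞)).smul contMDiff_const h) (by simp)

variable {G : Type*} [NormedAddCommGroup G] [NormedSpace ℝ G] {k : ℕ}

/-- Pullback of a form by group elements near `1`, in charts. -/
theorem eventually_pullback_eq (α : ∀ x : M, TangentSpace 𝓘(ℝ, E) x [⋀^Fin k]→L[ℝ] G) (p : M) :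
    ∀ᶠ h in 𝓝 (1 : H), ∀ v : Fin k → E,
      α (h • p) (fun i => mfderiv 𝓘(ℝ, E) 𝓘(ℝ, E) (fun q : M => h • q) p (v i)) =
        chartForm 𝓘(ℝ, E) α p (actionChart EH H p
            (extChartAt 𝓘(ℝ, EH) (1 : H) h, extChartAt 𝓘(ℝ, E) p p))
          (fun i => fderiv ℝ (actionChart EH H p)
            (extChartAt 𝓘(ℝ, EH) (1 : H) h, extChartAt 𝓘(ℝ, E) p p) (0, v i)) := by
  have : IsManifold 𝓘(ℝ, EH) ∞ H := LieGroup.toContMDiffMul.toIsManifold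
  have : IsManifold 𝓘(ℝ, E) 1 M := IsManifold.of_le (n := ∞) (by simp)
  have h1 : ∀ᶠ h in 𝓝 (1 : H), h ∈ (extChartAt 𝓘(ℝ, EH) (1 : H)).source :=
    extChartAt_source_mem_nhds _
  have h2 : ∀ᶠ h in 𝓝 (1 : H), h • p ∈ (extChartAt 𝓘(ℝ, E) p).source := by
    have : ContinuousAt (fun h : H => h • p) 1 := (mdifferentiableAt_smul_right (EH := EH) (E := E) 1 p).continuousAt
    refine this.eventually_mem ?_
    rw [one_smul]; exact extChartAt_source_mem_nhds _
  have h3 : ∀ᶠ h in 𝓝 (1 : H), ContDiffAt ℝ 1 (actionChart EH H p)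
      (extChartAt 𝓘(ℝ, EH) (1 : H) h, extChartAt 𝓘(ℝ, E) p p) := by
    have hc : Tendsto (fun h : H => (extChartAt 𝓘(ℝ, EH) (1 : H) h, extChartAt 𝓘(ℝ, E) p p))
        (𝓝 1) (𝓝 (extChartAt 𝓘(ℝ, EH) (1 : H) 1, extChartAt 𝓘(ℝ, E) p p)) :=
      (continuousAt_extChartAt (1 : H)).prodMk continuousAt_const
    exact hc.eventually (((contDiffAt_actionChart p).of_le (by simp)).eventually (by simp))
  filter_upwards [h1, h2, h3] with h hh1 hh2 hh3 v
  have hm : MDifferentiableAt 𝓘(ℝ, E) 𝓘(ℝ, E) (fun q : M => h • q) p :=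
    mdifferentiableAt_smul_left EH h p
  refine (chartForm_mfderiv α p hm hh2 v).symm.trans ?_
  have e1 : actionChart EH H p (extChartAt 𝓘(ℝ, EH) (1 : H) h, extChartAt 𝓘(ℝ, E) p p) =
      extChartAt 𝓘(ℝ, E) p (h • p) := by
    rw [actionChart, PartialEquiv.left_inv _ hh1, extChartAt_to_inv]
  have hm' : MDifferentiableAt 𝓘(ℝ, E) 𝓘(ℝ, E) (extChartAt 𝓘(ℝ, E) p ∘ fun q : M => h • q) p :=
    MDifferentiableAt.comp p (mdifferentiableAt_extChartAt (by rwa [← extChartAt_source 𝓘(ℝ, E)])) hm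
  obtain ⟨D, hD, hD'⟩ := hasFDerivAt_of_mdifferentiableAt hm'
  have e2 : writtenInExtChartAt 𝓘(ℝ, E) 𝓘(ℝ, E) p (extChartAt 𝓘(ℝ, E) p ∘ fun q : M => h • q) =
      fun y => actionChart EH H p (extChartAt 𝓘(ℝ, EH) (1 : H) h, y) := by
    funext y
    simp only [actionChart, PartialEquiv.left_inv _ hh1]
    rfl
  rw [e2] at hD'
  have e3 := hD'.unique (HasFDerivAt.comp (g := actionChart EH H p)
    (f := fun y : E => (extChartAt 𝓘(ℝ, EH) (1 : H) h, y)) _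
    ((hh3.differentiableAt (by simp)).hasFDerivAt) (hasFDerivAt_prodMk_right _ _))
  rw [e1]
  have e4 : ∀ v : E, (fderiv ℝ (actionChart EH H p)
      (extChartAt 𝓘(ℝ, EH) (1 : H) h, extChartAt 𝓘(ℝ, E) p p)) (0, v) =
      mfderiv 𝓘(ℝ, E) 𝓘(ℝ, E) (extChartAt 𝓘(ℝ, E) p ∘ fun q : M => h • q) p v := fun v => by
    rw [← hD, e3]; rfl
  simp only [e4]

/-- The fundamental vector fields in charts. -/
theorem eventually_fund_eq (p : M) :
    ∀ᶠ y in 𝓝 (extChartAt 𝓘(ℝ, E) p p), ∀ ξ : EH,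
      (mfderiv 𝓘(ℝ, E) 𝓘(ℝ, E) (extChartAt 𝓘(ℝ, E) p).symm y : E →L[ℝ] E)
        (fderiv ℝ (actionChart EH H p) (extChartAt 𝓘(ℝ, EH) (1 : H) 1, y) (ξ, 0)) =
      fund (H := H) (ξ : GroupLieAlgebra 𝓘(ℝ, EH) H) ((extChartAt 𝓘(ℝ, E) p).symm y) := by
  have : IsManifold 𝓘(ℝ, EH) ∞ H := LieGroup.toContMDiffMul.toIsManifold
  have : IsManifold 𝓘(ℝ, E) 1 M := IsManifold.of_le (n := ∞) (by simp)
  have h1 : ∀ᶠ y in 𝓝 (extChartAt 𝓘(ℝ, E) p p), y ∈ (extChartAt 𝓘(ℝ, E) p).target :=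
    extChartAt_target_mem_nhds _
  have h3 : ∀ᶠ y in 𝓝 (extChartAt 𝓘(ℝ, E) p p), ContDiffAt ℝ 1 (actionChart EH H p)
      (extChartAt 𝓘(ℝ, EH) (1 : H) 1, y) := by
    have hc : Tendsto (fun y : E => (extChartAt 𝓘(ℝ, EH) (1 : H) 1, y))
        (𝓝 (extChartAt 𝓘(ℝ, E) p p))
        (𝓝 (extChartAt 𝓘(ℝ, EH) (1 : H) 1, extChartAt 𝓘(ℝ, E) p p)) :=
      (continuous_const.prodMk continuous_id).continuousAt
    exact hc.eventually (((contDiffAt_actionChart p).of_le (by simp)).eventually (by simp))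
  filter_upwards [h1, h3] with y hy1 hy3 ξ
  set q := (extChartAt 𝓘(ℝ, E) p).symm y with hq
  have hqs : (1 : H) • q ∈ (extChartAt 𝓘(ℝ, E) p).source := by
    rw [one_smul]; exact PartialEquiv.map_target _ hy1
  have hqy : extChartAt 𝓘(ℝ, E) p ((1 : H) • q) = y := by
    rw [one_smul]; exact PartialEquiv.right_inv _ hy1
  have hm : MDifferentiableAt 𝓘(ℝ, EH) 𝓘(ℝ, E) (fun h : H => h • q) 1 :=
    mdifferentiableAt_smul_right 1 q
  have e0 := mfderiv_extChartAt_symm_comp p hm hqs hqy ξ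
  have hm' : MDifferentiableAt 𝓘(ℝ, EH) 𝓘(ℝ, E) (extChartAt 𝓘(ℝ, E) p ∘ fun h : H => h • q) 1 :=
    MDifferentiableAt.comp (1 : H)
      (mdifferentiableAt_extChartAt (by rwa [← extChartAt_source 𝓘(ℝ, E)])) hm
  obtain ⟨D, hD, hD'⟩ := hasFDerivAt_of_mdifferentiableAt hm'
  have e2 : writtenInExtChartAt 𝓘(ℝ, EH) 𝓘(ℝ, E) 1 (extChartAt 𝓘(ℝ, E) p ∘ fun h : H => h • q) =
      fun a => actionChart EH H p (a, y) := rfl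
  rw [e2] at hD'
  have e3 := hD'.unique (HasFDerivAt.comp (f := fun a : EH => (a, y)) _
    ((hy3.differentiableAt (by simp)).hasFDerivAt) (hasFDerivAt_prodMk_left _ _))
  have e4 : (fderiv ℝ (actionChart EH H p) (extChartAt 𝓘(ℝ, EH) (1 : H) 1, y)) (ξ, 0) =
      mfderiv 𝓘(ℝ, EH) 𝓘(ℝ, E) (extChartAt 𝓘(ℝ, E) p ∘ fun h : H => h • q) 1 ξ := by
    rw [← hD, e3]; rfl
  rw [e4]
  exact e0

end ActionChart

/-! ### Invariance of the Kähler form under the group. -/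

section Invariance

open Set Filter Topology

theorem hasMFDerivAt_zero_comp {𝕜 : Type*} [NontriviallyNormedField 𝕜]
    {E : Type*} [NormedAddCommGroup E] [NormedSpace 𝕜 E]
    {H : Type*} [TopologicalSpace H] {I : ModelWithCorners 𝕜 E H}
    {M : Type*} [TopologicalSpace M] [ChartedSpace H M]
    {E' : Type*} [NormedAddCommGroup E'] [NormedSpace 𝕜 E']
    {H' : Type*} [TopologicalSpace H'] {I' : ModelWithCorners 𝕜 E' H'}
    {M' : Type*} [TopologicalSpace M'] [ChartedSpace H' M']
    {E'' : Type*} [NormedAddCommGroup E''] [NormedSpace 𝕜 E'']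
    {H'' : Type*} [TopologicalSpace H''] {I'' : ModelWithCorners 𝕜 E'' H''}
    {M'' : Type*} [TopologicalSpace M''] [ChartedSpace H'' M'']
    {g : M' → M''} {f : M → M'} {x : M} (hg : HasMFDerivAt I' I'' g (f x) 0)
    (hf : MDifferentiableAt I I' f x) : HasMFDerivAt I I'' (g ∘ f) x 0 := by
  have h := hg.comp x hf.hasMFDerivAt
  rwa [ContinuousLinearMap.zero_comp] at h

section

variable {E : Type*} [NormedAddCommGroup E] [NormedSpace ℝ E]
  {M : Type*} [TopologicalSpace M] [ChartedSpace E M]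
  {H : Type*} [Group H] [MulAction H M]

theorem mfderiv_mul_smul (EH : Type*) [NormedAddCommGroup EH] [NormedSpace ℝ EH]
    [TopologicalSpace H] [ChartedSpace EH H] [ContMDiffSMul 𝓘(ℝ, EH) 𝓘(ℝ, E) ∞ H M] (h k : H) (p : M) (v : E) :
    (mfderiv 𝓘(ℝ, E) 𝓘(ℝ, E) (fun q : M => (h * k) • q) p : E →L[ℝ] E) v =
      (mfderiv 𝓘(ℝ, E) 𝓘(ℝ, E) (fun q : M => h • q) (k • p) : E →L[ℝ] E)
        ((mfderiv 𝓘(ℝ, E) 𝓘(ℝ, E) (fun q : M => k • q) p : E →L[ℝ] E) v) := by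
  have h1 := (mdifferentiableAt_smul_left (E := E) EH h (k • p)).hasMFDerivAt.comp p
    (mdifferentiableAt_smul_left EH k p).hasMFDerivAt
  have e : ((fun q : M => h • q) ∘ fun q : M => k • q) = fun q : M => (h * k) • q := by
    funext q; simp [mul_smul]
  rw [e] at h1
  exact congrArg (fun D : E →L[ℝ] E => D v) h1.mfderiv

theorem mfderiv_one_smul (p : M) (v : E) :
    (mfderiv 𝓘(ℝ, E) 𝓘(ℝ, E) (fun q : M => (1 : H) • q) p : E →L[ℝ] E) v = v := by
  have e : (fun q : M => (1 : H) • q) = id := by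
    funext q; simp
  rw [e]
  exact congrArg (fun D : E →L[ℝ] E => D v) mfderiv_id

end

variable {n : ℕ} {E : Type*} [NormedAddCommGroup E] [NormedSpace ℂ E] [FiniteDimensional ℝ E]
  {M : Type*} [TopologicalSpace M] [ChartedSpace E M] [IsManifold 𝓘(ℝ, E) ∞ M]
  {EH : Type*} [NormedAddCommGroup EH] [NormedSpace ℝ EH]
  {H : Type*} [TopologicalSpace H] [ChartedSpace EH H] [Group H]
  [LieGroup 𝓘(ℝ, EH) ∞ H] [MulAction H M] [ContMDiffSMul 𝓘(ℝ, EH) 𝓘(ℝ, E) ∞ H M]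

theorem comp_cons_two {α β : Type*} (f : α → β) (u v : α) :
    (fun i => f (![u, v] i)) = ![f u, f v] := by
  ext i; fin_cases i <;> rfl

/-- Infinitesimal invariance. In charts the velocity field of the action is the fundamental field,
by `eventually_fund_eq`, and the component of `μ` along `ξ` serves as the function `m` of
`hasFDerivAt_pullback_two_form`. -/
theorem CalabiYau.hasMFDerivAt_pullback_kform (C : CalabiYau n E M)
    {μ : M → (GroupLieAlgebra 𝓘(ℝ, EH) H →L[ℝ] ℝ)} (hμ : C.IsMomentMap μ) (p : M) (v : Fin 2 → E) :
    HasMFDerivAt 𝓘(ℝ, EH) 𝓘(ℝ, ℝ) (fun h : H => C.kform (h • p)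
      (fun i => mfderiv 𝓘(ℝ, E) 𝓘(ℝ, E) (fun q : M => h • q) p (v i))) 1 0 := by
  have : IsManifold 𝓘(ℝ, EH) ∞ H := LieGroup.toContMDiffMul.toIsManifold
  have : IsManifold 𝓘(ℝ, E) 1 M := IsManifold.of_le (n := ∞) (by simp)
  have htgt : ∀ᶠ y in 𝓝 (extChartAt 𝓘(ℝ, E) p p), y ∈ (extChartAt 𝓘(ℝ, E) p).target :=
    extChartAt_target_mem_nhds _
  have hw : ContDiffAt ℝ ∞ (chartForm 𝓘(ℝ, E) C.kform p) (extChartAt 𝓘(ℝ, E) p p) :=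
    (C.kform_smooth p).contDiffAt (extChartAt_target_mem_nhds _)
  have key : ∀ ξ : EH, ∃ D : EH →L[ℝ] ℝ, HasFDerivAt (fun a =>
      chartForm 𝓘(ℝ, E) C.kform p (actionChart EH H p (a, extChartAt 𝓘(ℝ, E) p p))
        ![fderiv ℝ (actionChart EH H p) (a, extChartAt 𝓘(ℝ, E) p p) (0, v 0),
          fderiv ℝ (actionChart EH H p) (a, extChartAt 𝓘(ℝ, E) p p) (0, v 1)]) D
      (extChartAt 𝓘(ℝ, EH) (1 : H) 1) ∧ D ξ = 0 := by
    intro ξ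
    refine hasFDerivAt_pullback_two_form (contDiffAt_actionChart p)
      (htgt.mono fun y hy => actionChart_one p hy) hw
      (C.kform_closed p _ (mem_extChartAt_target p)) ξ
      (m := fun y => μ ((extChartAt 𝓘(ℝ, E) p).symm y) (ξ : GroupLieAlgebra 𝓘(ℝ, EH) H)) ?_ _ _
    filter_upwards [htgt, eventually_fund_eq (EH := EH) (H := H) p] with y hy hyf
    have h1 : MDifferentiableAt 𝓘(ℝ, E) 𝓘(ℝ, E) (extChartAt 𝓘(ℝ, E) p).symm y :=
      mdifferentiableAt_extChartAt_symm hy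
    have h2 := ((hμ.2 (ξ : GroupLieAlgebra 𝓘(ℝ, EH) H)).1
      ((extChartAt 𝓘(ℝ, E) p).symm y)).hasMFDerivAt.comp y h1.hasMFDerivAt
    have h3 : HasFDerivAt (E := E) (F := ℝ)
        (fun y => μ ((extChartAt 𝓘(ℝ, E) p).symm y) (ξ : GroupLieAlgebra 𝓘(ℝ, EH) H))
        ((mfderiv 𝓘(ℝ, E) 𝓘(ℝ, ℝ) (fun q => μ q (ξ : GroupLieAlgebra 𝓘(ℝ, EH) H))
          ((extChartAt 𝓘(ℝ, E) p).symm y) : E →L[ℝ] ℝ).comp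
          (mfderiv 𝓘(ℝ, E) 𝓘(ℝ, E) (extChartAt 𝓘(ℝ, E) p).symm y : E →L[ℝ] E)) y := h2.hasFDerivAt
    refine ⟨h3.differentiableAt, fun u => ?_⟩
    have h4 := (hμ.2 (ξ : GroupLieAlgebra 𝓘(ℝ, EH) H)).2 ((extChartAt 𝓘(ℝ, E) p).symm y)
      ((mfderiv 𝓘(ℝ, E) 𝓘(ℝ, E) (extChartAt 𝓘(ℝ, E) p).symm y : E →L[ℝ] E) u)
    have h5 : ∀ {f : E → ℝ} {D : E →L[ℝ] ℝ}, HasFDerivAt f D y → fderiv ℝ f y u = D u :=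
      fun h => by rw [h.fderiv]
    refine (h5 h3).trans (h4.trans ?_)
    refine congrArg Neg.neg (form_congr C.kform rfl ?_)
    rw [← hyf]
    ext i; fin_cases i <;> rfl
  -- For each `ξ` a derivative is found that kills this `ξ`; by uniqueness all these derivatives
  -- agree, so the common one is zero.
  obtain ⟨D, hD, -⟩ := key 0
  have hD0 : D = 0 := by
    ext ξ
    obtain ⟨D', hD', h0⟩ := key ξ
    rw [hD.unique hD', h0, zero_apply]
  rw [hD0] at hD
  have h5 : MDifferentiableAt 𝓘(ℝ, EH) 𝓘(ℝ, EH) (extChartAt 𝓘(ℝ, EH) (1 : H)) 1 :=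
    mdifferentiableAt_extChartAt (mem_chart_source _ _)
  have h7 := hasMFDerivAt_zero_comp hD.hasMFDerivAt h5
  refine h7.congr_of_eventuallyEq ?_
  filter_upwards [eventually_pullback_eq (EH := EH) (H := H) C.kform p] with h hh
  rw [hh]
  refine congrArg _ ?_
  ext i; fin_cases i <;> rfl

/-- A connected group acting with a moment map preserves the symplectic form. -/
theorem CalabiYau.kform_smul [ConnectedSpace H] (C : CalabiYau n E M)
    {μ : M → (GroupLieAlgebra 𝓘(ℝ, EH) H →L[ℝ] ℝ)} (hμ : C.IsMomentMap μ) (h : H) (p : M)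
    (v : Fin 2 → E) :
    C.kform (h • p) (fun i => mfderiv 𝓘(ℝ, E) 𝓘(ℝ, E) (fun q : M => h • q) p (v i)) =
      C.kform p v := by
  have : IsManifold 𝓘(ℝ, EH) ∞ H := LieGroup.toContMDiffMul.toIsManifold
  have : IsManifold 𝓘(ℝ, EH) 1 H := IsManifold.of_le (n := ∞) (by simp)
  -- The derivative at `k` is the one at `1` for the point `k • p`, after writing `x = (x * k⁻¹) *
  -- k`.
  have key : ∀ k : H, HasMFDerivAt 𝓘(ℝ, EH) 𝓘(ℝ, ℝ) (fun h : H => C.kform (h • p)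
      (fun i => mfderiv 𝓘(ℝ, E) 𝓘(ℝ, E) (fun q : M => h • q) p (v i))) k 0 := by
    intro k
    have h1 := C.hasMFDerivAt_pullback_kform hμ (k • p)
      (fun i => (mfderiv 𝓘(ℝ, E) 𝓘(ℝ, E) (fun q : M => k • q) p : E →L[ℝ] E) (v i))
    have h2 : MDifferentiableAt 𝓘(ℝ, EH) 𝓘(ℝ, EH) (fun x : H => x * k⁻¹) k :=
      ((contMDiff_mul_right (I := 𝓘(ℝ, EH)) (n := ∞)) k).mdifferentiableAt (by simp)
    rw [← mul_inv_cancel k] at h1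
    have h4 := hasMFDerivAt_zero_comp (f := fun x : H => x * k⁻¹) h1 h2
    refine h4.congr_of_eventuallyEq (Eventually.of_forall fun x => ?_)
    have e : x * k⁻¹ * k = x := by group
    refine form_congr C.kform (by rw [smul_smul, e]) ?_
    funext i
    refine Eq.trans ?_ (mfderiv_mul_smul EH (x * k⁻¹) k p (v i))
    rw [e]
  have h0 := eq_of_hasMFDerivAt_zero key h 1
  refine h0.trans (form_congr C.kform (one_smul _ _) ?_)
  funext i
  exact mfderiv_one_smul p (v i)

end Invariance

/-! ### Complex forms of top degree, and wedge products under linear changes. -/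

section TopForms

theorem top_form_basis_ne_zero {n : ℕ} {E : Type*} [NormedAddCommGroup E] [NormedSpace ℂ E]
    (b : Module.Basis (Fin n) ℂ E) {Ω : E [⋀^Fin n]→L[ℂ] ℂ} (hΩ : Ω ≠ 0) : Ω b ≠ 0 := by
  intro h
  refine hΩ (ContinuousAlternatingMap.toAlternatingMap_injective ?_)
  rw [AlternatingMap.eq_smul_basis_det b Ω.toAlternatingMap]
  have h' : Ω.toAlternatingMap b = 0 := h
  rw [h', zero_smul]
  rfl

/-- Forms of top degree make up a complex line. -/
theorem top_form_eq_mul {n : ℕ} {E : Type*} [NormedAddCommGroup E] [NormedSpace ℂ E]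
    (b : Module.Basis (Fin n) ℂ E) {Ω : E [⋀^Fin n]→L[ℂ] ℂ} (hΩ : Ω ≠ 0)
    (Ω' : E [⋀^Fin n]→L[ℂ] ℂ) (v : Fin n → E) : Ω' v = Ω' b / Ω b * Ω v := by
  have h1 : Ω' v = Ω' b * b.det v :=
    congrArg (fun F : E [⋀^Fin n]→ₗ[ℂ] ℂ => F v) (AlternatingMap.eq_smul_basis_det b Ω'.toAlternatingMap)
  have h2 : Ω v = Ω b * b.det v :=
    congrArg (fun F : E [⋀^Fin n]→ₗ[ℂ] ℂ => F v) (AlternatingMap.eq_smul_basis_det b Ω.toAlternatingMap)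
  have := top_form_basis_ne_zero b hΩ
  rw [h1, h2]
  field_simp

theorem wedge_comp {T R : Type*} [Field R] {k l : ℕ} (α : (Fin k → T) → R) (β : (Fin l → T) → R)
    (f : T → T) (v : Fin (k + l) → T) :
    wedge α β (fun i => f (v i)) =
      wedge (fun w => α (fun i => f (w i))) (fun w => β (fun i => f (w i))) v := rfl

theorem wedgePow_comp {T R : Type*} [Field R] (α : (Fin 2 → T) → R) (f : T → T) (j : ℕ) :
    ∀ v : Fin (2 * j) → T, wedgePow α j (fun i => f (v i)) =
      wedgePow (fun w => α (fun i => f (w i))) j v := by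
  induction j with
  | zero => intro v; rfl
  | succ j ih =>
    intro v
    change wedge (wedgePow α j) α (fun i => f (v i)) =
      wedge (wedgePow (fun w => α (fun i => f (w i))) j) (fun w => α (fun i => f (w i))) v
    rw [wedge_comp]
    congr 1
    funext w
    exact ih w

theorem wedge_smul {T : Type*} {k : ℕ} (c : ℂ) (α : (Fin k → T) → ℂ) (v : Fin (k + k) → T) :
    wedge (fun w => c * α w) (fun w => conj (c * α w)) v =
      c * conj c * wedge α (fun w => conj (α w)) v := by
  simp only [wedge, Finset.mul_sum, map_mul]
  refine Finset.sum_congr rfl fun σ _ => ?_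
  ring

end TopForms

/-! ### Cauchy–Riemann equations. -/

section ComplexDifferentiability

open Set Filter Topology

variable {E : Type*} [NormedAddCommGroup E] [NormedSpace ℂ E]
  {F : Type*} [NormedAddCommGroup F] [NormedSpace ℂ F]

/-- A real linear map that commutes with multiplication by `√-1` is complex linear. -/
def complexLinear (D : E →L[ℝ] F) (hD : ∀ u, D (Complex.I • u) = Complex.I • D u) : E →L[ℂ] F :=
  { toFun := D
    map_add' := D.map_add
    map_smul' := fun c u => by
      have e : c • u = c.re • u + c.im • (Complex.I • u) := by
        conv_lhs => rw [← Complex.re_add_im c]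
        rw [add_smul, mul_smul]; rfl
      have e' : c • D u = c.re • D u + c.im • (Complex.I • D u) := by
        conv_lhs => rw [← Complex.re_add_im c]
        rw [add_smul, mul_smul]; rfl
      simp only [RingHom.id_apply]
      rw [e, e', map_add, map_smul, map_smul, hD]
    cont := D.continuous }

theorem differentiableAt_complex_of_real {f : E → F} {D : E →L[ℝ] F} {x : E}
    (h : HasFDerivAt f D x) (hD : ∀ u, D (Complex.I • u) = Complex.I • D u) :
    DifferentiableAt ℂ f x := by
  exact (hasFDerivAt_of_restrictScalars ℝ (f' := complexLinear D hD) h rfl).differentiableAt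

/-- Differentiating the Cauchy–Riemann equations and using the symmetry of the second derivative
shows that the directional derivatives of a holomorphic map are holomorphic. They occur as
coefficients in the pullback of `Ω`. -/
theorem differentiableAt_complex_fderiv {f : E → F} {x : E} (hf : ContDiffAt ℝ ∞ f x)
    (hI : ∀ᶠ y in 𝓝 x, ∀ u, fderiv ℝ f y (Complex.I • u) = Complex.I • fderiv ℝ f y u) :
    DifferentiableAt ℂ f x ∧ ∀ u, DifferentiableAt ℂ (fun y => fderiv ℝ f y u) x := by
  refine ⟨differentiableAt_complex_of_real (hf.differentiableAt (by simp)).hasFDerivAt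
    hI.self_of_nhds, fun u => ?_⟩
  have h1 : ContDiffAt ℝ ∞ (fderiv ℝ f) x := hf.fderiv_right (by simp)
  have h2 := (h1.differentiableAt (by simp)).hasFDerivAt
  set Q := fderiv ℝ (fderiv ℝ f) x with hQ
  have hsymm : ∀ z z', Q z z' = Q z' z := fun z z' =>
    (hf.isSymmSndFDerivAt (by
      rw [minSmoothness_of_isRCLikeNormedField]; exact WithTop.coe_le_coe.2 le_top)).eq z z'
  have h3 : ∀ u, HasFDerivAt (fun y => fderiv ℝ f y u)
      ((ContinuousLinearMap.apply ℝ F u).comp Q) x := fun u =>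
    (ContinuousLinearMap.apply ℝ F u).hasFDerivAt.comp x h2
  refine differentiableAt_complex_of_real (h3 u) fun z => ?_
  simp only [ContinuousLinearMap.comp_apply, ContinuousLinearMap.apply_apply]
  rw [hsymm, hsymm z]
  have h4 : HasFDerivAt (fun y => fderiv ℝ f y (Complex.I • z))
      (Complex.I • (ContinuousLinearMap.apply ℝ F z).comp Q) x :=
    ((h3 z).const_smul Complex.I).congr_of_eventuallyEq (hI.mono fun y hy => hy z)
  exact congrArg (fun D : E →L[ℝ] F => D u) ((h3 (Complex.I • z)).unique h4)

end ComplexDifferentiability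

/-! ### The factor by which a translation multiplies the volume form. -/

section Factor

open Set Filter Topology

variable {n : ℕ} {E : Type*} [NormedAddCommGroup E] [NormedSpace ℂ E] [FiniteDimensional ℂ E]
  {M : Type*} [TopologicalSpace M] [ChartedSpace E M] 
  {H : Type*} [Group H] [MulAction H M]

/-- A complex basis of the tangent spaces. -/
def CalabiYau.basis (C : CalabiYau n E M) : Module.Basis (Fin n) ℂ E :=
  Module.finBasisOfFinrankEq ℂ E C.finrank_eq

/-- The function `f` with `L_h^* Ω = f Ω`. -/
def CalabiYau.factor (C : CalabiYau n E M) (h : H) (p : M) : ℂ :=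
  C.vform (h • p) (fun i => mfderiv 𝓘(ℝ, E) 𝓘(ℝ, E) (fun q : M => h • q) p (C.basis i)) /
    C.vform p C.basis

/-- The group acts by holomorphic transformations. -/
def ActsHolomorphically (H M : Type*) [Group H] {E : Type*} [NormedAddCommGroup E]
    [NormedSpace ℂ E] [TopologicalSpace M] [ChartedSpace E M] [MulAction H M] : Prop :=
  ∀ (h : H) (p : M) (v : TangentSpace 𝓘(ℝ, E) p),
      mfderiv 𝓘(ℝ, E) 𝓘(ℝ, E) (fun q : M => h • q) p (cplx p v) =
        cplx (h • p) (mfderiv 𝓘(ℝ, E) 𝓘(ℝ, E) (fun q : M => h • q) p v)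

variable (C : CalabiYau n E M)

/-- The differential of a translation is complex linear, so the pullback of `Ω` is again a complex
form of top degree. -/
theorem CalabiYau.vform_smul (hI : ActsHolomorphically H M (E := E)) (h : H) (p : M)
    (v : Fin n → E) :
    C.vform (h • p) (fun i => mfderiv 𝓘(ℝ, E) 𝓘(ℝ, E) (fun q : M => h • q) p (v i)) =
      C.factor h p * C.vform p v := by
  let D : E →L[ℝ] E := mfderiv 𝓘(ℝ, E) 𝓘(ℝ, E) (fun q : M => h • q) p
  have hD : ∀ u, D (Complex.I • u) = Complex.I • D u := fun u => hI h p u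
  exact top_form_eq_mul C.basis (C.vform_ne_zero p)
    ((C.vform (h • p) : E [⋀^Fin n]→L[ℂ] ℂ).compContinuousLinearMap
      (complexLinear (E := E) (F := E) D hD)) v

/-- In the pulled back normalization the power of `ω` is unchanged, while the product of `Ω` with
its conjugate is multiplied by the squared modulus of the factor and does not vanish. -/
theorem CalabiYau.norm_factor (hI : ActsHolomorphically H M (E := E)) (h : H) (p : M)
    (hω : ∀ v : Fin 2 → E, C.kform (h • p)
      (fun i => mfderiv 𝓘(ℝ, E) 𝓘(ℝ, E) (fun q : M => h • q) p (v i)) = C.kform p v) :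
    ‖C.factor h p‖ = 1 := by
  let D : E → E := (mfderiv 𝓘(ℝ, E) 𝓘(ℝ, E) (fun q : M => h • q) p : E →L[ℝ] E)
  obtain ⟨v, hv⟩ := exists_wedge_conj_ne_zero (E := E) (C.vform p : E [⋀^Fin n]→L[ℂ] ℂ) (C.vform_ne_zero p)
  let v' : Fin (2 * n) → E := fun i => v (Fin.cast (two_mul n) i)
  have hvv : (fun i => v' (Fin.cast (two_mul n).symm i)) = v := rfl
  have h1 := C.normalization p v'
  have h2 := C.normalization (h • p) (fun i => D (v' i))
  have h2' := (congrArg (· / (n.factorial : ℂ)) (wedgePow_comp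
    (fun w : Fin 2 → E => ((C.kform (h • p) w : ℝ) : ℂ)) D n v').symm).trans h2
  have h3 : (fun w : Fin 2 → E => ((C.kform (h • p) (fun i => D (w i)) : ℝ) : ℂ)) =
      fun w => (C.kform p w : ℂ) := by
    funext w
    exact congrArg _ (hω w)
  rw [h3] at h2'
  replace h2' := h1.symm.trans h2'
  have h4 : ((-1 : ℂ) ^ (n * (n - 1) / 2) * (Complex.I / 2) ^ n) ≠ 0 := by simp
  have h5 := mul_left_cancel₀ h4 h2'
  rw [hvv] at h5
  have h6 : (fun w : Fin n → E => C.vform (h • p) (fun i => D (w i))) =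
      fun w => C.factor h p * C.vform p w := by
    funext w
    exact C.vform_smul hI h p w
  have h7 : wedge (fun w : Fin n → E => C.vform (h • p) w)
      (fun w : Fin n → E => conj (C.vform (h • p) w)) (fun i => D (v i)) =
      C.factor h p * conj (C.factor h p) *
        wedge (fun w : Fin n → E => C.vform p w) (fun w : Fin n → E => conj (C.vform p w)) v := by
    rw [← wedge_smul, wedge_comp]
    simp only [← C.vform_smul hI h p]
    rfl
  have h8 := h5.trans h7
  have h9 : C.factor h p * conj (C.factor h p) = 1 := by
    have := mul_right_cancel₀ hv ((one_mul _).trans h8)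
    exact this.symm
  rw [Complex.mul_conj, Complex.normSq_eq_norm_sq] at h9
  have h10 : ‖C.factor h p‖ ^ 2 = 1 := by exact_mod_cast h9
  exact (pow_eq_one_iff_of_nonneg (norm_nonneg _) two_ne_zero).1 h10

end Factor

/-! ### Holomorphy of the factor on the manifold. -/

section Holomorphic

set_option linter.unusedSectionVars false

open Set Filter Topology

variable {n : ℕ} {E : Type*} [NormedAddCommGroup E] [NormedSpace ℂ E] [FiniteDimensional ℂ E]
  {M : Type*} [TopologicalSpace M] [ChartedSpace E M] [IsManifold 𝓘(ℂ, E) ω M]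
  {H : Type*} [Group H] [MulAction H M] (C : CalabiYau n E M)

/-- Charts are holomorphic, so the complex structure of the model space is the same in all of them.
-/
theorem mfderiv_extChartAt_symm_I_smul (p : M) {y : E} (hy : y ∈ (extChartAt 𝓘(ℝ, E) p).target)
    (u : E) :
    let D : E →L[ℝ] E := mfderiv 𝓘(ℝ, E) 𝓘(ℝ, E) (extChartAt 𝓘(ℝ, E) p).symm y
    D (Complex.I • u) = Complex.I • D u := by
  intro D
  have : IsManifold 𝓘(ℂ, E) 1 M := IsManifold.of_le (n := ω) le_top
  have h1 : MDifferentiableAt 𝓘(ℂ, E) 𝓘(ℂ, E) (extChartAt 𝓘(ℂ, E) p).symm y :=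
    mdifferentiableAt_extChartAt_symm hy
  have h2 : D =
      (mfderiv 𝓘(ℂ, E) 𝓘(ℂ, E) (extChartAt 𝓘(ℂ, E) p).symm y : E →L[ℂ] E).restrictScalars ℝ :=
    (hasMFDerivAt_restrictScalars h1.hasMFDerivAt).mfderiv
  rw [h2]
  exact (mfderiv 𝓘(ℂ, E) 𝓘(ℂ, E) (extChartAt 𝓘(ℂ, E) p).symm y : E →L[ℂ] E).map_smul _ _

theorem mfderiv_extChartAt_I_smul (p : M) {q : M} (hq : q ∈ (extChartAt 𝓘(ℝ, E) p).source)
    (u : E) :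
    let D : E →L[ℝ] E := mfderiv 𝓘(ℝ, E) 𝓘(ℝ, E) (extChartAt 𝓘(ℝ, E) p) q
    D (Complex.I • u) = Complex.I • D u := by
  intro D
  have : IsManifold 𝓘(ℂ, E) 1 M := IsManifold.of_le (n := ω) le_top
  have h1 : MDifferentiableAt 𝓘(ℂ, E) 𝓘(ℂ, E) (extChartAt 𝓘(ℂ, E) p) q :=
    mdifferentiableAt_extChartAt (by rwa [← extChartAt_source 𝓘(ℝ, E)])
  have h2 : D =
      (mfderiv 𝓘(ℂ, E) 𝓘(ℂ, E) (extChartAt 𝓘(ℂ, E) p) q : E →L[ℂ] E).restrictScalars ℝ :=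
    (hasMFDerivAt_restrictScalars h1.hasMFDerivAt).mfderiv
  rw [h2]
  exact (mfderiv 𝓘(ℂ, E) 𝓘(ℂ, E) (extChartAt 𝓘(ℂ, E) p) q : E →L[ℂ] E).map_smul _ _

/-- In charts the factor is a quotient of two coefficients. The numerator is built from the
holomorphic coefficients of `Ω`, the translation and its directional derivatives, all holomorphic by
`differentiableAt_complex_fderiv`. -/
theorem CalabiYau.mdifferentiableAt_factor (EH : Type*) [NormedAddCommGroup EH] [NormedSpace ℝ EH]
    [TopologicalSpace H] [ChartedSpace EH H] [ContMDiffSMul 𝓘(ℝ, EH) 𝓘(ℝ, E) ∞ H M]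
    (hI : ActsHolomorphically H M (E := E)) (h : H) (p : M) :
    MDifferentiableAt 𝓘(ℂ, E) 𝓘(ℂ, ℂ) (C.factor h) p := by
  have : IsManifold 𝓘(ℝ, E) ∞ M := isManifold_real
  have : IsManifold 𝓘(ℝ, E) 1 M := IsManifold.of_le (n := ∞) (by simp)
  have : IsManifold 𝓘(ℂ, E) 1 M := IsManifold.of_le (n := ω) le_top
  let φ := extChartAt 𝓘(ℝ, E) p
  let ψ := extChartAt 𝓘(ℝ, E) (h • p)
  let g : E → M := (fun q : M => h • q) ∘ φ.symm
  let Ψ : E → E := ψ ∘ g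
  have hp0 : φ.symm (φ p) = p := extChartAt_to_inv p
  have hsm : ContMDiff 𝓘(ℝ, E) 𝓘(ℝ, E) ∞ (fun q : M => h • q) :=
    ContMDiffSMul.contMDiff_const_smul (I := 𝓘(ℝ, EH)) h
  have hg : ContMDiffAt 𝓘(ℝ, E) 𝓘(ℝ, E) ∞ g (φ p) :=
    hsm.contMDiffAt.comp _ ((contMDiffOn_extChartAt_symm p).contMDiffAt
      (extChartAt_target_mem_nhds p))
  have hgp : g (φ p) = h • p := by simp only [g, Function.comp_apply, hp0]
  have hΨ : ContDiffAt ℝ ∞ Ψ (φ p) := by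
    rw [← contMDiffAt_iff_contDiffAt]
    refine ContMDiffAt.comp _ ?_ hg
    rw [hgp]; exact contMDiffAt_extChartAt
  have htgt : ∀ᶠ y in 𝓝 (φ p), y ∈ φ.target := extChartAt_target_mem_nhds p
  have hsrc : ∀ᶠ y in 𝓝 (φ p), g y ∈ ψ.source := by
    refine hg.continuousAt.eventually_mem ?_
    rw [hgp]; exact extChartAt_source_mem_nhds _
  have hgd : ∀ᶠ y in 𝓝 (φ p), MDifferentiableAt 𝓘(ℝ, E) 𝓘(ℝ, E) g y := by
    filter_upwards [htgt] with y hy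
    exact (mdifferentiableAt_smul_left EH h (φ.symm y)).comp y
      (mdifferentiableAt_extChartAt_symm hy)
  have hgv : ∀ᶠ y in 𝓝 (φ p), ∀ u : E, (mfderiv 𝓘(ℝ, E) 𝓘(ℝ, E) g y : E →L[ℝ] E) u =
      (mfderiv 𝓘(ℝ, E) 𝓘(ℝ, E) (fun q : M => h • q) (φ.symm y) : E →L[ℝ] E)
        ((mfderiv 𝓘(ℝ, E) 𝓘(ℝ, E) φ.symm y : E →L[ℝ] E) u) := by
    filter_upwards [htgt] with y hy u
    exact congrArg (fun D : E →L[ℝ] E => D u)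
      ((mdifferentiableAt_smul_left EH h (φ.symm y)).hasMFDerivAt.comp y
        (mdifferentiableAt_extChartAt_symm hy).hasMFDerivAt).mfderiv
  have hΨI : ∀ᶠ y in 𝓝 (φ p), ∀ u, fderiv ℝ Ψ y (Complex.I • u) = Complex.I • fderiv ℝ Ψ y u := by
    filter_upwards [htgt, hsrc, hgd, hgv] with y hy hys hyg hygv u
    have h1 : ∀ u : E, fderiv ℝ Ψ y u = (mfderiv 𝓘(ℝ, E) 𝓘(ℝ, E) ψ (g y) : E →L[ℝ] E)
        ((mfderiv 𝓘(ℝ, E) 𝓘(ℝ, E) g y : E →L[ℝ] E) u) := fun u => by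
      have h2 : MDifferentiableAt 𝓘(ℝ, E) 𝓘(ℝ, E) ψ (g y) :=
        mdifferentiableAt_extChartAt (by rwa [← extChartAt_source 𝓘(ℝ, E)])
      have h3 := (h2.hasMFDerivAt.comp y hyg.hasMFDerivAt).mfderiv
      rw [mfderiv_eq_fderiv] at h3
      exact congrArg (fun D : E →L[ℝ] E => D u) h3
    let A : E →L[ℝ] E := mfderiv 𝓘(ℝ, E) 𝓘(ℝ, E) ψ (g y)
    let B : E →L[ℝ] E := mfderiv 𝓘(ℝ, E) 𝓘(ℝ, E) (fun q : M => h • q) (φ.symm y)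
    let D : E →L[ℝ] E := mfderiv 𝓘(ℝ, E) 𝓘(ℝ, E) φ.symm y
    have h5 : ∀ u : E, fderiv ℝ Ψ y u = A (B (D u)) := fun u => by
      rw [h1, hygv]; rfl
    have hA : ∀ u : E, A (Complex.I • u) = Complex.I • A u :=
      mfderiv_extChartAt_I_smul (h • p) hys
    have hB : ∀ u : E, B (Complex.I • u) = Complex.I • B u := hI h (φ.symm y)
    have hD : ∀ u : E, D (Complex.I • u) = Complex.I • D u := mfderiv_extChartAt_symm_I_smul p hy
    rw [h5, h5, hD, hB, hA]
  obtain ⟨hΨd, hΨd'⟩ := differentiableAt_complex_fderiv hΨ hΨI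
  have hΨp : Ψ (φ p) = ψ (h • p) := congrArg ψ hgp
  have hden : DifferentiableAt ℂ (chartForm 𝓘(ℂ, E) C.vform p) (φ p) :=
    (C.vform_holomorphic p).differentiableAt (extChartAt_target_mem_nhds p)
  have hnum : DifferentiableAt ℂ (chartForm 𝓘(ℂ, E) C.vform (h • p)) (Ψ (φ p)) := by
    rw [hΨp]
    exact (C.vform_holomorphic (h • p)).differentiableAt (extChartAt_target_mem_nhds (h • p))
  have hden' : DifferentiableAt ℂ (fun y => chartForm 𝓘(ℂ, E) C.vform p y C.basis) (φ p) :=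
    hden.continuousAlternatingMap_apply_const _
  have hnum' : DifferentiableAt ℂ (fun y => chartForm 𝓘(ℂ, E) C.vform (h • p) (Ψ y)
      (fun i => fderiv ℝ Ψ y (C.basis i))) (φ p) :=
    (DifferentiableAt.comp (φ p) hnum hΨd).continuousAlternatingMap_apply
      (g := fun i y => fderiv ℝ Ψ y (C.basis i)) fun i => hΨd' _
  have hne : chartForm 𝓘(ℂ, E) C.vform p (φ p) C.basis ≠ 0 := by
    refine top_form_basis_ne_zero C.basis fun h0 => C.vform_ne_zero p ?_
    ext v
    have h1 := chartForm_mfderiv C.vform p (f := id) (x := p) mdifferentiableAt_id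
      (mem_extChartAt_source p) v
    have h2 : mfderiv 𝓘(ℂ, E) 𝓘(ℂ, E) (id : M → M) p = ContinuousLinearMap.id ℂ _ := mfderiv_id
    rw [h2] at h1
    refine h1.symm.trans ?_
    exact congrArg (fun F : E [⋀^Fin n]→L[ℂ] ℂ => F _) h0
  have key : ∀ᶠ y in 𝓝 (φ p), C.factor h (φ.symm y) =
      chartForm 𝓘(ℂ, E) C.vform (h • p) (Ψ y) (fun i => fderiv ℝ Ψ y (C.basis i)) /
        chartForm 𝓘(ℂ, E) C.vform p y C.basis := by
    filter_upwards [htgt, hsrc, hgd, hgv, hden'.continuousAt.eventually_ne hne]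
      with y hy hys hyg hygv hyne
    rw [eq_div_iff hyne]
    have h1 := chartForm_mfderiv C.rform (h • p) hyg hys C.basis
    rw [C.chartForm_rform (h • p) (ψ.map_source hys)] at h1
    have h2 : ∀ v : E, fderiv ℝ Ψ y v = mfderiv 𝓘(ℝ, E) 𝓘(ℝ, E) (ψ ∘ g) y v := fun v =>
      (congrArg (fun D : E →L[ℝ] E => D v) mfderiv_eq_fderiv).symm
    have h3 : chartForm 𝓘(ℂ, E) C.vform (h • p) (Ψ y) (fun i => fderiv ℝ Ψ y (C.basis i)) =
        C.rform (g y) (fun i => mfderiv 𝓘(ℝ, E) 𝓘(ℝ, E) g y (C.basis i)) := by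
      simp only [h2]
      exact h1
    have h4 : chartForm 𝓘(ℂ, E) C.vform p y C.basis = C.vform (φ.symm y)
        (fun i => (mfderiv 𝓘(ℝ, E) 𝓘(ℝ, E) φ.symm y : E →L[ℝ] E) (C.basis i)) := by
      have h5 := congrArg (fun F : E [⋀^Fin n]→L[ℝ] ℂ => F C.basis) (C.chartForm_rform p hy)
      exact h5.symm
    rw [h3, h4]
    refine (C.vform_smul hI h (φ.symm y) _).symm.trans ?_
    refine form_congr C.vform rfl ?_
    funext i
    exact (hygv _).symm
  have hdiv : ∀ {a b : E → ℂ} {y : E}, DifferentiableAt ℂ a y → DifferentiableAt ℂ b y → b y ≠ 0 →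
      DifferentiableAt ℂ (fun y => a y / b y) y := fun ha hb h => by
    simpa only [div_eq_mul_inv] using! ha.mul (hb.inv h)
  have hq : DifferentiableAt ℂ (fun y => C.factor h (φ.symm y)) (φ p) :=
    (hdiv (b := fun y => chartForm 𝓘(ℂ, E) C.vform p y C.basis) hnum' hden' hne).congr_of_eventuallyEq key
  have h1 : MDifferentiableAt 𝓘(ℂ, E) 𝓘(ℂ, E) (extChartAt 𝓘(ℂ, E) p) p :=
    mdifferentiableAt_extChartAt (mem_chart_source _ _)
  refine (hq.mdifferentiableAt.comp p h1).congr_of_eventuallyEq ?_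
  filter_upwards [extChartAt_source_mem_nhds (I := 𝓘(ℝ, E)) p] with q hq'
  exact congrArg (C.factor h) (φ.left_inv hq').symm

end Holomorphic

/-! ### The unitary character and the phase. -/

section Phase

set_option linter.unusedSectionVars false

open Set Filter Topology

/-- The functional equation turns the derivative at `0` into the equation `g' = z g`; hence `g t *
exp (-z t)` has zero derivative. -/
theorem eq_exp_of_map_add {g : ℝ → ℂ} {z : ℂ} (h0 : g 0 = 1) (hg : ∀ s t, g (s + t) = g s * g t)
    (hd : HasDerivAt g z 0) (t : ℝ) : g t = Complex.exp (z * t) := by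
  have h1 : ∀ t, HasDerivAt g (g t * z) t := by
    intro t
    have h2 : HasDerivAt (fun s => g t * g (s - t)) (g t * z) t := by
      have h3 : HasDerivAt g z (t - t) := by rwa [sub_self]
      exact (h3.comp_sub_const t t).const_mul (g t)
    refine h2.congr_of_eventuallyEq (Eventually.of_forall fun s => ?_)
    change g s = g t * g (s - t)
    rw [← hg, add_sub_cancel]
  have h2 : ∀ t, HasDerivAt (fun t : ℝ => g t * Complex.exp (-(z * t))) 0 t := by
    intro t
    have h3 : HasDerivAt (fun t : ℝ => Complex.exp (-(z * t)))
        (Complex.exp (-(z * t)) * -(z * 1)) t :=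
      (((Complex.ofRealCLM.hasDerivAt (x := t)).const_mul z).neg).cexp
    have h4 := (h1 t).mul h3
    refine h4.congr_deriv ?_
    ring
  have h3 := is_const_of_deriv_eq_zero (fun t => (h2 t).differentiableAt)
    (fun t => (h2 t).deriv) t 0
  simp only [h0, Complex.ofReal_zero, mul_zero, neg_zero, Complex.exp_zero, mul_one] at h3
  rw [Complex.exp_neg, ← div_eq_mul_inv, div_eq_one_iff_eq (Complex.exp_ne_zero _)] at h3
  exact h3

variable {n : ℕ} {E : Type*} [NormedAddCommGroup E] [NormedSpace ℂ E] [FiniteDimensional ℂ E]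
  {M : Type*} [TopologicalSpace M] [ChartedSpace E M] [IsManifold 𝓘(ℂ, E) ω M]
  {EH : Type*} [NormedAddCommGroup EH] [NormedSpace ℝ EH] [FiniteDimensional ℝ EH]
  {H : Type*} [TopologicalSpace H] [ChartedSpace EH H] [Group H] [LieGroup 𝓘(ℝ, EH) ∞ H]
  [MulAction H M] [ContMDiffSMul 𝓘(ℝ, EH) 𝓘(ℝ, E) ∞ H M] (C : CalabiYau n E M)

theorem CalabiYau.vform_basis_ne_zero (p : M) : C.vform p C.basis ≠ 0 :=
  top_form_basis_ne_zero (E := E) C.basis (C.vform_ne_zero p)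

theorem CalabiYau.factor_one (p : M) : C.factor (1 : H) p = 1 := by
  rw [factor, div_eq_one_iff_eq (C.vform_basis_ne_zero p)]
  exact form_congr C.vform (one_smul _ _) (funext fun i => mfderiv_one_smul p _)

/-- A cocycle identity; it becomes multiplicativity in the group once the factor is independent of
the point. -/
theorem CalabiYau.factor_mul (EH : Type*) [NormedAddCommGroup EH] [NormedSpace ℝ EH]
    [ChartedSpace EH H] [ContMDiffSMul 𝓘(ℝ, EH) 𝓘(ℝ, E) ∞ H M]
    (hI : ActsHolomorphically H M (E := E)) (h k : H) (p : M) :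
    C.factor (h * k) p = C.factor h (k • p) * C.factor k p := by
  refine mul_right_cancel₀ (C.vform_basis_ne_zero p) ?_
  rw [mul_assoc]
  rw [← C.vform_smul hI k p C.basis]
  refine (C.vform_smul hI (h * k) p C.basis).symm.trans ?_
  refine Eq.trans ?_ (C.vform_smul hI h (k • p) _)
  exact form_congr C.vform (mul_smul h k p) (funext fun i => mfderiv_mul_smul EH h k p _)

/-- Differentiability at `1` suffices: multiplicativity carries continuity to all of `H` and makes
the factor exponential along one-parameter subgroups. -/
theorem CalabiYau.mdifferentiableAt_factor_one (p : M) :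
    MDifferentiableAt 𝓘(ℝ, EH) 𝓘(ℝ, ℂ) (fun h : H => C.factor h p) 1 := by
  have : IsManifold 𝓘(ℝ, E) ∞ M := isManifold_real
  have : IsManifold 𝓘(ℝ, EH) ∞ H := LieGroup.toContMDiffMul.toIsManifold
  have : IsManifold 𝓘(ℝ, EH) 1 H := IsManifold.of_le (n := ∞) (by simp)
  let χ := extChartAt 𝓘(ℝ, EH) (1 : H)
  let φ := extChartAt 𝓘(ℝ, E) p
  let Φ : EH × E → E := actionChart EH H p
  have hΦ : ContDiffAt ℝ ∞ Φ (χ 1, φ p) := contDiffAt_actionChart p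
  have hin : ContDiffAt ℝ ∞ (fun a : EH => (a, φ p)) (χ 1) :=
    contDiffAt_id.prodMk contDiffAt_const
  have h0 : Φ (χ 1, φ p) = φ p := actionChart_one p (mem_extChartAt_target p)
  have h1 : DifferentiableAt ℝ (fun a => Φ (a, φ p)) (χ 1) :=
    ((hΦ.comp (χ 1) hin).differentiableAt (by simp) :)
  have h2 : DifferentiableAt ℝ (chartForm 𝓘(ℝ, E) C.rform p) (Φ (χ 1, φ p)) := by
    rw [h0]
    exact (C.differentiableOn_chartForm_rform p).differentiableAt (extChartAt_target_mem_nhds p)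
  have h3 : DifferentiableAt ℝ (fun a => chartForm 𝓘(ℝ, E) C.rform p (Φ (a, φ p))) (χ 1) :=
    DifferentiableAt.comp (f := fun a => Φ (a, φ p)) (χ 1) h2 h1
  have h4 : ∀ u : E, DifferentiableAt ℝ (fun a => fderiv ℝ Φ (a, φ p) (0, u)) (χ 1) := fun u =>
    (((hΦ.fderiv_right (m := ∞) (by simp)).comp (χ 1) hin).differentiableAt
      (by simp)).clm_apply (differentiableAt_const _)
  have h5 : DifferentiableAt ℝ (fun a => chartForm 𝓘(ℝ, E) C.rform p (Φ (a, φ p))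
      (fun i => fderiv ℝ Φ (a, φ p) (0, C.basis i))) (χ 1) :=
    h3.continuousAlternatingMap_apply (g := fun i a => fderiv ℝ Φ (a, φ p) (0, C.basis i))
      fun i => h4 _
  have h6 := (h5.mul_const (C.vform p C.basis)⁻¹).mdifferentiableAt
  have h7 : MDifferentiableAt 𝓘(ℝ, EH) 𝓘(ℝ, EH) (extChartAt 𝓘(ℝ, EH) (1 : H)) 1 :=
    mdifferentiableAt_extChartAt (mem_chart_source _ _)
  refine (h6.comp (1 : H) h7).congr_of_eventuallyEq ?_
  filter_upwards [eventually_pullback_eq (EH := EH) (H := H) C.rform p] with h hh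
  rw [factor, div_eq_mul_inv]
  exact congrArg (· * (C.vform p C.basis)⁻¹) (hh C.basis)

/-- The translations multiply the holomorphic volume form by a unitary character, whose
differential is the phase. -/
theorem CalabiYau.exists_character [ConnectedSpace H] [ConnectedSpace M]
    (hI : ActsHolomorphically H M (E := E))
    {μ : M → (GroupLieAlgebra 𝓘(ℝ, EH) H →L[ℝ] ℝ)} (hμ : C.IsMomentMap μ) :
    ∃ (f : H → ℂ) (a : GroupLieAlgebra 𝓘(ℝ, EH) H →L[ℝ] ℝ), Continuous f ∧
      (∀ (h : H) (p : M) (v : Fin n → E),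
        C.vform (h • p) (fun i => mfderiv 𝓘(ℝ, E) 𝓘(ℝ, E) (fun q : M => h • q) p (v i)) =
          f h * C.vform p v) ∧
      ∀ η : List (GroupLieAlgebra 𝓘(ℝ, EH) H),
        f (η.map lieExp).prod = Complex.exp (Complex.I * (a η.sum : ℂ)) := by
  have : IsManifold 𝓘(ℝ, E) ∞ M := isManifold_real
  have : FiniteDimensional ℝ E := FiniteDimensional.complexToReal E
  have : CompleteSpace EH := FiniteDimensional.complete ℝ EH
  have : IsTopologicalGroup H := topologicalGroup_of_lieGroup 𝓘(ℝ, EH) ∞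
  obtain ⟨p₀⟩ : Nonempty M := inferInstance
  have hnorm : ∀ (h : H) (p : M), ‖C.factor h p‖ = 1 := fun h p =>
    C.norm_factor hI h p (C.kform_smul hμ h p)
  -- The modulus is constant, so it attains its maximum at `p₀`; the maximum principle on the
  -- connected manifold applies.
  have hconst : ∀ (h : H) (p : M), C.factor h p = C.factor h p₀ := by
    intro h p
    have hd : MDifferentiableOn 𝓘(ℂ, E) 𝓘(ℂ, ℂ) (C.factor h) univ := fun q _ =>
      (C.mdifferentiableAt_factor EH hI h q).mdifferentiableWithinAt
    refine hd.eqOn_of_isPreconnected_of_isMaxOn_norm isPreconnected_univ isOpen_univ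
      (mem_univ p₀) (fun q _ => ?_) (mem_univ p)
    simp [hnorm]
  let f : H → ℂ := fun h => C.factor h p₀
  have hf1 : f 1 = 1 := C.factor_one p₀
  have hfm : ∀ h k, f (h * k) = f h * f k := fun h k => by
    simp only [f]
    rw [C.factor_mul EH hI, hconst h (k • p₀)]
  have hfd : MDifferentiableAt 𝓘(ℝ, EH) 𝓘(ℝ, ℂ) f 1 := C.mdifferentiableAt_factor_one p₀
  have hfc : Continuous f := by
    refine continuous_iff_continuousAt.2 fun k => ?_
    have h1 : ContinuousAt (fun h => f (h * k⁻¹) * f k) k := by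
      refine ContinuousAt.mul ?_ continuousAt_const
      refine ContinuousAt.comp (g := f) ?_ (continuous_mul_const k⁻¹).continuousAt
      rw [mul_inv_cancel]
      exact hfd.continuousAt
    refine h1.congr (Eventually.of_forall fun h => ?_)
    change f (h * k⁻¹) * f k = f h
    rw [← hfm, inv_mul_cancel_right]
  let A : EH →L[ℝ] ℂ := mfderiv 𝓘(ℝ, EH) 𝓘(ℝ, ℂ) f 1
  have hexp : ∀ ξ : GroupLieAlgebra 𝓘(ℝ, EH) H,
      f (lieExp ξ) = Complex.exp (Complex.I * ((A ξ).im : ℂ)) := by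
    intro ξ
    obtain ⟨γ, hγ⟩ := exists_isOneParam ξ
    have h1 : HasMFDerivAt 𝓘(ℝ, ℝ) 𝓘(ℝ, ℂ) (f ∘ γ) 0
        (A.comp ((1 : ℝ →L[ℝ] ℝ).smulRight (ξ : EH) : ℝ →L[ℝ] EH)) :=
      HasMFDerivAt.comp (0 : ℝ) (by rw [hγ.zero]; exact hfd.hasMFDerivAt) hγ.hasMFDerivAt_zero
    have h2 : HasFDerivAt (𝕜 := ℝ) (E := ℝ) (F := ℂ) (f ∘ γ)
        (A.comp ((1 : ℝ →L[ℝ] ℝ).smulRight (ξ : EH) : ℝ →L[ℝ] EH)) 0 := h1.hasFDerivAt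
    have h3 : HasDerivAt (f ∘ γ) (A ξ) 0 := by
      have := h2.hasDerivAt
      have e : (A.comp ((1 : ℝ →L[ℝ] ℝ).smulRight (ξ : EH) : ℝ →L[ℝ] EH)) 1 = A ξ :=
        congrArg A (one_smul ℝ (ξ : EH))
      rwa [e] at this
    have h4 := eq_exp_of_map_add (g := f ∘ γ) (by simp [hγ.zero, hf1])
      (fun s t => by simp [hγ.1, hfm]) h3 1
    rw [lieExp_eq hγ]
    have h5 : f (γ 1) = Complex.exp (A ξ) := by simpa using h4
    have h6 : ‖Complex.exp (A ξ)‖ = 1 := by rw [← h5]; exact hnorm _ _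
    -- Unit modulus makes `A ξ` purely imaginary, so the phase is the imaginary part of the
    -- differential of the character.
    rw [Complex.norm_exp, Real.exp_eq_one_iff] at h6
    rw [h5]
    congr 1
    apply Complex.ext <;> simp [h6]
  refine ⟨f, Complex.imCLM.comp A, hfc, fun h p v => ?_, fun η => ?_⟩
  · rw [C.vform_smul hI, hconst]
  · induction η with
    | nil => simp [hf1]
    | cons ξ η ih =>
      rw [List.map_cons, List.prod_cons, hfm, ih, hexp, ← Complex.exp_add, List.sum_cons, map_add]
      push_cast
      rw [mul_add]
      rfl

theorem CalabiYau.IsPhase.unique [Nonempty M] {a b : GroupLieAlgebra 𝓘(ℝ, EH) H →L[ℝ] ℝ}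
    (ha : C.IsPhase (M := M) a) (hb : C.IsPhase b) : b = a := by
  obtain ⟨p⟩ : Nonempty M := inferInstance
  have h1 : ∀ ξ, Complex.exp (Complex.I * (b ξ : ℂ)) = Complex.exp (Complex.I * (a ξ : ℂ)) := by
    intro ξ
    have h2 := ha [ξ] _ rfl p C.basis
    have h3 := hb [ξ] _ rfl p C.basis
    have h4 := mul_right_cancel₀ (C.vform_basis_ne_zero p) (h3.symm.trans h2)
    simpa using h4
  ext ξ
  by_contra hne
  have hc : b ξ - a ξ ≠ 0 := sub_ne_zero.2 hne
  -- Equality of exponentials only compares phases modulo `2π`. The multiple of `ξ` on which `b - a`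
  -- takes the value `π` gives the contradiction `-1 = 1`.
  have h2 := h1 ((Real.pi / (b ξ - a ξ)) • ξ)
  have h3 : Complex.exp (Complex.I * ((b ((Real.pi / (b ξ - a ξ)) • ξ) : ℝ) : ℂ) -
      Complex.I * ((a ((Real.pi / (b ξ - a ξ)) • ξ) : ℝ) : ℂ)) = 1 := by
    rw [Complex.exp_sub, h2, div_self (Complex.exp_ne_zero _)]
  rw [← mul_sub, ← Complex.ofReal_sub, map_smul, map_smul, ← smul_sub, smul_eq_mul,
    div_mul_cancel₀ _ hc, mul_comm, Complex.exp_pi_mul_I] at h3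
  norm_num at h3

end Phase

/-! ### The orbit map and its differential. -/

section OrbitMap

set_option linter.unusedSectionVars false

open Set Filter Topology

variable {E : Type*} [NormedAddCommGroup E] [NormedSpace ℝ E]
  {M : Type*} [TopologicalSpace M] [ChartedSpace E M] [IsManifold 𝓘(ℝ, E) ∞ M]
  {EH : Type*} [NormedAddCommGroup EH] [NormedSpace ℝ EH] [FiniteDimensional ℝ EH]
  {H : Type*} [TopologicalSpace H] [ChartedSpace EH H] [Group H] [LieGroup 𝓘(ℝ, EH) ∞ H]
  [MulAction H M] [ContMDiffSMul 𝓘(ℝ, EH) 𝓘(ℝ, E) ∞ H M]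
  {EV : Type*} [NormedAddCommGroup EV] [NormedSpace ℝ EV]
  {V : Set M} [ChartedSpace EV V]
  {K : Subgroup H} (hK : ∀ p ∈ V, MulAction.stabilizer H p = K)
  {EQ : Type*} [NormedAddCommGroup EQ] [NormedSpace ℝ EQ] [FiniteDimensional ℝ EQ]
  [ChartedSpace EQ (H ⧸ K)] [IsManifold 𝓘(ℝ, EQ) ∞ (H ⧸ K)]

/-- The value does not depend on the representative, so near a point the map is `(q, p) ↦ s q • p`
for a smooth local section `s` of the projection. -/
theorem contMDiff_orbitMap (hV : IsSubmanifold (E := E) EV V)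
    (hQ : IsSubmersion 𝓘(ℝ, EH) 𝓘(ℝ, EQ) (QuotientGroup.mk : H → H ⧸ K)) :
    ContMDiff (𝓘(ℝ, EQ).prod 𝓘(ℝ, EV)) 𝓘(ℝ, E) ∞ (orbitMap K V hK) := by
  have : IsManifold 𝓘(ℝ, EH) ∞ H := LieGroup.toContMDiffMul.toIsManifold
  have : CompleteSpace EH := FiniteDimensional.complete ℝ EH
  rintro ⟨q, p⟩
  obtain ⟨h, rfl⟩ := QuotientGroup.mk_surjective q
  obtain ⟨s, -, hs, hπs⟩ := exists_local_section h (hQ.1 h) (hQ.2 h)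
  have h1 : ContMDiffAt (𝓘(ℝ, EQ).prod 𝓘(ℝ, EV)) 𝓘(ℝ, EH) ∞ (fun x : (H ⧸ K) × V => s x.1)
      ((h : H ⧸ K), p) :=
    ContMDiffAt.comp (g := s) (f := Prod.fst) (I' := 𝓘(ℝ, EQ)) ((h : H ⧸ K), p) hs
      contMDiffAt_fst
  have h2 : ContMDiffAt (𝓘(ℝ, EQ).prod 𝓘(ℝ, EV)) 𝓘(ℝ, E) ∞
      (fun x : (H ⧸ K) × V => (x.2 : M)) ((h : H ⧸ K), p) :=
    ContMDiffAt.comp (g := (Subtype.val : V → M)) (f := Prod.snd) (I' := 𝓘(ℝ, EV))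
      ((h : H ⧸ K), p) (hV.2.1 p) contMDiffAt_snd
  refine (h1.smul h2).congr_of_eventuallyEq ?_
  have h3 : ∀ᶠ x : (H ⧸ K) × V in 𝓝 ((h : H ⧸ K), p), ((s x.1 : H) : H ⧸ K) = x.1 :=
    (continuous_fst.tendsto ((h : H ⧸ K), p)).eventually hπs
  filter_upwards [h3] with x hx
  exact congrArg (fun q => orbitMap K V hK (q, x.2)) hx.symm

/-- Both sides differentiate `k ↦ (h * k) • p` at `1`. -/
theorem mfderiv_smul_right_mul (h : H) (p : M) (ξ : GroupLieAlgebra 𝓘(ℝ, EH) H) :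
    (mfderiv 𝓘(ℝ, EH) 𝓘(ℝ, E) (fun k : H => k • p) h : EH →L[ℝ] E)
      ((mfderiv 𝓘(ℝ, EH) 𝓘(ℝ, EH) (fun k : H => h * k) 1 : EH →L[ℝ] EH) ξ) =
      (mfderiv 𝓘(ℝ, E) 𝓘(ℝ, E) (fun q : M => h • q) p : E →L[ℝ] E) (fund ξ p) := by
  have h1 : HasMFDerivAt 𝓘(ℝ, EH) 𝓘(ℝ, E) (fun k : H => k • p) (h * 1)
      (mfderiv 𝓘(ℝ, EH) 𝓘(ℝ, E) (fun k : H => k • p) h : EH →L[ℝ] E) := by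
    rw [mul_one]; exact (mdifferentiableAt_smul_right h p).hasMFDerivAt
  have h2 := h1.comp (1 : H) (mdifferentiableAt_mul_left' h 1).hasMFDerivAt
  have h3 : HasMFDerivAt 𝓘(ℝ, E) 𝓘(ℝ, E) (fun q : M => h • q) ((1 : H) • p)
      (mfderiv 𝓘(ℝ, E) 𝓘(ℝ, E) (fun q : M => h • q) p : E →L[ℝ] E) := by
    rw [one_smul]; exact (mdifferentiableAt_smul_left EH h p).hasMFDerivAt
  have h4 := h3.comp (1 : H) (mdifferentiableAt_smul_right (EH := EH) 1 p).hasMFDerivAt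
  have e : (fun q : M => h • q) ∘ (fun k : H => k • p) = (fun k : H => k • p) ∘ fun k => h * k := by
    funext k; simp [mul_smul]
  rw [e] at h4
  exact congrArg (fun D : EH →L[ℝ] E => D ξ) (h2.mfderiv.symm.trans h4.mfderiv)

theorem mfderiv_mul_left_surjective (h : H) (u : EH) :
    ∃ ξ : EH, (mfderiv 𝓘(ℝ, EH) 𝓘(ℝ, EH) (fun k : H => h * k) 1 : EH →L[ℝ] EH) ξ = u := by
  have h1 := mdifferentiableAt_mul_left' (EH := EH) h⁻¹ h
  have h2 : HasMFDerivAt 𝓘(ℝ, EH) 𝓘(ℝ, EH) (fun k : H => h * k) (h⁻¹ * h)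
      (mfderiv 𝓘(ℝ, EH) 𝓘(ℝ, EH) (fun k : H => h * k) 1 : EH →L[ℝ] EH) := by
    rw [inv_mul_cancel]; exact (mdifferentiableAt_mul_left' h 1).hasMFDerivAt
  have h3 := h2.comp h h1.hasMFDerivAt
  have e : (fun k : H => h * k) ∘ (fun k => h⁻¹ * k) = id := by funext k; simp
  rw [e] at h3
  exact ⟨_, congrArg (fun D : EH →L[ℝ] EH => D u) (h3.mfderiv.symm.trans mfderiv_id)⟩

/-- A one-parameter subgroup whose fundamental vector field vanishes at a point fixes that point. -/
theorem IsOneParam.smul_eq {γ : ℝ → H} {ξ : GroupLieAlgebra 𝓘(ℝ, EH) H} (hγ : IsOneParam γ ξ)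
    {p : M} (hp : fund (E := E) ξ p = (0 : E)) (t : ℝ) : γ t • p = p := by
  have : IsManifold 𝓘(ℝ, E) 1 M := IsManifold.of_le (n := ∞) (by simp)
  -- The velocity of the orbit at time `t` is the image under `γ t` of the velocity at time `0`,
  -- which is zero.
  have key : ∀ t, HasMFDerivAt 𝓘(ℝ, ℝ) 𝓘(ℝ, E) (fun s => γ s • p) t 0 := by
    intro t
    have h1 : HasMFDerivAt 𝓘(ℝ, EH) 𝓘(ℝ, E) (fun k : H => k • p) (γ 0)
        (mfderiv 𝓘(ℝ, EH) 𝓘(ℝ, E) (fun k : H => k • p) 1 : EH →L[ℝ] E) := by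
      rw [hγ.zero]; exact (mdifferentiableAt_smul_right 1 p).hasMFDerivAt
    have h2 := HasMFDerivAt.comp (f := γ) (0 : ℝ) h1 hγ.hasMFDerivAt_zero
    have h3 : HasMFDerivAt 𝓘(ℝ, ℝ) 𝓘(ℝ, E) ((fun k : H => k • p) ∘ γ) (t - t)
        (0 : ℝ →L[ℝ] E) := by
      rw [sub_self]
      refine (congrArg (HasMFDerivAt 𝓘(ℝ, ℝ) 𝓘(ℝ, E) ((fun k : H => k • p) ∘ γ) 0) ?_).mp h2
      refine ContinuousLinearMap.ext_ring ?_
      have e : ((1 : ℝ →L[ℝ] ℝ).smulRight (ξ : EH)) 1 = ξ := one_smul ℝ (ξ : EH)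
      exact (congrArg (mfderiv 𝓘(ℝ, EH) 𝓘(ℝ, E) (fun k : H => k • p) 1 : EH →L[ℝ] E) e).trans hp
    have h4 : MDifferentiableAt 𝓘(ℝ, ℝ) 𝓘(ℝ, ℝ) (fun s : ℝ => s - t) t :=
      ((differentiableAt_id).sub_const t).mdifferentiableAt
    have h5 := hasMFDerivAt_zero_comp (f := fun s : ℝ => s - t) h3 h4
    have h6 := (mdifferentiableAt_smul_left EH (γ t) _).hasMFDerivAt.comp t h5
    have h7 : HasMFDerivAt 𝓘(ℝ, ℝ) 𝓘(ℝ, E) ((fun q : M => γ t • q) ∘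
        (((fun k : H => k • p) ∘ γ) ∘ fun s : ℝ => s - t)) t (0 : ℝ →L[ℝ] E) := by
      rw [ContinuousLinearMap.comp_zero] at h6
      exact h6
    refine h7.congr_of_eventuallyEq (Eventually.of_forall fun s => ?_)
    simp only [Function.comp_apply]
    rw [smul_smul, ← hγ.1, add_sub_cancel]
  have h := eq_of_hasMFDerivAt_zero key t 0
  simpa [hγ.zero] using h

/-- The differential of the orbit map. -/
theorem exists_mfderiv_orbitMap (hV : IsSubmanifold (E := E) EV V)
    (hQ : IsSubmersion 𝓘(ℝ, EH) 𝓘(ℝ, EQ) (QuotientGroup.mk : H → H ⧸ K)) (h : H) (p : V) :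
    ∃ G : EQ × EV →ₗ[ℝ] E,
      (∀ z, (mfderiv (𝓘(ℝ, EQ).prod 𝓘(ℝ, EV)) 𝓘(ℝ, E) (orbitMap K V hK) ((h : H ⧸ K), p) :
          EQ × EV →L[ℝ] E) z =
        (mfderiv 𝓘(ℝ, E) 𝓘(ℝ, E) (fun q : M => h • q) (p : M) : E →L[ℝ] E) (G z)) ∧
      ∀ w, ∃ ξ : GroupLieAlgebra 𝓘(ℝ, EH) H,
        (∀ v, G (w, v) = fund (E := E) ξ (p : M) +
          (mfderiv 𝓘(ℝ, EV) 𝓘(ℝ, E) (Subtype.val : V → M) p : EV →L[ℝ] E) v) ∧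
        (fund (E := E) ξ (p : M) = (0 : E) → w = 0) := by
  have : IsManifold 𝓘(ℝ, EH) ∞ H := LieGroup.toContMDiffMul.toIsManifold
  have : IsManifold 𝓘(ℝ, EQ) 1 (H ⧸ K) := IsManifold.of_le (n := ∞) (by simp)
  have : CompleteSpace EH := FiniteDimensional.complete ℝ EH
  let D : EQ × EV →L[ℝ] E :=
    mfderiv (𝓘(ℝ, EQ).prod 𝓘(ℝ, EV)) 𝓘(ℝ, E) (orbitMap K V hK) ((h : H ⧸ K), p)
  let A : E →L[ℝ] E := mfderiv 𝓘(ℝ, E) 𝓘(ℝ, E) (fun q : M => h • q) (p : M)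
  let A' : E →L[ℝ] E := mfderiv 𝓘(ℝ, E) 𝓘(ℝ, E) (fun q : M => h⁻¹ • q) (h • (p : M))
  let B : EV →L[ℝ] E := mfderiv 𝓘(ℝ, EV) 𝓘(ℝ, E) (Subtype.val : V → M) p
  let P : EH →L[ℝ] EQ := mfderiv 𝓘(ℝ, EH) 𝓘(ℝ, EQ) (QuotientGroup.mk : H → H ⧸ K) h
  let S : EH →L[ℝ] EH := mfderiv 𝓘(ℝ, EH) 𝓘(ℝ, EH) (fun k : H => h * k) 1
  have hAA' : ∀ u, A' (A u) = u := fun u => by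
    have h1 := mfderiv_mul_smul EH h⁻¹ h (p : M) u
    rw [inv_mul_cancel, mfderiv_one_smul] at h1
    exact h1.symm
  have hA'A : ∀ u, A (A' u) = u := fun u => by
    have h1 := mfderiv_mul_smul EH h h⁻¹ (h • (p : M)) u
    rw [mul_inv_cancel, mfderiv_one_smul, inv_smul_smul] at h1
    exact h1.symm
  have hD := ((contMDiff_orbitMap hK hV hQ ((h : H ⧸ K), p)).mdifferentiableAt
    (by simp)).hasMFDerivAt
  have hP : HasMFDerivAt 𝓘(ℝ, EH) 𝓘(ℝ, EQ) (QuotientGroup.mk : H → H ⧸ K) h P :=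
    ((hQ.1 h).mdifferentiableAt (by simp)).hasMFDerivAt
  have hB : HasMFDerivAt 𝓘(ℝ, EV) 𝓘(ℝ, E) (Subtype.val : V → M) p B :=
    ((hV.2.1 p).mdifferentiableAt (by simp)).hasMFDerivAt
  have hfst : ∀ ξ : EH, D (P (S ξ), 0) = A (fund (H := H) ξ (p : M)) := by
    intro ξ
    have h1 : HasMFDerivAt 𝓘(ℝ, EH) (𝓘(ℝ, EQ).prod 𝓘(ℝ, EV))
        (fun k : H => ((k : H ⧸ K), p)) h (P.prod (0 : EH →L[ℝ] EV)) :=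
      hP.prodMk (hasMFDerivAt_const p h)
    have h2 := HasMFDerivAt.comp (f := fun k : H => ((k : H ⧸ K), p)) h hD h1
    have h3 : D.comp (P.prod (0 : EH →L[ℝ] EV)) =
        (mfderiv 𝓘(ℝ, EH) 𝓘(ℝ, E) (fun k : H => k • (p : M)) h : EH →L[ℝ] E) := h2.mfderiv.symm
    refine Eq.trans ?_ (mfderiv_smul_right_mul h (p : M) ξ)
    exact congrArg (fun F : EH →L[ℝ] E => F (S ξ)) h3
  have hsnd : ∀ v : EV, D (0, v) = A (B v) := by
    intro v
    have h1 : HasMFDerivAt 𝓘(ℝ, EV) (𝓘(ℝ, EQ).prod 𝓘(ℝ, EV))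
        (fun x : V => ((h : H ⧸ K), x)) p
        ((0 : EV →L[ℝ] EQ).prod (ContinuousLinearMap.id ℝ EV)) :=
      (hasMFDerivAt_const (h : H ⧸ K) p).prodMk (hasMFDerivAt_id p)
    have h2 := HasMFDerivAt.comp (f := fun x : V => ((h : H ⧸ K), x)) p hD h1
    have h3 := HasMFDerivAt.comp (f := (Subtype.val : V → M)) p
      (mdifferentiableAt_smul_left EH h (p : M)).hasMFDerivAt hB
    have h4 : D.comp ((0 : EV →L[ℝ] EQ).prod (ContinuousLinearMap.id ℝ EV)) = A.comp B :=
      h2.mfderiv.symm.trans h3.mfderiv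
    exact congrArg (fun F : EV →L[ℝ] E => F v) h4
  -- `G` is the differential of the orbit map moved back to `p` by the inverse translation.
  refine ⟨(A'.comp D).toLinearMap, fun z => (hA'A (D z)).symm, fun w => ?_⟩
  -- `ξ` is a lift of `w` to the tangent space of `H` at `h`, translated back to `1`.
  obtain ⟨u, hu⟩ := hQ.2 h w
  obtain ⟨ξ, hξ⟩ := mfderiv_mul_left_surjective (EH := EH) h u
  have hw : P (S ξ) = w := (congrArg P hξ).trans hu
  refine ⟨ξ, fun v => ?_, fun h0 => ?_⟩
  · have e : ((w, v) : EQ × EV) = (P (S ξ), 0) + (0, v) := by simp [hw]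
    change A' (D (w, v)) = _
    rw [e, map_add, map_add, hfst, hsnd, hAA' (B v)]
    exact congrArg (· + B v) (hAA' _)
  -- If the fundamental field of `ξ` vanishes at `p`, the one-parameter subgroup fixes `p` and lies
  -- in `K`. The curve `h γ(t) K` is then constant, and its velocity at `0` is `w`.
  · obtain ⟨γ, hγ⟩ := exists_isOneParam (H := H) ξ
    have h1 : ∀ t, ((h * γ t : H) : H ⧸ K) = (h : H ⧸ K) := by
      intro t
      have h2 : γ t ∈ K := by
        rw [← hK p p.2, MulAction.mem_stabilizer_iff]
        exact hγ.smul_eq h0 t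
      exact (QuotientGroup.eq.2 (by simpa using h2)).symm
    have h3 : HasMFDerivAt 𝓘(ℝ, EH) 𝓘(ℝ, EH) (fun k : H => h * k) (γ 0) S := by
      rw [hγ.zero]; exact (mdifferentiableAt_mul_left' h 1).hasMFDerivAt
    have h4 := HasMFDerivAt.comp (f := γ) (0 : ℝ) h3 hγ.hasMFDerivAt_zero
    have h5 : HasMFDerivAt 𝓘(ℝ, EH) 𝓘(ℝ, EQ) (QuotientGroup.mk : H → H ⧸ K) (h * γ 0) P := by
      rw [hγ.zero, mul_one]; exact hP
    have h6 := HasMFDerivAt.comp (f := (fun k : H => h * k) ∘ γ) (0 : ℝ) h5 h4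
    have h7 : ((QuotientGroup.mk : H → H ⧸ K) ∘ ((fun k : H => h * k) ∘ γ)) =
        fun _ => (h : H ⧸ K) := funext h1
    rw [h7] at h6
    have h8 := h6.mfderiv.symm.trans mfderiv_const
    have h9 := congrArg (fun F : ℝ →L[ℝ] EQ => F 1) h8
    have e : ((1 : ℝ →L[ℝ] ℝ).smulRight (ξ : EH)) 1 = ξ := one_smul ℝ (ξ : EH)
    rw [← hw]
    refine Eq.trans ?_ h9
    exact (congrArg (fun x => P (S x)) e).symm

end OrbitMap

/-! ### Tangent spaces of the submanifolds, and the moment map along them. -/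

section TangentSpaces

open Set Filter Topology

/-- The inclusion of `V` in `L` is a priori only continuous. It is differentiable because it factors
a differentiable map through the immersion of `L`; then the chain rule applies. -/
theorem tangent_le {E : Type*} [NormedAddCommGroup E] [NormedSpace ℝ E] [FiniteDimensional ℝ E]
    {M : Type*} [TopologicalSpace M] [ChartedSpace E M]
    {EL : Type*} [NormedAddCommGroup EL] [NormedSpace ℝ EL] {L : Set M} [ChartedSpace EL L]
    (hL : IsSubmanifold (E := E) EL L)
    {EV : Type*} [NormedAddCommGroup EV] [NormedSpace ℝ EV] {V : Set M} [ChartedSpace EV V]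
    (hV : IsSubmanifold (E := E) EV V) (hVL : V ⊆ L) (p : V) :
    tangent (E := E) EV V p ≤ tangent EL L ⟨p, hVL p.2⟩ := by
  rintro _ ⟨v, rfl⟩
  have h1 : MDifferentiableAt 𝓘(ℝ, EV) 𝓘(ℝ, E) (Subtype.val : V → M) p :=
    (hV.2.1 p).mdifferentiableAt (by simp)
  have h2 : MDifferentiableAt 𝓘(ℝ, EL) 𝓘(ℝ, E) (Subtype.val : L → M) ⟨p, hVL p.2⟩ :=
    (hL.2.1 _).mdifferentiableAt (by simp)
  have h3 : MDifferentiableAt 𝓘(ℝ, EV) 𝓘(ℝ, EL) (inclusion hVL) p :=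
    mdifferentiableAt_factor (i := inclusion hVL) h1 h2 (hL.2.2 _)
      (continuous_inclusion hVL).continuousAt fun _ => rfl
  have h4 : HasMFDerivAt 𝓘(ℝ, EV) 𝓘(ℝ, E) (Subtype.val : V → M) p _ :=
    HasMFDerivAt.comp (f := inclusion hVL) p h2.hasMFDerivAt h3.hasMFDerivAt
  exact ⟨(mfderiv 𝓘(ℝ, EV) 𝓘(ℝ, EL) (inclusion hVL) p : EV →L[ℝ] EL) v,
    congrArg (fun D : EV →L[ℝ] E => D v) h4.mfderiv.symm⟩

variable {n : ℕ} {E : Type*} [NormedAddCommGroup E] [NormedSpace ℂ E]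
  {M : Type*} [TopologicalSpace M] [ChartedSpace E M] (C : CalabiYau n E M)
  {EH : Type*} [NormedAddCommGroup EH] [NormedSpace ℝ EH]
  {H : Type*} [TopologicalSpace H] [ChartedSpace EH H] [Group H] [MulAction H M]
  {μ : M → (GroupLieAlgebra 𝓘(ℝ, EH) H →L[ℝ] ℝ)}
  {c : GroupLieAlgebra 𝓘(ℝ, EH) H →L[ℝ] ℝ}

/-- The moment map is constant on `V`, and its differential is the contraction of the Kähler form up
to sign. -/
theorem CalabiYau.kform_fund_tangent {EV : Type*} [NormedAddCommGroup EV] [NormedSpace ℝ EV]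
    {V : Set M} [ChartedSpace EV V] (hV : IsSubmanifold (E := E) EV V) (hμ : C.IsMomentMap μ)
    (hVμ : V ⊆ μ ⁻¹' {c})
    (p : V) (ξ : GroupLieAlgebra 𝓘(ℝ, EH) H) (v : EV) :
    C.kform p ![fund (E := E) ξ (p : M),
      (mfderiv 𝓘(ℝ, EV) 𝓘(ℝ, E) (Subtype.val : V → M) p : EV →L[ℝ] E) v] = 0 := by
  have h1 : MDifferentiableAt 𝓘(ℝ, EV) 𝓘(ℝ, E) (Subtype.val : V → M) p :=
    (hV.2.1 p).mdifferentiableAt (by simp)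
  have h2 := ((hμ.2 ξ).1 (p : M)).hasMFDerivAt.comp p h1.hasMFDerivAt
  have e : (fun q => μ q ξ) ∘ (Subtype.val : V → M) = fun _ => c ξ := by
    funext q
    exact congrArg (fun F : GroupLieAlgebra 𝓘(ℝ, EH) H →L[ℝ] ℝ => F ξ) (hVμ q.2)
  rw [e] at h2
  have h3 := congrArg (fun D : EV →L[ℝ] ℝ => D v) (h2.mfderiv.symm.trans mfderiv_const)
  exact neg_eq_zero.1 (((hμ.2 ξ).2 (p : M) _).symm.trans h3)

/-- By equivariance and centrality of `c`, the moment map is constant on the orbit of `p`. -/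
theorem CalabiYau.kform_fund_fund [IsManifold 𝓘(ℝ, E) ∞ M] [LieGroup 𝓘(ℝ, EH) ∞ H]
    [ContMDiffSMul 𝓘(ℝ, EH) 𝓘(ℝ, E) ∞ H M] (hμ : C.IsMomentMap μ)
    (hc : ∀ (h : H) ξ, c (adj h ξ) = c ξ) {p : M} (hp : μ p = c)
    (ξ η : GroupLieAlgebra 𝓘(ℝ, EH) H) :
    C.kform p ![fund (E := E) ξ p, fund (E := E) η p] = 0 := by
  have h1 : HasMFDerivAt 𝓘(ℝ, E) 𝓘(ℝ, ℝ) (fun q => μ q ξ) ((1 : H) • p)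
      (mfderiv 𝓘(ℝ, E) 𝓘(ℝ, ℝ) (fun q => μ q ξ) p : E →L[ℝ] ℝ) := by
    rw [one_smul]; exact ((hμ.2 ξ).1 p).hasMFDerivAt
  have h2 := HasMFDerivAt.comp (f := fun k : H => k • p) (1 : H) h1
    (mdifferentiableAt_smul_right (EH := EH) 1 p).hasMFDerivAt
  have e : (fun q => μ q ξ) ∘ (fun k : H => k • p) = fun _ => c ξ := by
    funext k
    change μ (k • p) ξ = c ξ
    rw [hμ.1, hp, hc]
  rw [e] at h2
  have h3 := congrArg (fun D : EH →L[ℝ] ℝ => D η) (h2.mfderiv.symm.trans mfderiv_const)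
  exact neg_eq_zero.1 (((hμ.2 ξ).2 p (fund (E := E) η p)).symm.trans h3)

end TangentSpaces

/-! ### The image of the differential is Lagrangian, and its phase. -/

section OrbitDifferential

open Set Filter Topology

variable {n : ℕ} {E : Type*} [NormedAddCommGroup E] [NormedSpace ℂ E]
  {M : Type*} [TopologicalSpace M] [ChartedSpace E M] (C : CalabiYau n E M)
  {EH : Type*} [NormedAddCommGroup EH] [NormedSpace ℝ EH]
  {H : Type*} [TopologicalSpace H] [ChartedSpace EH H] [Group H] [MulAction H M]
  {EV : Type*} [NormedAddCommGroup EV] [NormedSpace ℝ EV]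
  {V : Set M} [ChartedSpace EV V]
  {EQ : Type*} [NormedAddCommGroup EQ] [NormedSpace ℝ EQ]

variable (EH H) in
/-- The map `(w, v) ↦ ξ^#_p + v`, where `ξ` induces the tangent vector `w` of `H / K`. -/
def IsOrbitDifferential (p : V) (G : EQ × EV →ₗ[ℝ] E) : Prop :=
  ∀ w, ∃ ξ : GroupLieAlgebra 𝓘(ℝ, EH) H,
    (∀ v, G (w, v) = fund (E := E) ξ (p : M) +
      (mfderiv 𝓘(ℝ, EV) 𝓘(ℝ, E) (Subtype.val : V → M) p : EV →L[ℝ] E) v) ∧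
    (fund (E := E) ξ (p : M) = (0 : E) → w = 0)

/-- The `ξ` attached to `w = 0` need not be zero, but by linearity at `v = 0` its fundamental field
vanishes at `p`. -/
theorem IsOrbitDifferential.apply_snd {p : V} {G : EQ × EV →ₗ[ℝ] E}
    (hG : IsOrbitDifferential EH H p G) (v : EV) :
    G (0, v) = (mfderiv 𝓘(ℝ, EV) 𝓘(ℝ, E) (Subtype.val : V → M) p : EV →L[ℝ] E) v := by
  obtain ⟨ξ, hξ, -⟩ := hG 0
  let B : EV →L[ℝ] E := mfderiv 𝓘(ℝ, EV) 𝓘(ℝ, E) (Subtype.val : V → M) p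
  let x : E := fund (E := E) ξ (p : M)
  have h1 : G (0, 0) = x + B 0 := hξ 0
  have h2 : G (0, v) = x + B v := hξ v
  rw [Prod.mk_zero_zero, map_zero, map_zero, add_zero] at h1
  rw [← h1, zero_add] at h2
  exact h2

/-- `hξ` is condition (ii). On the kernel the fundamental vector is tangent to `V`, hence zero, so
`w = 0`; then `v = 0` because `V` is immersed. -/
theorem IsOrbitDifferential.injective {p : V} {G : EQ × EV →ₗ[ℝ] E}
    (hG : IsOrbitDifferential EH H p G) (hV : IsSubmanifold (E := E) EV V)
    (hξ : ∀ ξ : GroupLieAlgebra 𝓘(ℝ, EH) H, fund (E := E) ξ (p : M) ∈ tangent (E := E) EV V p →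
      fund (E := E) ξ (p : M) = (0 : E)) :
    Function.Injective G := by
  refine (injective_iff_map_eq_zero G).2 ?_
  rintro ⟨w, v⟩ h0
  obtain ⟨ξ, h1, h2⟩ := hG w
  let B : EV →L[ℝ] E := mfderiv 𝓘(ℝ, EV) 𝓘(ℝ, E) (Subtype.val : V → M) p
  let x : E := fund (E := E) ξ (p : M)
  have h3 : x + B v = 0 := (h1 v).symm.trans h0
  have h4 : B (-v) = x := by rw [map_neg]; exact (eq_neg_of_add_eq_zero_left h3).symm
  have hw : w = 0 := h2 (hξ ξ ⟨-v, h4⟩)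
  subst hw
  have h5 : B v = B 0 := by rw [map_zero]; exact (hG.apply_snd v).symm.trans h0
  have h6 : v = 0 := hV.2.2 p h5
  rw [h6, Prod.mk_zero_zero]

/-- Each kind of pair has its own reason: `μ` is constant on the orbit, `μ` is constant on `V`, and
`V` is isotropic. -/
theorem IsOrbitDifferential.kform_eq_zero [IsManifold 𝓘(ℝ, E) ∞ M] [LieGroup 𝓘(ℝ, EH) ∞ H]
    [ContMDiffSMul 𝓘(ℝ, EH) 𝓘(ℝ, E) ∞ H M]
    {p : V} {G : EQ × EV →ₗ[ℝ] E}
    (hG : IsOrbitDifferential EH H p G) (hV : IsSubmanifold (E := E) EV V)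
    {μ : M → (GroupLieAlgebra 𝓘(ℝ, EH) H →L[ℝ] ℝ)} (hμ : C.IsMomentMap μ)
    {c : GroupLieAlgebra 𝓘(ℝ, EH) H →L[ℝ] ℝ} (hc : ∀ (h : H) ξ, c (adj h ξ) = c ξ)
    (hVμ : V ⊆ μ ⁻¹' {c})
    (hiso : ∀ u ∈ tangent (E := E) EV V p, ∀ v ∈ tangent (E := E) EV V p, C.kform p ![u, v] = 0)
    (z z' : EQ × EV) : C.kform p ![G z, G z'] = 0 := by
  obtain ⟨w, v⟩ := z
  obtain ⟨w', v'⟩ := z'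
  obtain ⟨ξ, h1, -⟩ := hG w
  obtain ⟨η, h2, -⟩ := hG w'
  let B : EV →L[ℝ] E := mfderiv 𝓘(ℝ, EV) 𝓘(ℝ, E) (Subtype.val : V → M) p
  let x : E := fund (E := E) ξ (p : M)
  let y : E := fund (E := E) η (p : M)
  let σ := toBilin (E := E) (C.kform (p : M))
  have e1 : G (w, v) = x + B v := h1 v
  have e2 : G (w', v') = y + B v' := h2 v'
  have f1 : σ x y = 0 := C.kform_fund_fund hμ hc (hVμ p.2) ξ η
  have f2 : σ x (B v') = 0 := C.kform_fund_tangent hV hμ hVμ p ξ v'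
  have f3 : σ (B v) y = 0 := by
    have h3 : σ y (B v) = 0 := C.kform_fund_tangent hV hμ hVμ p η v
    have h4 : σ (B v) y = - σ y (B v) := toBilin_swap (E := E) _ _ _
    rw [h4, h3, neg_zero]
  have f4 : σ (B v) (B v') = 0 := hiso _ ⟨v, rfl⟩ _ ⟨v', rfl⟩
  change σ (G (w, v)) (G (w', v')) = 0
  rw [e1, e2, map_add, map_add, LinearMap.add_apply, LinearMap.add_apply, f1, f2, f3, f4]
  simp

/-- The phase of the holomorphic volume form on the image of the differential of the orbit map. -/
theorem IsOrbitDifferential.exists_eq_toCircle_mul [FiniteDimensional ℂ E] [FiniteDimensional ℝ EQ]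
    [FiniteDimensional ℝ EV] {p : V} {G : EQ × EV →ₗ[ℝ] E}
    (hG : IsOrbitDifferential EH H p G) (hV : IsSubmanifold (E := E) EV V)
    (hinj : Function.Injective G) (hiso : ∀ z z', C.kform p ![G z, G z'] = 0)
    (hdim : Module.finrank ℝ EQ + Module.finrank ℝ EV = n)
    {EL : Type*} [NormedAddCommGroup EL] [NormedSpace ℝ EL] [FiniteDimensional ℝ EL]
    {L : Set M} [ChartedSpace EL L] (hLag : C.IsLagrangian 𝓘(ℝ, EL) (Subtype.val : L → M))
    (hpL : (p : M) ∈ L) (hle : tangent (E := E) EV V p ≤ tangent EL L ⟨p, hpL⟩)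
    (hperp : ∀ ξ : GroupLieAlgebra 𝓘(ℝ, EH) H,
      fund ξ (p : M) ∈ C.perp p (tangent EL L ⟨p, hpL⟩) ⊔ tangent EV V p)
    {t : Real.Angle} {ν : EL [⋀^Fin n]→L[ℝ] ℝ}
    (hν : C.IsVolumeAt 𝓘(ℝ, EL) (Subtype.val : L → M) ⟨p, hpL⟩ ν)
    (hνt : C.PullbackEq 𝓘(ℝ, EL) (Subtype.val : L → M) ⟨p, hpL⟩ t ν) (z : Fin n → EQ × EV) :
    ∃ r : ℝ, r ^ 2 = Matrix.det (Matrix.of fun i j =>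
        C.kform p ![G (z i), Complex.I • G (z j)]) ∧
      C.vform p (fun i => G (z i)) =
        ((((-(Real.pi / 2 * Module.finrank ℝ EQ) : ℝ) : Real.Angle) + t).toCircle : ℂ) * r := by
  let B : EV →L[ℝ] E := mfderiv 𝓘(ℝ, EV) 𝓘(ℝ, E) (Subtype.val : V → M) p
  let j : EL →L[ℝ] E := mfderiv 𝓘(ℝ, EL) 𝓘(ℝ, E) (Subtype.val : L → M) ⟨p, hpL⟩
  have hj : Function.Injective j := hLag.1.2 ⟨p, hpL⟩
  have hB : Function.Injective B := hV.2.2 p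
  have hrB : Module.finrank ℝ (LinearMap.range B.toLinearMap) = Module.finrank ℝ EV :=
    LinearMap.finrank_range_of_inj hB
  refine exists_eq_toCircle_mul_of_perp C.finrank_eq (C.kform (p : M)) (C.kform_cplx (p : M))
    (C.kform_pos (p : M)) (C.vform (p : M)) (LinearMap.range j.toLinearMap)
    (LinearMap.range B.toLinearMap) (LinearMap.range G) ?_ ?_ ?_ ?_ hle ?_ ?_ ?_ t ?_ _
    fun i => ⟨z i, rfl⟩
  · exact (LinearMap.finrank_range_of_inj hj).trans hLag.2.1
  · rintro _ ⟨u, rfl⟩ _ ⟨v, rfl⟩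
    exact hLag.2.2 ⟨p, hpL⟩ u v
  · rw [LinearMap.finrank_range_of_inj hinj, Module.finrank_prod, hdim]
  · rintro _ ⟨u, rfl⟩ _ ⟨v, rfl⟩
    exact hiso u v
  · rintro _ ⟨v, rfl⟩
    exact ⟨(0, v), hG.apply_snd v⟩
  · rintro _ ⟨⟨w, v⟩, rfl⟩
    obtain ⟨ξ, hξ, -⟩ := hG w
    -- Condition (i): the part of the fundamental vector tangent to `V` is absorbed into the
    -- `V`-component, leaving a vector normal to `L`.
    obtain ⟨k, hk, b, hb, hkb⟩ := Submodule.mem_sup.1 (hperp ξ)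
    obtain ⟨v', rfl⟩ := hb
    let x : E := fund (E := E) ξ (p : M)
    let k' : E := k
    let v'' : EV := v'
    have h1 : G (w, v) = x + B v := hξ v
    have h2 : k' + B v'' = x := hkb
    refine ⟨k', B v'' + B v, fun l hl => hk l hl, ⟨v'' + v, B.map_add _ _⟩, ?_⟩
    rw [h1, ← h2, add_assoc]
  · rw [hrB, hdim]
  · intro l hl
    choose u hu using hl
    obtain rfl : (fun i => j (u i)) = l := funext hu
    exact ⟨ν u, hν u, hνt u⟩

end OrbitDifferential

/-! ### Pointwise phases and the orientation they determine. -/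

section Angles

open Set Filter Topology

variable {n : ℕ} {E : Type*} [NormedAddCommGroup E] [NormedSpace ℂ E]
  {M : Type*} [TopologicalSpace M] [ChartedSpace E M] (C : CalabiYau n E M)
  {F : Type*} [NormedAddCommGroup F] [NormedSpace ℝ F]
  {B : Type*} [TopologicalSpace B] (J : ModelWithCorners ℝ F B)
  {N : Type*} [TopologicalSpace N] [ChartedSpace B N]

/-- The pullback of the holomorphic volume form. -/
def CalabiYau.pullform (f : N → M) (x : N) : TangentSpace J x [⋀^Fin n]→L[ℝ] ℂ :=
  (C.rform (f x)).compContinuousLinearMap (mfderiv J 𝓘(ℝ, E) f x)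

/-- The real part of `e ^ (- √-1 t) f^* Ω`. -/
def CalabiYau.angleForm (f : N → M) (t : Real.Angle) (x : N) :
    TangentSpace J x [⋀^Fin n]→L[ℝ] ℝ :=
  Complex.reCLM.compContinuousAlternatingMap
    (conj (t.toCircle : ℂ) • (C.pullform J f x : F [⋀^Fin n]→L[ℝ] ℂ))

variable {J C}

/-- Rotating back by the phase leaves a real number, so taking the real part loses nothing. -/
theorem CalabiYau.angleForm_eq {f : N → M} {t : Real.Angle} {x : N} {v : Fin n → F} {r : ℝ}
    (h : C.vform (f x) (fun i => (mfderiv J 𝓘(ℝ, E) f x : F →L[ℝ] E) (v i)) =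
      (t.toCircle : ℂ) * r) : C.angleForm J f t x v = r := by
  have h1 : C.angleForm J f t x v = (conj (t.toCircle : ℂ) *
      C.vform (f x) (fun i => (mfderiv J 𝓘(ℝ, E) f x : F →L[ℝ] E) (v i))).re := rfl
  rw [h1, h, ← mul_assoc, mul_comm (conj _), Complex.mul_conj, Circle.normSq_coe]
  simp

variable (C J) in
/-- The condition on the values of `Ω` that says that `f^* Ω = ± e ^ (√-1 t) vol` at `x`. -/
def CalabiYau.HasPhaseAt (f : N → M) (x : N) (t : Real.Angle) : Prop :=
  ∀ v : Fin n → F, ∃ r : ℝ, r ^ 2 = Matrix.det (Matrix.of fun i j =>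
      C.metric (f x) ((mfderiv J 𝓘(ℝ, E) f x : F →L[ℝ] E) (v i))
        ((mfderiv J 𝓘(ℝ, E) f x : F →L[ℝ] E) (v j))) ∧
    C.vform (f x) (fun i => (mfderiv J 𝓘(ℝ, E) f x : F →L[ℝ] E) (v i)) = (t.toCircle : ℂ) * r

/-- The numbers `r` are given separately for each family `v`; as values of `angleForm` they fit
together to an alternating form. -/
theorem CalabiYau.HasPhaseAt.isVolumeAt {f : N → M} {x : N} {t : Real.Angle}
    (h : C.HasPhaseAt J f x t) : C.IsVolumeAt J f x (C.angleForm J f t x) := by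
  intro v
  obtain ⟨r, h1, h2⟩ := h v
  exact (congrArg (· ^ 2) (C.angleForm_eq h2)).trans h1

theorem CalabiYau.HasPhaseAt.pullbackEq {f : N → M} {x : N} {t : Real.Angle}
    (h : C.HasPhaseAt J f x t) : C.PullbackEq J f x t (C.angleForm J f t x) := by
  intro v
  obtain ⟨r, h1, h2⟩ := h v
  exact h2.trans (congrArg (fun s : ℝ => (t.toCircle : ℂ) * s) (C.angleForm_eq h2).symm)

theorem CalabiYau.HasPhaseAt.hasAngleAt {f : N → M} {x : N} {t : Real.Angle}
    (h : C.HasPhaseAt J f x t) : C.HasAngleAt J f x t :=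
  ⟨_, h.isVolumeAt, h.pullbackEq⟩

variable [IsManifold 𝓘(ℂ, E) ω M] [J.Boundaryless] [IsManifold J ∞ N]

theorem CalabiYau.continuousOn_chartForm_pullform {f : N → M} (hf : ContMDiff J 𝓘(ℝ, E) ∞ f)
    (x₀ : N) : ContinuousOn (chartForm J (C.pullform J f) x₀) (extChartAt J x₀).target := by
  have : IsManifold 𝓘(ℝ, E) ∞ M := isManifold_real
  have : IsManifold 𝓘(ℝ, E) 1 M := IsManifold.of_le (n := ∞) (by simp)
  have : IsManifold J 1 N := IsManifold.of_le (n := ∞) (by simp)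
  intro y₀ hy₀
  let φ := extChartAt J x₀
  let g : F → M := f ∘ φ.symm
  let ψ := extChartAt 𝓘(ℝ, E) (g y₀)
  let Ψ : F → E := ψ ∘ g
  have htgt : ∀ᶠ y in 𝓝 y₀, y ∈ φ.target := extChartAt_target_mem_nhds' hy₀
  have hg : ContMDiffAt 𝓘(ℝ, F) 𝓘(ℝ, E) ∞ g y₀ :=
    hf.contMDiffAt.comp y₀ ((contMDiffOn_extChartAt_symm x₀).contMDiffAt
      (extChartAt_target_mem_nhds' hy₀))
  have hΨ : ContDiffAt ℝ ∞ Ψ y₀ := by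
    rw [← contMDiffAt_iff_contDiffAt]
    exact ContMDiffAt.comp y₀ contMDiffAt_extChartAt hg
  have hsrc : ∀ᶠ y in 𝓝 y₀, g y ∈ ψ.source :=
    hg.continuousAt.eventually_mem (extChartAt_source_mem_nhds _)
  have hgd : ∀ᶠ y in 𝓝 y₀, HasMFDerivAt 𝓘(ℝ, F) 𝓘(ℝ, E) g y
      ((mfderiv J 𝓘(ℝ, E) f (φ.symm y) : F →L[ℝ] E).comp
        (mfderiv 𝓘(ℝ, F) J φ.symm y : F →L[ℝ] F)) := by
    filter_upwards [htgt] with y hy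
    exact ((hf (φ.symm y)).mdifferentiableAt (by simp)).hasMFDerivAt.comp y
      (mdifferentiableAt_extChartAt_symm hy).hasMFDerivAt
  have hα : DifferentiableAt ℝ (chartForm 𝓘(ℝ, E) C.rform (g y₀)) (Ψ y₀) :=
    (C.differentiableOn_chartForm_rform (g y₀)).differentiableAt
      (extChartAt_target_mem_nhds (g y₀))
  have h1 : DifferentiableAt ℝ (fun y => chartForm 𝓘(ℝ, E) C.rform (g y₀) (Ψ y)) y₀ :=
    DifferentiableAt.comp (f := Ψ) y₀ hα (hΨ.differentiableAt (by simp))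
  have h2 : DifferentiableAt ℝ (fderiv ℝ Ψ) y₀ :=
    (hΨ.fderiv_right (m := ∞) (by simp)).differentiableAt (by simp)
  have h3 := (h1.continuousAlternatingMapCompContinuousLinearMap h2).continuousAt
  refine (h3.congr ?_).continuousWithinAt
  filter_upwards [htgt, hsrc, hgd] with y hy hys hyg
  ext v
  have h4 := chartForm_mfderiv C.rform (g y₀) hyg.mdifferentiableAt hys v
  have h5 : ∀ v : F, fderiv ℝ Ψ y v = mfderiv 𝓘(ℝ, F) 𝓘(ℝ, E) (ψ ∘ g) y v := fun v =>
    (congrArg (fun D : F →L[ℝ] E => D v) mfderiv_eq_fderiv).symm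
  have h6 : chartForm 𝓘(ℝ, E) C.rform (g y₀) (Ψ y) (fun i => fderiv ℝ Ψ y (v i)) =
      C.rform (g y) (fun i => mfderiv 𝓘(ℝ, F) 𝓘(ℝ, E) g y (v i)) := by
    simp only [h5]
    exact h4
  refine h6.trans (form_congr C.rform rfl (funext fun i => ?_))
  exact congrArg (fun D : F →L[ℝ] E => D (v i)) hyg.mfderiv

/-- The orientation is forced: the volume form is the real part of the pullback of `Ω` rotated back
by the angle, and it is continuous as soon as the unit complex number of the angle is. -/
theorem CalabiYau.isAngleOn_of_continuousOn {f : N → M} (hf : ContMDiff J 𝓘(ℝ, E) ∞ f)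
    {W : Set N} (hW : IsOpen W) {θ : N → Real.Angle}
    (hθ : ContinuousOn (fun x => ((θ x).toCircle : ℂ)) W)
    (h : ∀ x ∈ W, C.HasPhaseAt J f x (θ x)) : C.IsAngleOn J f θ W := by
  refine ⟨hW, fun x => C.angleForm J f (θ x) x, fun x₀ => ?_,
    fun x hx => ⟨(h x hx).isVolumeAt, (h x hx).pullbackEq⟩⟩
  let φ := extChartAt J x₀
  have h1 : ContinuousOn (fun y => conj ((θ (φ.symm y)).toCircle : ℂ))
      (φ.target ∩ φ.symm ⁻¹' W) :=
    Complex.continuous_conj.comp_continuousOn (ContinuousOn.comp (f := φ.symm) hθ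
      ((continuousOn_extChartAt_symm x₀).mono inter_subset_left) fun y hy => hy.2)
  have h2 : ContinuousOn (chartForm J (C.pullform J f) x₀) (φ.target ∩ φ.symm ⁻¹' W) :=
    (C.continuousOn_chartForm_pullform hf x₀).mono inter_subset_left
  exact (ContinuousLinearMap.compContinuousAlternatingMapCLM ℝ F ℂ ℝ (Fin n)
    Complex.reCLM).continuous.comp_continuousOn (h1.smul h2)

end Angles

/-! ### Continuity of Lagrangian angles. -/

section AngleContinuity

open Set Filter Topology

/-- A kernel vector `x` of the Gram matrix makes `∑ j, x j • v j` orthogonal to every `v i`, hence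
to itself, so this combination vanishes. -/
theorem det_gram_ne_zero {E : Type*} [NormedAddCommGroup E] [NormedSpace ℝ E]
    {σ : E →ₗ[ℝ] E →ₗ[ℝ] ℝ} (hσ : ∀ u, u ≠ 0 → 0 < σ u u) {n : ℕ} {v : Fin n → E}
    (hv : LinearIndependent ℝ v) : Matrix.det (Matrix.of fun i j => σ (v i) (v j)) ≠ 0 := by
  intro h
  obtain ⟨x, hx, h0⟩ := Matrix.exists_mulVec_eq_zero_iff.2 h
  have h1 : ∀ i, σ (v i) (∑ j, x j • v j) = 0 := fun i => by
    have h2 := congrFun h0 i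
    simp only [Matrix.mulVec, dotProduct, Matrix.of_apply, Pi.zero_apply] at h2
    rw [map_sum, ← h2]
    refine Finset.sum_congr rfl fun j _ => ?_
    rw [map_smul, smul_eq_mul, mul_comm]
  have h2 : ∑ j, x j • v j = 0 := by
    by_contra hne
    have h3 := hσ _ hne
    have h4 : ∀ y, (∀ i, σ (v i) y = 0) → σ (∑ j, x j • v j) y = 0 := fun y hy => by
      rw [map_sum, LinearMap.sum_apply]
      refine Finset.sum_eq_zero fun i _ => ?_
      rw [map_smul, LinearMap.smul_apply, hy, smul_zero]
    exact h3.ne' (h4 _ h1)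
  exact hx (funext fun i => Fintype.linearIndependent_iff.1 hv x h2 i)

variable {n : ℕ} {E : Type*} [NormedAddCommGroup E] [NormedSpace ℂ E]
  {M : Type*} [TopologicalSpace M] [ChartedSpace E M]
  {C : CalabiYau n E M}
  {F : Type*} [NormedAddCommGroup F] [NormedSpace ℝ F]
  {B : Type*} [TopologicalSpace B] {J : ModelWithCorners ℝ F B}
  {N : Type*} [TopologicalSpace N] [ChartedSpace B N]

theorem CalabiYau.IsVolumeAt.ne_zero {f : N → M} {x : N} {ν : F [⋀^Fin n]→L[ℝ] ℝ}
    (h : C.IsVolumeAt J f x ν) (hf : Function.Injective (mfderiv J 𝓘(ℝ, E) f x))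
    (b : Module.Basis (Fin n) ℝ F) : ν b ≠ 0 := by
  intro h0
  let D : F →L[ℝ] E := mfderiv J 𝓘(ℝ, E) f x
  have hD : Function.Injective D := hf
  have h1 : ν b ^ 2 = _ := h b
  rw [h0, zero_pow two_ne_zero] at h1
  let I' : E →ₗ[ℝ] E := ((Complex.I • (LinearMap.id : E →ₗ[ℂ] E))).restrictScalars ℝ
  let σ : E →ₗ[ℝ] E →ₗ[ℝ] ℝ := (toBilin (E := E) (C.kform (f x))).compl₂ I'
  have hσ : ∀ u, u ≠ 0 → 0 < σ u u := fun u hu => C.kform_pos (f x) u hu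
  exact det_gram_ne_zero hσ (b.linearIndependent.map' D.toLinearMap (LinearMap.ker_eq_bot.2 hD))
    h1.symm

/-- Lagrangian angles are continuous. -/
theorem CalabiYau.IsAngleOn.continuousOn_toCircle [IsManifold 𝓘(ℂ, E) ω M]
    [FiniteDimensional ℝ F] [J.Boundaryless] [IsManifold J ∞ N] {f : N → M} {θ : N → Real.Angle} {W : Set N}
    (h : C.IsAngleOn J f θ W) (hf : IsImmersion J 𝓘(ℝ, E) f) (hn : Module.finrank ℝ F = n) :
    ContinuousOn (fun x => ((θ x).toCircle : ℂ)) W := by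
  have : IsManifold J 1 N := IsManifold.of_le (n := ∞) (by simp)
  obtain ⟨hW, ν, hν, hνW⟩ := h
  intro x₀ hx₀
  let φ := extChartAt J x₀
  let b := Module.finBasisOfFinrankEq ℝ F hn
  let b' : Fin n → F := fun i => (mfderiv J 𝓘(ℝ, F) (φ ∘ id) x₀ : F →L[ℝ] F) (b i)
  have hx0 : φ.symm (φ x₀) = x₀ := extChartAt_to_inv x₀
  -- The unit complex number of the angle is the quotient of the values of the pullback of `Ω` and
  -- of `ν` on a fixed coordinate frame. Both are continuous, and the denominator does not vanish
  -- near `x₀`.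
  have hne : chartForm J ν x₀ (φ x₀) b' ≠ 0 := by
    have h1 := chartForm_mfderiv ν x₀ (f := id) (x := x₀) mdifferentiableAt_id
      (mem_extChartAt_source x₀) b
    have h2 : mfderiv J J (id : N → N) x₀ = ContinuousLinearMap.id ℝ _ := mfderiv_id
    rw [h2] at h1
    have h3 : ν x₀ b ≠ 0 := CalabiYau.IsVolumeAt.ne_zero (hνW x₀ hx₀).1 (hf.2 x₀) b
    intro h4
    exact h3 (h1.symm.trans h4)
  have hnhds : φ.target ∩ φ.symm ⁻¹' W ∈ 𝓝 (φ x₀) := by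
    refine Filter.inter_mem (extChartAt_target_mem_nhds x₀) ?_
    refine (continuousAt_extChartAt_symm x₀).preimage_mem_nhds (hW.mem_nhds ?_)
    exact hx0.symm ▸ hx₀
  have hc1 : ContinuousAt (fun y => ((chartForm J ν x₀ y b' : ℝ) : ℂ)) (φ x₀) := by
    have h1 := (hν x₀).continuousAt hnhds
    have h2 : ContinuousAt (fun y => chartForm J ν x₀ y b') (φ x₀) :=
      ((ContinuousAlternatingMap.apply ℝ F ℝ b').continuous.continuousAt).comp h1
    exact Complex.continuous_ofReal.continuousAt.comp h2
  have hc2 : ContinuousAt (fun y => chartForm J (C.pullform J f) x₀ y b') (φ x₀) :=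
    ((ContinuousAlternatingMap.apply ℝ F ℂ b').continuous.continuousAt).comp
      ((C.continuousOn_chartForm_pullform hf.1 x₀).continuousAt (extChartAt_target_mem_nhds x₀))
  have hne' : ((chartForm J ν x₀ (φ x₀) b' : ℝ) : ℂ) ≠ 0 := Complex.ofReal_ne_zero.2 hne
  have hc3 := (hc2.div hc1 hne').comp (continuousAt_extChartAt (I := J) x₀)
  refine (hc3.congr ?_).continuousWithinAt
  have h5 : ∀ᶠ x in 𝓝 x₀, ((chartForm J ν x₀ (φ x) b' : ℝ) : ℂ) ≠ 0 :=
    (hc1.comp (continuousAt_extChartAt (I := J) x₀)).eventually_ne hne'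
  filter_upwards [h5, extChartAt_source_mem_nhds (I := J) x₀, hW.mem_nhds hx₀] with x hx hxs hxW
  have h6 : φ.symm (φ x) = x := φ.left_inv hxs
  simp only [Function.comp_apply]
  rw [Pi.div_apply, div_eq_iff hx]
  have h7 := (hνW (φ.symm (φ x)) (h6.symm ▸ hxW)).2
    (fun i => (mfderiv 𝓘(ℝ, F) J φ.symm (φ x) : F →L[ℝ] F) (b' i))
  exact h7.trans (congrArg (fun t : N => ((θ t).toCircle : ℂ) *
    ((chartForm J ν x₀ (φ x) b' : ℝ) : ℂ)) h6)

end AngleContinuity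

/-! ### Transport of the phase along the group. -/

section OrbitPhase

open Set Filter Topology

theorem toCircle_coe_eq_exp (x : ℝ) :
    ((x : Real.Angle).toCircle : ℂ) = Complex.exp (Complex.I * (x : ℂ)) := by
  rw [Real.Angle.toCircle_coe, Circle.coe_exp, mul_comm]

theorem mfderiv_smul_injective {E : Type*} [NormedAddCommGroup E] [NormedSpace ℝ E]
    {M : Type*} [TopologicalSpace M] [ChartedSpace E M]
    (EH : Type*) [NormedAddCommGroup EH] [NormedSpace ℝ EH]
    {H : Type*} [TopologicalSpace H] [ChartedSpace EH H] [Group H] [MulAction H M]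
    [ContMDiffSMul 𝓘(ℝ, EH) 𝓘(ℝ, E) ∞ H M] (h : H) (p : M) :
    Function.Injective (mfderiv 𝓘(ℝ, E) 𝓘(ℝ, E) (fun q : M => h • q) p : E →L[ℝ] E) := by
  let A' : E →L[ℝ] E := mfderiv 𝓘(ℝ, E) 𝓘(ℝ, E) (fun q : M => h⁻¹ • q) (h • p)
  refine Function.LeftInverse.injective (g := A') fun u => ?_
  have h1 := mfderiv_mul_smul EH h⁻¹ h p u
  rw [inv_mul_cancel, mfderiv_one_smul (E := E)] at h1
  exact h1.symm

variable {n : ℕ} {E : Type*} [NormedAddCommGroup E] [NormedSpace ℂ E]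
  {M : Type*} [TopologicalSpace M] [ChartedSpace E M] (C : CalabiYau n E M)
  {EH : Type*} [NormedAddCommGroup EH] [NormedSpace ℝ EH]
  {H : Type*} [TopologicalSpace H] [ChartedSpace EH H] [Group H] [MulAction H M]
  {EV : Type*} [NormedAddCommGroup EV] [NormedSpace ℝ EV]
  {V : Set M} [ChartedSpace EV V]
  {EQ : Type*} [NormedAddCommGroup EQ] [NormedSpace ℝ EQ]
  {K : Subgroup H} (hK : ∀ p ∈ V, MulAction.stabilizer H p = K) [ChartedSpace EQ (H ⧸ K)]

/-- The phase of the orbit map. -/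
theorem CalabiYau.hasPhaseAt_orbitMap (hI : ActsHolomorphically H M (E := E)) (h : H) (p : V)
    {G : EQ × EV →ₗ[ℝ] E}
    (hG : ∀ z, (mfderiv (𝓘(ℝ, EQ).prod 𝓘(ℝ, EV)) 𝓘(ℝ, E) (orbitMap K V hK) ((h : H ⧸ K), p) :
          EQ × EV →L[ℝ] E) z =
        (mfderiv 𝓘(ℝ, E) 𝓘(ℝ, E) (fun q : M => h • q) (p : M) : E →L[ℝ] E) (G z))
    (hω : ∀ v : Fin 2 → E, C.kform (h • (p : M))
      (fun i => mfderiv 𝓘(ℝ, E) 𝓘(ℝ, E) (fun q : M => h • q) (p : M) (v i)) = C.kform p v)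
    {c : ℂ} (hΩ : ∀ v : Fin n → E, C.vform (h • (p : M))
      (fun i => mfderiv 𝓘(ℝ, E) 𝓘(ℝ, E) (fun q : M => h • q) (p : M) (v i)) = c * C.vform p v)
    {s t : Real.Angle} (hst : (t.toCircle : ℂ) = c * (s.toCircle : ℂ))
    (hs : ∀ z : Fin n → EQ × EV, ∃ r : ℝ, r ^ 2 = Matrix.det (Matrix.of fun i j =>
        C.kform p ![G (z i), Complex.I • G (z j)]) ∧
      C.vform p (fun i => G (z i)) = (s.toCircle : ℂ) * r) :
    C.HasPhaseAt (𝓘(ℝ, EQ).prod 𝓘(ℝ, EV)) (orbitMap K V hK) ((h : H ⧸ K), p) t := by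
  intro z
  obtain ⟨r, h1, h2⟩ := hs z
  let A : E →L[ℝ] E := mfderiv 𝓘(ℝ, E) 𝓘(ℝ, E) (fun q : M => h • q) (p : M)
  have hA : ∀ u : E, A (Complex.I • u) = Complex.I • A u := hI h p
  -- Translation by `h` is an isometry, so the volume `r` is kept; only the phase is multiplied by
  -- `c`.
  refine ⟨r, h1.trans (congrArg Matrix.det ?_), ?_⟩
  · ext i j
    refine (hω ![G (z i), Complex.I • G (z j)]).symm.trans ?_
    refine form_congr C.kform rfl ?_
    have h3 : (fun k => A (![G (z i), Complex.I • G (z j)] k)) = ![A (G (z i)),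
        Complex.I • A (G (z j))] := by
      rw [comp_cons_two, hA]
    refine h3.trans ?_
    exact congrArg₂ (fun u v : E => ![u, Complex.I • v]) (hG (z i)).symm (hG (z j)).symm
  · rw [hst, mul_assoc, ← h2, ← hΩ]
    refine form_congr C.vform rfl (funext fun i => ?_)
    exact hG (z i)

end OrbitPhase

end LagAngle

end

/-! ### The main theorem. -/

theorem theorem4p5
    -- the connected Calabi–Yau manifold `M`
    {n : ℕ} {E : Type*} [NormedAddCommGroup E] [NormedSpace ℂ E] [FiniteDimensional ℂ E]
    {M : Type*} [TopologicalSpace M] [T2Space M] [ConnectedSpace M] [ChartedSpace E M]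
    [IsManifold 𝓘(ℂ, E) ω M] (C : LagAngle.CalabiYau n E M)
    -- the connected Lie group `H`, acting smoothly on `M`, preserving the complex structure,
    -- with moment map `μ`
    {EH : Type*} [NormedAddCommGroup EH] [NormedSpace ℝ EH] [FiniteDimensional ℝ EH]
    {H : Type*} [TopologicalSpace H] [ConnectedSpace H] [ChartedSpace EH H] [Group H]
    [LieGroup 𝓘(ℝ, EH) ∞ H]
    [MulAction H M] [ContMDiffSMul 𝓘(ℝ, EH) 𝓘(ℝ, E) ∞ H M]
    (hI : ∀ (h : H) (p : M) (v : TangentSpace 𝓘(ℝ, E) p),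
      mfderiv 𝓘(ℝ, E) 𝓘(ℝ, E) (fun q : M => h • q) p (LagAngle.cplx p v) =
        LagAngle.cplx (h • p) (mfderiv 𝓘(ℝ, E) 𝓘(ℝ, E) (fun q : M => h • q) p v))
    (μ : M → (GroupLieAlgebra 𝓘(ℝ, EH) H →L[ℝ] ℝ)) (hμ : C.IsMomentMap μ)
    -- the Lagrangian submanifold `L` with a local Lagrangian angle `θ`, on the open set `U` of `L`
    {EL : Type*} [NormedAddCommGroup EL] [NormedSpace ℝ EL] [FiniteDimensional ℝ EL]
    (L : Set M) [ChartedSpace EL L] (hL : LagAngle.IsSubmanifold (E := E) EL L)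
    (hLag : C.IsLagrangian 𝓘(ℝ, EL) (Subtype.val : L → M))
    (U : Set L) (θ : L → Real.Angle) (hθ : C.IsAngleOn 𝓘(ℝ, EL) (Subtype.val : L → M) θ U)
    -- the submanifold `V` of `M` in `μ⁻¹(c) ∩ L`, with `c` central
    (c : GroupLieAlgebra 𝓘(ℝ, EH) H →L[ℝ] ℝ) (hc : ∀ (h : H) ξ, c (LagAngle.adj h ξ) = c ξ)
    {EV : Type*} [NormedAddCommGroup EV] [NormedSpace ℝ EV] [FiniteDimensional ℝ EV]
    (V : Set M) [ChartedSpace EV V] (hV : LagAngle.IsSubmanifold (E := E) EV V)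
    (hVμ : V ⊆ μ ⁻¹' {c}) (hVL : V ⊆ L)
    -- the constant isotropy group `K`, and `H / K` with its standard smooth structure, the one for
    -- which the projection is a submersion
    (K : Subgroup H) (hK : ∀ p ∈ V, MulAction.stabilizer H p = K)
    {EQ : Type*} [NormedAddCommGroup EQ] [NormedSpace ℝ EQ] [FiniteDimensional ℝ EQ]
    [ChartedSpace EQ (H ⧸ K)] [IsManifold 𝓘(ℝ, EQ) ∞ (H ⧸ K)]
    (hQ : LagAngle.IsSubmersion 𝓘(ℝ, EH) 𝓘(ℝ, EQ) (QuotientGroup.mk : H → H ⧸ K))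
    (hdim : Module.finrank ℝ EQ + Module.finrank ℝ EV = n)
    -- the generalized perpendicularity condition
    (hperp : ∀ (p : M) (hp : p ∈ V) (ξ : GroupLieAlgebra 𝓘(ℝ, EH) H),
      LagAngle.fund ξ p ∈
          C.perp p (LagAngle.tangent EL L ⟨p, hVL hp⟩) ⊔ LagAngle.tangent EV V ⟨p, hp⟩ ∧
        ¬ (LagAngle.fund ξ p ∈ LagAngle.tangent (E := E) EV V ⟨p, hp⟩ ∧
          LagAngle.fund ξ p ≠ (0 : TangentSpace 𝓘(ℝ, E) p))) :
    -- `φ` is a Lagrangian immersion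
    C.IsLagrangian (𝓘(ℝ, EQ).prod 𝓘(ℝ, EV)) (LagAngle.orbitMap K V hK) ∧
    -- every `h` is a product of exponentials
    (∀ h : H, ∃ η : List (GroupLieAlgebra 𝓘(ℝ, EH) H), h = (η.map LagAngle.lieExp).prod) ∧
    -- there is exactly one `a_H` with its defining property, and
    ∃ a : GroupLieAlgebra 𝓘(ℝ, EH) H →L[ℝ] ℝ, C.IsPhase a ∧ (∀ b, C.IsPhase b → b = a) ∧
    -- `φ^* Ω = ± e ^ (√-1 θ_c) vol` for every choice of the `η_i`
    (∀ (h : H) (η : List (GroupLieAlgebra 𝓘(ℝ, EH) H)), h = (η.map LagAngle.lieExp).prod →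
      ∀ (p : M) (hp : p ∈ V), (⟨p, hVL hp⟩ : L) ∈ U →
        C.HasAngleAt (𝓘(ℝ, EQ).prod 𝓘(ℝ, EV)) (LagAngle.orbitMap K V hK) ((h : H ⧸ K), ⟨p, hp⟩)
          (((a η.sum - Real.pi / 2 * Module.finrank ℝ EQ : ℝ) : Real.Angle) +
            θ ⟨p, hVL hp⟩)) ∧
    -- and, locally, `θ_c` is a Lagrangian angle of `φ` for some orientation
    (∀ (h₀ : H) (p₀ : M) (hp₀ : p₀ ∈ V), (⟨p₀, hVL hp₀⟩ : L) ∈ U →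
      ∃ (W : Set ((H ⧸ K) × V)) (θc : (H ⧸ K) × V → Real.Angle),
        ((h₀ : H ⧸ K), (⟨p₀, hp₀⟩ : V)) ∈ W ∧
        (∀ x ∈ W, (⟨x.2, hVL x.2.2⟩ : L) ∈ U ∧
          ∃ (h : H) (η : List (GroupLieAlgebra 𝓘(ℝ, EH) H)),
            x.1 = (h : H ⧸ K) ∧ h = (η.map LagAngle.lieExp).prod ∧
            θc x = ((a η.sum - Real.pi / 2 * Module.finrank ℝ EQ : ℝ) : Real.Angle) +
              θ ⟨x.2, hVL x.2.2⟩) ∧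
        C.IsAngleOn (𝓘(ℝ, EQ).prod 𝓘(ℝ, EV)) (LagAngle.orbitMap K V hK) θc W) := by
  have : IsManifold 𝓘(ℝ, E) ∞ M := LagAngle.isManifold_real
  have : FiniteDimensional ℝ E := FiniteDimensional.complexToReal E
  have : IsManifold 𝓘(ℝ, EV) ∞ V := hV.1
  have : IsManifold 𝓘(ℝ, EL) ∞ L := hL.1
  obtain ⟨f, a, hfc, hfΩ, hfe⟩ := C.exists_character hI hμ
  have hle := LagAngle.tangent_le hL hV hVL
  have hiso : ∀ p : V, ∀ u ∈ LagAngle.tangent (E := E) EV V p,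
      ∀ v ∈ LagAngle.tangent (E := E) EV V p, C.kform p ![u, v] = 0 := by
    intro p u hu v hv
    obtain ⟨u', rfl⟩ := hle p hu
    obtain ⟨v', rfl⟩ := hle p hv
    exact hLag.2.2 _ u' v'
  have hsm := LagAngle.contMDiff_orbitMap (K := K) hK hV hQ
  have hdiff : ∀ (h : H) (p : V), ∃ G : EQ × EV →ₗ[ℝ] E,
      (∀ z, (mfderiv (𝓘(ℝ, EQ).prod 𝓘(ℝ, EV)) 𝓘(ℝ, E) (LagAngle.orbitMap K V hK)
          ((h : H ⧸ K), p) : EQ × EV →L[ℝ] E) z =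
        (mfderiv 𝓘(ℝ, E) 𝓘(ℝ, E) (fun q : M => h • q) (p : M) : E →L[ℝ] E) (G z)) ∧
      LagAngle.IsOrbitDifferential EH H p G ∧ Function.Injective G ∧
      ∀ z z', C.kform p ![G z, G z'] = 0 := by
    intro h p
    obtain ⟨G, hG, hG'⟩ := LagAngle.exists_mfderiv_orbitMap hK hV hQ h p
    have hG'' : LagAngle.IsOrbitDifferential EH H p G := hG'
    refine ⟨G, hG, hG'', hG''.injective hV fun ξ hξ => ?_,
      hG''.kform_eq_zero C hV hμ hc hVμ (hiso p)⟩
    by_contra hne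
    exact (hperp p p.2 ξ).2 ⟨hξ, hne⟩
  -- The angle `t` enters only through its unit complex number, so the statement applies to every
  -- expression of `h` as a product and to the local angle.
  have hphase : ∀ (h : H) (p : V), (⟨p, hVL p.2⟩ : L) ∈ U → ∀ t : Real.Angle,
      (t.toCircle : ℂ) = f h * ((((-(Real.pi / 2 * Module.finrank ℝ EQ) : ℝ) : Real.Angle) +
        θ ⟨p, hVL p.2⟩).toCircle : ℂ) →
      C.HasPhaseAt (𝓘(ℝ, EQ).prod 𝓘(ℝ, EV)) (LagAngle.orbitMap K V hK) ((h : H ⧸ K), p) t := by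
    intro h p hp t ht
    obtain ⟨G, hG, hG', hinj, hiso'⟩ := hdiff h p
    obtain ⟨-, ν, -, hν⟩ := hθ
    exact C.hasPhaseAt_orbitMap hK hI h p hG (C.kform_smul hμ h p) (hfΩ h p) ht fun z =>
      hG'.exists_eq_toCircle_mul C hV hinj hiso' hdim hLag (hVL p.2) (hle p)
        (fun ξ => (hperp p p.2 ξ).1) (hν _ hp).1 (hν _ hp).2 z
  -- Different expressions of `h` can give different sums, but the resulting unit complex number
  -- depends only on the character at `h`.
  have hcirc : ∀ (h : H) (η : List (GroupLieAlgebra 𝓘(ℝ, EH) H)),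
      h = (η.map LagAngle.lieExp).prod → ∀ t : Real.Angle,
      ((((a η.sum - Real.pi / 2 * Module.finrank ℝ EQ : ℝ) : Real.Angle) + t).toCircle : ℂ) =
        f h * ((((-(Real.pi / 2 * Module.finrank ℝ EQ) : ℝ) : Real.Angle) + t).toCircle : ℂ) := by
    rintro h η rfl t
    rw [hfe, ← LagAngle.toCircle_coe_eq_exp, ← Circle.coe_mul, ← Real.Angle.toCircle_add,
      ← add_assoc, ← Real.Angle.coe_add, sub_eq_add_neg]
  have ha : C.IsPhase a := by
    rintro η h rfl p v
    rw [← hfe]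
    exact hfΩ _ p v
  refine ⟨⟨⟨hsm, ?_⟩, ?_, ?_⟩, LagAngle.exists_eq_prod_lieExp, a, ha,
    fun b hb => LagAngle.CalabiYau.IsPhase.unique C ha hb, ?_, ?_⟩
  · rintro ⟨q, p⟩
    obtain ⟨h, rfl⟩ := QuotientGroup.mk_surjective q
    obtain ⟨G, hG, -, hinj, -⟩ := hdiff h p
    intro z z' hzz
    refine hinj (LagAngle.mfderiv_smul_injective EH h (p : M) ?_)
    exact (hG z).symm.trans (Eq.trans hzz (hG z'))
  · rw [Module.finrank_prod, hdim]
  · rintro ⟨q, p⟩ z z'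
    obtain ⟨h, rfl⟩ := QuotientGroup.mk_surjective q
    obtain ⟨G, hG, -, -, hiso'⟩ := hdiff h p
    refine Eq.trans ?_ ((C.kform_smul hμ h (p : M) ![G z, G z']).trans (hiso' z z'))
    refine LagAngle.form_congr C.kform rfl ?_
    refine Eq.trans ?_ (LagAngle.comp_cons_two (mfderiv 𝓘(ℝ, E) 𝓘(ℝ, E) (fun q : M => h • q)
      (p : M) : E →L[ℝ] E) (G z) (G z')).symm
    exact congrArg₂ (fun u v : E => ![u, v]) (hG z) (hG z')
  · intro h η hη p hp hpU
    exact (hphase h ⟨p, hp⟩ hpU _ (hcirc h η hη _)).hasAngleAt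
  · intro h₀ p₀ hp₀ hpU
    have : IsManifold 𝓘(ℝ, EH) ∞ H := LieGroup.toContMDiffMul.toIsManifold
    have : IsManifold 𝓘(ℝ, EH) 1 H := IsManifold.of_le (n := ∞) (by simp)
    have : IsManifold 𝓘(ℝ, EQ) 1 (H ⧸ K) := IsManifold.of_le (n := ∞) (by simp)
    have : CompleteSpace EH := FiniteDimensional.complete ℝ EH
    obtain ⟨s, -, hs, hπs⟩ := LagAngle.exists_local_section h₀ (hQ.1 h₀) (hQ.2 h₀)
    have hs' : ∀ᶠ q in nhds (h₀ : H ⧸ K), ContMDiffAt 𝓘(ℝ, EQ) 𝓘(ℝ, EH) 1 s q :=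
      (contMDiffAt_iff_contMDiffAt_nhds (by simp)).1 (hs.of_le (by simp))
    obtain ⟨O, hO, hOo, hh₀⟩ := eventually_nhds_iff.1 (hs'.and hπs)
    -- These expressions are chosen without any continuity in `h`. Continuity of the local angle
    -- comes from `hcirc`, which replaces them by the continuous character along the section `s`.
    choose η hη using LagAngle.exists_eq_prod_lieExp (EH := EH) (H := H)
    let W : Set ((H ⧸ K) × V) := {x | x.1 ∈ O ∧ Set.inclusion hVL x.2 ∈ U}
    let θc : (H ⧸ K) × V → Real.Angle := fun x =>
      ((a (η (s x.1)).sum - Real.pi / 2 * Module.finrank ℝ EQ : ℝ) : Real.Angle) +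
        θ (Set.inclusion hVL x.2)
    have hW : IsOpen W := (hOo.preimage continuous_fst).inter
      (hθ.1.preimage ((continuous_inclusion hVL).comp continuous_snd))
    refine ⟨W, θc, ⟨hh₀, hpU⟩, fun x hx => ⟨hx.2, s x.1, η (s x.1), ((hO _ hx.1).2).symm,
      hη _, rfl⟩, C.isAngleOn_of_continuousOn hsm hW ?_ ?_⟩
    · have h1 : ContinuousOn (fun x : (H ⧸ K) × V => f (s x.1)) W := fun x hx =>
        (hfc.continuousAt.comp (ContinuousAt.comp (hO _ hx.1).1.continuousAt
          continuous_fst.continuousAt)).continuousWithinAt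
      have h2 : ContinuousOn (fun x : (H ⧸ K) × V =>
          ((θ (Set.inclusion hVL x.2)).toCircle : ℂ)) W :=
        ContinuousOn.comp (g := fun l => ((θ l).toCircle : ℂ))
          (f := fun x : (H ⧸ K) × V => Set.inclusion hVL x.2)
          (hθ.continuousOn_toCircle hLag.1 hLag.2.1)
          ((continuous_inclusion hVL).comp continuous_snd).continuousOn fun x hx => hx.2
      have h3 := h1.mul ((continuousOn_const (c := ((((-(Real.pi / 2 * Module.finrank ℝ EQ) : ℝ) :
        Real.Angle)).toCircle : ℂ))).mul h2)
      refine h3.congr fun x _ => ?_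
      refine (hcirc (s x.1) (η (s x.1)) (hη _) (θ (Set.inclusion hVL x.2))).trans ?_
      rw [Real.Angle.toCircle_add, Circle.coe_mul]
      rfl
    · intro x hx
      have h1 := hphase (s x.1) x.2 hx.2 (θc x) (hcirc (s x.1) (η (s x.1)) (hη _) _)
      rw [(hO _ hx.1).2] at h1
      exact h1
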